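/- **Terms.** Terms are built from variables, names and function symbols. For all $n$ there are tuples $(T_1,\dots,T_n)$ and projections, with rules $\pi^n_i((x_1,\dots,x_n))\to x_i$. The *private* symbols are $\mathsf{unseal},\mathsf{get\_entry},\mathsf{state},\mathsf{tpm},\mathsf{cpu},\mathsf{smram},\mathsf{drt},\mathsf{tpm\_ch},\mathsf{set\_pcr},\mathsf{is\_small},\mathsf{is\_big}$ and the constants $\mathsf{tpm\_acc},\mathsf{cpu\_acc},\mathsf{cpu\_tpm}$ and infinitely many program entry points, among them $T_{init},T_{pp},T_{stm}$. All other symbols are public; these include the channel $\mathsf{os}$, the register reset values $p_s$ and $p_d$, $\mathsf{true},\mathsf{false},\bot$ and the message tags. Write $\mathsf{chain}(v_0)=v_0$, $\mathsf{chain}(v_0,\dots,v_{i+1})=\mathsf h((\mathsf{chain}(v_0,\dots,v_i),v_{i+1}))$. **Theories.** $\mathcal E_{drt}$ consists of the projection rules and the following rules, where $S=\mathsf{state}(\mathsf{tpm}(p),\mathsf{cpu}(i,c),\mathsf{smram}(m,s),\mathsf{drt}(a,q,l))$, all letters are variables unless a restriction on them is stated, $S[p:=v]$ denotes $S$ with the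 component $p$ replaced by $v$, and only those of the inner terms $\mathsf{tpm}(\cdot),\mathsf{cpu}(\cdot),\mathsf{smram}(\cdot),\mathsf{drt}(\cdot)$ that a rule reads, changes or restricts need have the displayed form: $\mathsf{sdec}(\mathsf{senc}(x,k),k)\to x$; $\mathsf{unseal}(\mathsf{seal}(x,y),y)\to x$; $\mathsf{get\_entry}(\mathsf{prog}(x))\to x$; $\mathsf{pcr}(S)\to p$, $\mathsf{int}(S)\to i$, $\mathsf{cache}(S)\to c$, $\mathsf{stm}(S)\to m$, $\mathsf{smi}(S)\to s$, $\mathsf{init}(S)\to a$, $\mathsf{pp}(S)\to q$, $\mathsf{lock}(S)\to l$; $\mathsf{reset}(S,\mathsf{tpm\_acc},r)\to S[p:=r]$ for $r\in\{p_s,p_d\}$; $\mathsf{extend}(S,\mathsf{tpm\_acc},v)\to S[p:=\mathsf h((p,v))]$; $\mathsf{set\_pcr}(S,\mathsf{tpm\_acc},v)\to S[p:=v]$; $\mathsf{set\_int}(S,\mathsf{cpu\_acc},v)\to S[i:=v]$, and $\mathsf{set\_int}(S,z,v)\to S[i:=v]$ if $q=\mathsf{prog}(z)$, $l=\mathsf{true}$;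 $\mathsf{cache}(S,v)\to S[c:=v]$; $\mathsf{flush\_stm}(S)\to S[m:=c]$ if $l=\mathsf{false}$; $\mathsf{flush\_smi}(S)\to S[s:=c]$; $\mathsf{set\_init}(S,\mathsf{cpu\_acc},v)\to S[a:=v]$; $\mathsf{set\_pp}(S,t,v)\to S[q:=v]$ if $t=\mathsf{cpu\_acc}$, or $a=\mathsf{prog}(t)$, or $i=\mathsf{true},m=\mathsf{prog}(z_1),s=\mathsf{prog}(z_2),t=(z_1,z_2)$; $\mathsf{set\_lock}(S,t,v)\to S[l:=v]$ if $t=\mathsf{cpu\_acc}$, or $q=\mathsf{prog}(t)$, or $i=\mathsf{true},m=\mathsf{prog}(z_1),s=\mathsf{prog}(z_2),t=(z_1,z_2)$. For $b\in\mathbb N$, $\mathcal E^b_{drt}$ is $\mathcal E_{drt}$ together with $\mathsf{is\_small}(\mathsf{chain}(v_0,\dots,v_j))\to\mathsf{true}$ for $0\le j<b$, $v_0\in\{p_s,p_d\}$, and $\mathsf{is\_big}(\mathsf{chain}(v_0,\dots,v_{b+1}))\to\mathsf{true}$, where all other $v_j$ are variables. These theories are convergent; $T\!\downarrow$ is the normal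 form of $T$ and $U=_{\mathcal E}V$ means $U\!\downarrow=V\!\downarrow$. The symbols at the root of a left-hand side are called destructors. $M\vdash_{\mathcal E}T$ means that, up to $=_{\mathcal E}$, $T$ is obtained from $M$ by applying public symbols. **Processes.** $P::=0\mid P|P\mid\,!P\mid\mathsf{new}\,n;P\mid\mathsf{in}(U,A);P\mid\mathsf{out}(U,T);P\mid\mathsf{if}\,U=V\,\mathsf{then}\,P\,\mathsf{else}\,P\mid\mathsf{let}\,x=T\,\mathsf{in}\,P$, where a pattern $A$ is a variable, a test $=T$ or a tuple of patterns. A configuration $(N,M,\mathcal P)$ consists of the set of names in use, the set of terms made available to the attacker, and a multiset of processes. Restriction creates a name outside $N$; $\mathsf{if}$ compares modulo $\mathcal E$; $\mathsf{let}\,x=T$ proceeds, with $x$ replaced by $T\!\downarrow$, only if $T\!\downarrow$ contains no destructor; an output of $T$ on $U$ and an input with pattern $A$ on the same channel (modulo $\mathcal E$) synchronize with any matching substitution $\sigma$, $T=_{\mathcal E}A\sigma$, and $T$ is added to $M$ if $M\vdash_{\mathcal E}U$. We write $P\models_{\mathcal E}\mathsf{Att}(T)$ if for some closed process $Q$, without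 private symbols and without the restricted names of $P$, there is a run from $(N,\emptyset,\{P|Q\})$, $N$ being the set of free names of $P|Q$, to some $(N',M',\mathcal P')$ with $M'\vdash_{\mathcal E}T$. Further, $P\models_{\mathcal E}(\mathsf{Att}(T)\Rightarrow\Psi)$ means that, for all substitutions $\sigma$, $P\models_{\mathcal E}\mathsf{Att}(T\sigma)$ implies $\Psi\sigma$, where $\Psi$ is $\mathit{false}$ or an equation, the latter read modulo $\mathcal E$. **Protocol.** In patterns, tags and names that are already bound are tests; a missing $\mathsf{else}$ branch and a missing continuation are $0$. $\mathrm{RESET}=\mathsf{in}(ch,(\mathsf{reset\_req},n,x));\mathsf{let}\,y=\mathsf{reset}(x,\mathsf{tpm\_acc},rv)\,\mathsf{in}\,\mathsf{out}(ch,(\mathsf{reset\_resp},n,y))$. $\mathrm{EXT}=\mathsf{in}(ch,(\mathsf{extend\_req},n,x,v));\mathsf{let}\,y=\mathsf{extend}(x,\mathsf{tpm\_acc},v)\,\mathsf{in}\,\mathsf{out}(ch,(\mathsf{extend\_resp},n,y))$. $\mathrm{EXT}^b=\mathsf{in}(ch,(\mathsf{extend\_req},n,x,v));\mathsf{let}\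,p=\mathsf{pcr}(x)\,\mathsf{in}\,\mathsf{if}\,\mathsf{is\_small}(p)=\mathsf{true}\,\mathsf{then}\,(\mathsf{let}\,y=\mathsf{extend}(x,\mathsf{tpm\_acc},v)\,\mathsf{in}\,\mathsf{out}(ch,(\mathsf{extend\_resp},n,y)))\,\mathsf{else}\,(\mathsf{out}(\mathsf{os},(p,v));\mathsf{in}(\mathsf{os},p');\mathsf{if}\,\mathsf{is\_big}(p')=\mathsf{true}\,\mathsf{then}\,\mathsf{let}\,y=\mathsf{set\_pcr}(x,\mathsf{tpm\_acc},p')\,\mathsf{in}\,\mathsf{out}(ch,(\mathsf{extend\_resp},n,y)))$. $\mathrm{UNS}=\mathsf{in}(ch,(\mathsf{tag\_unseal},z));\mathsf{let}\,v=\mathsf{unseal}(z,\mathsf{pcr}(x))\,\mathsf{in}\,\mathsf{out}(ch,(\mathsf{tag\_plain},v))$. For a process $X$, $\mathrm{TPM}(X)=\,!\big((\mathsf{let}\,(ch,rv)=(\mathsf{cpu\_tpm},p_d)\,\mathsf{in}\,!\mathrm{RESET})\mid(\mathsf{let}\,(ch,rv)=(\mathsf{os},p_s)\,\mathsf{in}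\,!\mathrm{RESET})\big)\mid\,!\big((\mathsf{let}\,ch=\mathsf{cpu\_tpm}\,\mathsf{in}\,!X)\mid(\mathsf{let}\,ch=\mathsf{os}\,\mathsf{in}\,!X)\mid\,!\,\mathsf{in}(\mathsf{cpu\_tpm},(\mathsf{ext\_channel},ch));!X\big)\mid\,!\big(\mathsf{in}(\mathsf{os},x);\mathsf{if}\,\mathsf{lock}(x)=\mathsf{true}\,\mathsf{then}\,\mathsf{let}\,ch=\mathsf{tpm\_ch}(\mathsf{pp}(x))\,\mathsf{in}\,\mathrm{UNS}\,\mathsf{else}\,\mathsf{let}\,ch=\mathsf{os}\,\mathsf{in}\,\mathrm{UNS}\big)$. $\mathrm{CPU}=\,!\,\mathsf{in}(\mathsf{os},(\mathsf{drt\_req},i,q,x));\mathsf{if}\,\mathsf{lock}(x)=\mathsf{false}\,\mathsf{then}\,\mathsf{let}\,s_0'=\mathsf{set\_int}(x,\mathsf{cpu\_acc},\mathsf{false})\,\mathsf{in}\,\mathsf{let}\,s_0=\mathsf{set\_lock}(s_0',\mathsf{cpu\_acc},\mathsf{true})\,\mathsf{in}\,\mathsf{let}\,m=(\mathsf h(i),\mathsf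 h(\mathsf{stm}(x)))\,\mathsf{in}\,\mathsf{new}\,n;\mathsf{out}(\mathsf{cpu\_tpm},(\mathsf{reset\_req},n,s_0));\mathsf{in}(\mathsf{cpu\_tpm},(\mathsf{reset\_resp},n,s_1));\mathsf{out}(\mathsf{cpu\_tpm},(\mathsf{extend\_req},n,s_1,m));\mathsf{in}(\mathsf{cpu\_tpm},(\mathsf{extend\_resp},n,s_2));\mathsf{let}\,s_3=\mathsf{set\_init}(s_2,\mathsf{cpu\_acc},i)\,\mathsf{in}\,\mathsf{let}\,e=\mathsf{get\_entry}(i)\,\mathsf{in}\,\mathsf{out}(e,(n,s_3,\mathsf{tpm\_ch}(i),q));\mathsf{out}(\mathsf{cpu\_tpm},(\mathsf{ext\_channel},\mathsf{tpm\_ch}(i)));\mathsf{in}(e,(\mathsf{drt\_resp},n,s_4));\mathsf{let}\,e'=\mathsf{get\_entry}(\mathsf{pp}(s_4))\,\mathsf{in}\,\mathsf{out}(e',(s_4,\mathsf{tpm\_ch}(\mathsf{prog}(e'))));\mathsf{out}(\mathsf{cpu\_tpm},(\mathsf{ext\_channel},\mathsf{tpm\_ch}(\mathsf{prog}(e'))))$.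 $\mathrm{INIT}=\mathsf{out}(\mathsf{os},\mathsf{prog}(T_{init}));\mathsf{out}(\mathsf{os},\mathsf{prog}(T_{stm}));\mathsf{in}(T_{init},(n,x,c,q));\mathsf{let}\,m=\mathsf h(q)\,\mathsf{in}\,\mathsf{new}\,n_1;\mathsf{out}(c,(\mathsf{extend\_req},n_1,x,m));\mathsf{in}(c,(\mathsf{extend\_resp},n_1,x'));\mathsf{let}\,y=\mathsf{set\_pp}(x',T_{init},q)\,\mathsf{in}\,\mathsf{out}(T_{init},(\mathsf{drt\_resp},n,y));\mathsf{out}(\mathsf{os},y)$. $\mathrm{PP}=\mathsf{out}(\mathsf{os},\mathsf{prog}(T_{pp}));\mathsf{in}(T_{pp},(x_0,c));\mathsf{let}\,x=\mathsf{set\_int}(x_0,T_{pp},\mathsf{true})\,\mathsf{in}\,\mathsf{out}(\mathsf{os},x);\mathsf{in}(\mathsf{os},z);\mathsf{in}(\mathsf{os},w);\mathsf{out}(c,(\mathsf{tag\_unseal},z));\mathsf{in}(c,(\mathsf{tag\_plain},k));\mathsf{let}\,u=\mathsf{sdec}(w,k)\,\mathsf{in}\,\mathsf{out}(\mathsf{os},u);\mathsf{new}\,r;\mathsf{out}(c,(\mathsf{extend\_req},r,x,\bot));\mathsf{in}(c,(\mathsf{extend\_resp},r,x'));\mathsf{let}\,y=\mathsf{set\_lock}(x',T_{pp},\mathsf{false})\,\mathsf{in}\,\mathsf{out}(\mathsf{os},y)$.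 With $\mathsf{hchain}=\mathsf{chain}(p_d,(\mathsf h(\mathsf{prog}(T_{init})),\mathsf h(\mathsf{prog}(T_{stm}))),\mathsf h(\mathsf{prog}(T_{pp})))$: $\mathrm{DATA}=\mathsf{new}\,k_{pp};\mathsf{new}\,hi_{pp};\mathsf{out}(\mathsf{os},\mathsf{senc}(hi_{pp},k_{pp}));\mathsf{let}\,z=\mathsf{seal}(k_{pp},\mathsf{hchain})\,\mathsf{in}\,\mathsf{out}(\mathsf{os},z)$. $\mathrm{SETUP}=\mathsf{in}(\mathsf{os},m);\mathsf{in}(\mathsf{os},s);\mathsf{out}(\mathsf{os},\mathsf{state}(\mathsf{tpm}(p_s),\mathsf{cpu}(\mathsf{true},\bot),\mathsf{smram}(m,s),\mathsf{drt}(\bot,\bot,\mathsf{false})));\mathsf{in}(\mathsf{os},i);\mathsf{in}(\mathsf{os},q);\mathsf{in}(\mathsf{os},x);\mathsf{out}(\mathsf{os},(\mathsf{drt\_req},i,q,x))$. $\mathrm{EXEC}=\mathrm{CPU}\mid\,!\mathrm{INIT}\mid\mathrm{SETUP}\mid\mathrm{DATA}\mid\,!\mathrm{PP}$, $\mathrm{DRT}=\mathrm{TPM}(\mathrm{EXT})\mid\mathrm{EXEC}$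 and $\mathrm{DRT}^b=\mathrm{TPM}(\mathrm{EXT}^b)\mid\mathrm{EXEC}$. **Properties.** $\Phi_{sec}$ is $\mathsf{Att}(k_{pp})\Rightarrow\mathit{false}$, where $k_{pp}$ stands for any name created by the restriction of $k_{pp}$ in $\mathrm{DATA}$; $\Phi_{int}$ is $$\mathsf{Att}\big(\mathsf{state}(\mathsf{tpm}(\mathsf{hchain}),\mathsf{cpu}(x,y),\mathsf{smram}(x_{stm},x_{smi}),\mathsf{drt}(x_{init},x_{pp},\mathsf{true}))\big)\Rightarrow(x_{init},x_{pp},x_{stm})=(\mathsf{prog}(T_{init}),\mathsf{prog}(T_{pp}),\mathsf{prog}(T_{stm})).$$ **Theorem.** For every natural number $b\ge 2$ and every $\Phi\in\{\Phi_{sec},\Phi_{int}\}$, $$\mathrm{DRT}\models_{\mathcal E_{drt}}\Phi\quad\Longleftrightarrow\quad \mathrm{DRT}^b\models_{\mathcal E^b_{drt}}\Phi .$$ -/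

import Mathlib

namespace Drt

/-! ### Signature -/

/-- Function symbols. `entry i` are the private constants that serve as entry points of programs
(countably many, as there are countably many processes); `tup n` builds sequences of length `n` and
`proj n i` takes them apart; `cacheR` reads the cache and `cacheW` writes it. -/
inductive Sym
  -- public constants: channel, values, message tags
  | os | ps | pd | tt | ff | bot
  | reset_req | reset_resp | extend_req | extend_resp | ext_channel
  | tag_open | tag_plain | drt_req | drt_resp
  -- data
  | h | senc | sdec | sealData | unsealData
  | tup (n : ℕ) | proj (n : ℕ) (i : Fin n)
  -- programs
  | prog | get_entry | entry (i : ℕ)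
  -- platform state
  | state | tpm | cpu | smram | drt
  | tpm_acc | cpu_acc
  -- reading the state
  | pcr | int | cacheR | stm | smi | init | pp | lock
  -- writing the state
  | reset | extend | set_pcr | set_int | cacheW | flush_stm | flush_smi
  | set_init | set_pp | set_lock
  -- private channels
  | cpu_tpm | tpm_ch
  -- bounding the register
  | is_small | is_big
  deriving DecidableEq

@[reducible] def Sym.arity : Sym → ℕ
  | .h | .prog | .get_entry | .tpm | .tpm_ch | .is_small | .is_big => 1
  | .pcr | .int | .cacheR | .stm | .smi | .init | .pp | .lock => 1
  | .flush_stm | .flush_smi => 1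
  | .senc | .sdec | .sealData | .unsealData | .cpu | .smram | .cacheW => 2
  | .drt | .reset | .extend | .set_pcr | .set_int | .set_init | .set_pp | .set_lock => 3
  | .state => 4
  | .tup n => n
  | .proj _ _ => 1
  | _ => 0

/-- The private symbols; all the others are public. -/
def Sym.priv : Set Sym :=
  {f | (∃ i, f = .entry i) ∨
    f ∈ ({.unsealData, .get_entry, .state, .tpm, .cpu, .smram, .drt, .tpm_acc, .cpu_acc,
      .cpu_tpm, .tpm_ch, .set_pcr, .is_small, .is_big} : Set Sym)}

/-! ### Terms -/

/-- Variables: those used in the protocol, and infinitely many others. -/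
inductive Var
  | ch | rv | nonce | pf_state | new_st | v | blob | pcr | val | new_pcr
  | init | pp | s0' | s0 | measure | s1 | s2 | s3 | einit | new_state | epp
  | pf_st | tpmc | nonce1 | ext_st
  | pf_state0 | xblob | xenc | xk | mess | rand | exts | ends
  | kpp | hipp | sealed_key | xstm | xsmi | xint | xcache | xinit | xpp
  | other (n : ℕ)
  deriving DecidableEq

/-- The origin of a name: the attacker, or one of the name restrictions of the protocol. -/
inductive Label
  | att | kpp | hipp | nonce | nonce1 | rand
  deriving DecidableEq

/-- Names. The name that a restriction creates carries the label of the restriction, so that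
a restricted name can be referred to in a security property. -/
structure Name where
  label : Label
  idx : ℕ
  deriving DecidableEq

inductive Term
  | var (x : Var)
  | name (n : Name)
  | app (f : Sym) (args : Fin f.arity → Term)

abbrev Subst := Var → Term

def Term.subst (σ : Subst) : Term → Term
  | .var x => σ x
  | .name n => .name n
  | .app f args => .app f fun i => (args i).subst σ

/-- The free variables of a term. -/
def Term.fv : Term → Set Var
  | .var x => {x}
  | .name _ => ∅
  | .app _ args => ⋃ i, (args i).fv

/-- The names that occur in a term. -/
def Term.names : Term → Set Name
  | .var _ => ∅
  | .name n => {n}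
  | .app _ args => ⋃ i, (args i).names

/-- The function symbols that occur in a term. -/
def Term.sig : Term → Set Sym
  | .var _ => ∅
  | .name _ => ∅
  | .app f args => {f} ∪ ⋃ i, (args i).sig

namespace Term

abbrev os : Term := .app .os ![]
abbrev ps : Term := .app .ps ![]
abbrev pd : Term := .app .pd ![]
abbrev tt : Term := .app .tt ![]
abbrev ff : Term := .app .ff ![]
abbrev bot : Term := .app .bot ![]
abbrev reset_req : Term := .app .reset_req ![]
abbrev reset_resp : Term := .app .reset_resp ![]
abbrev extend_req : Term := .app .extend_req ![]
abbrev extend_resp : Term := .app .extend_resp ![]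
abbrev ext_channel : Term := .app .ext_channel ![]
abbrev tag_open : Term := .app .tag_open ![]
abbrev tag_plain : Term := .app .tag_plain ![]
abbrev drt_req : Term := .app .drt_req ![]
abbrev drt_resp : Term := .app .drt_resp ![]
abbrev h (t : Term) : Term := .app .h ![t]
abbrev senc (t k : Term) : Term := .app .senc ![t, k]
abbrev sdec (t k : Term) : Term := .app .sdec ![t, k]
abbrev sealData (t p : Term) : Term := .app .sealData ![t, p]
abbrev unsealData (t p : Term) : Term := .app .unsealData ![t, p]
abbrev tup {n : ℕ} (ts : Fin n → Term) : Term := .app (.tup n) ts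
abbrev proj {n : ℕ} (i : Fin n) (t : Term) : Term := .app (.proj n i) ![t]
abbrev prog (t : Term) : Term := .app .prog ![t]
abbrev get_entry (t : Term) : Term := .app .get_entry ![t]
abbrev entry (i : ℕ) : Term := .app (.entry i) ![]
/-- The entry points of the trusted programs. -/
abbrev Tinit : Term := entry 0
abbrev Tpp : Term := entry 1
abbrev Tstm : Term := entry 2
abbrev state (a b c d : Term) : Term := .app .state ![a, b, c, d]
abbrev tpm (a : Term) : Term := .app .tpm ![a]
abbrev cpu (a b : Term) : Term := .app .cpu ![a, b]
abbrev smram (a b : Term) : Term := .app .smram ![a, b]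
abbrev drt (a b c : Term) : Term := .app .drt ![a, b, c]
abbrev tpm_acc : Term := .app .tpm_acc ![]
abbrev cpu_acc : Term := .app .cpu_acc ![]
abbrev pcr (s : Term) : Term := .app .pcr ![s]
abbrev int (s : Term) : Term := .app .int ![s]
abbrev cacheR (s : Term) : Term := .app .cacheR ![s]
abbrev stm (s : Term) : Term := .app .stm ![s]
abbrev smi (s : Term) : Term := .app .smi ![s]
abbrev init (s : Term) : Term := .app .init ![s]
abbrev pp (s : Term) : Term := .app .pp ![s]
abbrev lock (s : Term) : Term := .app .lock ![s]
abbrev reset (s a v : Term) : Term := .app .reset ![s, a, v]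
abbrev extend (s a v : Term) : Term := .app .extend ![s, a, v]
abbrev set_pcr (s a v : Term) : Term := .app .set_pcr ![s, a, v]
abbrev set_int (s a v : Term) : Term := .app .set_int ![s, a, v]
abbrev cacheW (s v : Term) : Term := .app .cacheW ![s, v]
abbrev flush_stm (s : Term) : Term := .app .flush_stm ![s]
abbrev flush_smi (s : Term) : Term := .app .flush_smi ![s]
abbrev set_init (s a v : Term) : Term := .app .set_init ![s, a, v]
abbrev set_pp (s a v : Term) : Term := .app .set_pp ![s, a, v]
abbrev set_lock (s a v : Term) : Term := .app .set_lock ![s, a, v]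
abbrev cpu_tpm : Term := .app .cpu_tpm ![]
abbrev tpm_ch (t : Term) : Term := .app .tpm_ch ![t]
abbrev is_small (t : Term) : Term := .app .is_small ![t]
abbrev is_big (t : Term) : Term := .app .is_big ![t]

/-- `chain v₀ [v₁, …, vₙ] = h((… h((v₀, v₁)) …, vₙ))`. -/
def chain (v₀ : Term) (vs : List Term) : Term := vs.foldl (fun p v => h (tup ![p, v])) v₀

end Term

/-! ### Rewriting -/

/-- A theory is given by the instances `lσ → rσ` of its rewrite rules `l → r`: in the rules
below, the universally quantified terms play the role of the variables of the rule. -/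
abbrev Theory := Term → Term → Prop

/-- Rewriting in one step, in any context. -/
inductive Step (E : Theory) : Term → Term → Prop
  | root {l r : Term} : E l r → Step E l r
  | arg {f : Sym} {args : Fin f.arity → Term} {i : Fin f.arity} {t : Term} :
      Step E (args i) t → Step E (.app f args) (.app f (Function.update args i t))

/-- `W` is a normal form of `T`. -/
def IsNF (E : Theory) (T W : Term) : Prop :=
  Relation.ReflTransGen (Step E) T W ∧ ∀ W', ¬ Step E W W'

open Classical in
/-- The normal form of `T` (the theories below are convergent: it exists and is unique). -/
noncomputable def nf (E : Theory) (T : Term) : Term :=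
  if H : ∃ W, IsNF E T W then H.choose else T

/-- Equality modulo the theory. -/
def EqE (E : Theory) (U V : Term) : Prop := nf E U = nf E V

/-- Destructors are the symbols at the root of the left-hand sides of the rewrite rules. -/
def destructors (E : Theory) : Set Sym := {f | ∃ args r, E (.app f args) r}

/-- Deduction: what an attacker can compute from `S`. -/
inductive Ded (E : Theory) (S : Set Term) : Term → Prop
  | mem {T' T : Term} : T' ∈ S → EqE E T' T → Ded E S T
  | app {f : Sym} {args : Fin f.arity → Term} {T : Term} :
      f ∉ Sym.priv → (∀ i, Ded E S (args i)) → EqE E (.app f args) T → Ded E S T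

/-! ### The theories of the platform -/

open Term in
/-- Sequences. -/
inductive Etup : Theory
  | proj {n : ℕ} (i : Fin n) (ts : Fin n → Term) : Etup (proj i (tup ts)) (ts i)

open Term in
inductive Edata : Theory
  | sdec (v k : Term) : Edata (sdec (senc v k) k) v
  | unsealData (v p : Term) : Edata (unsealData (sealData v p) p) v

open Term in
inductive Eprog : Theory
  | get_entry (x : Term) : Eprog (get_entry (prog x)) x

open Term in
inductive Estate : Theory
  -- read access
  | pcr (y x₁ x₂ x₃ : Term) : Estate (pcr (state (tpm y) x₁ x₂ x₃)) y
  | int (x₁ y₁ y₂ x₂ x₃ : Term) : Estate (int (state x₁ (cpu y₁ y₂) x₂ x₃)) y₁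
  | cacheR (x₁ y₁ y₂ x₂ x₃ : Term) : Estate (cacheR (state x₁ (cpu y₁ y₂) x₂ x₃)) y₂
  | stm (x₁ x₂ y₁ y₂ x₃ : Term) : Estate (stm (state x₁ x₂ (smram y₁ y₂) x₃)) y₁
  | smi (x₁ x₂ y₁ y₂ x₃ : Term) : Estate (smi (state x₁ x₂ (smram y₁ y₂) x₃)) y₂
  | init (x₁ x₂ x₃ y₁ y₂ y₃ : Term) : Estate (init (state x₁ x₂ x₃ (drt y₁ y₂ y₃))) y₁
  | pp (x₁ x₂ x₃ y₁ y₂ y₃ : Term) : Estate (pp (state x₁ x₂ x₃ (drt y₁ y₂ y₃))) y₂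
  | lock (x₁ x₂ x₃ y₁ y₂ y₃ : Term) : Estate (lock (state x₁ x₂ x₃ (drt y₁ y₂ y₃))) y₃
  -- write access: the register
  | reset_ps (y x₁ x₂ x₃ : Term) :
      Estate (reset (state (tpm y) x₁ x₂ x₃) tpm_acc ps) (state (tpm ps) x₁ x₂ x₃)
  | reset_pd (y x₁ x₂ x₃ : Term) :
      Estate (reset (state (tpm y) x₁ x₂ x₃) tpm_acc pd) (state (tpm pd) x₁ x₂ x₃)
  | extend (y x₁ x₂ x₃ v : Term) :
      Estate (extend (state (tpm y) x₁ x₂ x₃) tpm_acc v)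
        (state (tpm (h (tup ![y, v]))) x₁ x₂ x₃)
  | set_pcr (y x₁ x₂ x₃ v : Term) :
      Estate (set_pcr (state (tpm y) x₁ x₂ x₃) tpm_acc v) (state (tpm v) x₁ x₂ x₃)
  -- write access: interrupts
  | set_int_cpu (x₁ y₁ y₂ x₂ x₃ v : Term) :
      Estate (set_int (state x₁ (cpu y₁ y₂) x₂ x₃) cpu_acc v) (state x₁ (cpu v y₂) x₂ x₃)
  | set_int_pp (x₁ y z x₂ z₁ z₂ v : Term) :
      Estate (set_int (state x₁ (cpu y z) x₂ (drt z₁ (prog z₂) tt)) z₂ v)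
        (state x₁ (cpu v z) x₂ (drt z₁ (prog z₂) tt))
  -- write access: cache
  | cacheW (x₁ y₁ y₂ x₂ x₃ v : Term) :
      Estate (cacheW (state x₁ (cpu y₁ y₂) x₂ x₃) v) (state x₁ (cpu y₁ v) x₂ x₃)
  | flush_stm (x₁ y₁ v z₁ z₂ w₁ w₂ : Term) :
      Estate (flush_stm (state x₁ (cpu y₁ v) (smram z₁ z₂) (drt w₁ w₂ ff)))
        (state x₁ (cpu y₁ v) (smram v z₂) (drt w₁ w₂ ff))
  | flush_smi (x₁ y₁ v z₁ z₂ x₂ : Term) :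
      Estate (flush_smi (state x₁ (cpu y₁ v) (smram z₁ z₂) x₂))
        (state x₁ (cpu y₁ v) (smram z₁ v) x₂)
  -- write access: loaded programs and lock
  | set_init (x₁ x₂ x₃ y₁ y₂ y₃ v : Term) :
      Estate (set_init (state x₁ x₂ x₃ (drt y₁ y₂ y₃)) cpu_acc v) (state x₁ x₂ x₃ (drt v y₂ y₃))
  | set_pp_cpu (x₁ x₂ x₃ y₁ y₂ y₃ v : Term) :
      Estate (set_pp (state x₁ x₂ x₃ (drt y₁ y₂ y₃)) cpu_acc v) (state x₁ x₂ x₃ (drt y₁ v y₃))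
  | set_pp_init (x₁ x₂ x₃ y₁ y₂ y₃ v : Term) :
      Estate (set_pp (state x₁ x₂ x₃ (drt (prog y₁) y₂ y₃)) y₁ v)
        (state x₁ x₂ x₃ (drt (prog y₁) v y₃))
  | set_pp_smi (x z z₁ z₂ y₁ y₂ y₃ v : Term) :
      Estate (set_pp (state x (cpu tt z) (smram (prog z₁) (prog z₂)) (drt y₁ y₂ y₃))
          (tup ![z₁, z₂]) v)
        (state x (cpu tt z) (smram (prog z₁) (prog z₂)) (drt y₁ v y₃))
  | set_lock_cpu (x₁ x₂ x₃ y₁ y₂ y₃ v : Term) :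
      Estate (set_lock (state x₁ x₂ x₃ (drt y₁ y₂ y₃)) cpu_acc v) (state x₁ x₂ x₃ (drt y₁ y₂ v))
  | set_lock_pp (x₁ x₂ x₃ y₁ y₂ y₃ v : Term) :
      Estate (set_lock (state x₁ x₂ x₃ (drt y₁ (prog y₂) y₃)) y₂ v)
        (state x₁ x₂ x₃ (drt y₁ (prog y₂) v))
  | set_lock_smi (x z z₁ z₂ y₁ y₂ y₃ v : Term) :
      Estate (set_lock (state x (cpu tt z) (smram (prog z₁) (prog z₂)) (drt y₁ y₂ y₃))
          (tup ![z₁, z₂]) v)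
        (state x (cpu tt z) (smram (prog z₁) (prog z₂)) (drt y₁ y₂ v))

open Term in
/-- A register is small if it records fewer than `b` extensions of `ps` or `pd`, and a term is big
if it is a chain of at least `b + 1` extensions. -/
inductive Ebound (b : ℕ) : Theory
  | small_ps (vs : List Term) : vs.length < b → Ebound b (is_small (chain ps vs)) tt
  | small_pd (vs : List Term) : vs.length < b → Ebound b (is_small (chain pd vs)) tt
  | big (v₀ : Term) (vs : List Term) : vs.length = b + 1 → Ebound b (is_big (chain v₀ vs)) tt

/-- The theory of the platform. -/
def Edrt : Theory := fun l r => Etup l r ∨ Edata l r ∨ Eprog l r ∨ Estate l r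

/-- The theory of the platform with bounded extensions. -/
def Edrtb (b : ℕ) : Theory := fun l r => Edrt l r ∨ Ebound b l r

/-! ### Processes -/

/-- Input patterns: a variable to be bound, a term that has to be matched, or a sequence of
patterns. -/
inductive Pat
  | bind (x : Var)
  | eq (t : Term)
  | tup {n : ℕ} (ps : Fin n → Pat)

/-- The variables that a pattern binds. -/
def Pat.bv : Pat → Finset Var
  | .bind x => {x}
  | .eq _ => ∅
  | .tup ps => Finset.univ.biUnion fun i => (ps i).bv

/-- The pattern as a term. -/
def Pat.toTerm : Pat → Term
  | .bind x => .var x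
  | .eq t => t
  | .tup ps => Term.tup fun i => (ps i).toTerm

def Pat.subst (σ : Subst) : Pat → Pat
  | .bind x => .bind x
  | .eq t => .eq (t.subst σ)
  | .tup ps => .tup fun i => (ps i).subst σ

/-- Processes. In `new l x P` the variable `x` stands for the restricted name in `P`, and `l` is
its label. -/
inductive Proc
  | nil
  | par (P Q : Proc)
  | repl (P : Proc)
  | new (l : Label) (x : Var) (P : Proc)
  | inp (U : Term) (A : Pat) (P : Proc)
  | out (U T : Term) (P : Proc)
  | ite (U V : Term) (P Q : Proc)
  | letin (x : Var) (T : Term) (P : Proc)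

/-- `σ` without its action on the variables in `s`. -/
def Subst.drop (σ : Subst) (s : Finset Var) : Subst := fun x => if x ∈ s then .var x else σ x

/-- The substitution `[x ↦ T]`. -/
def Subst.single (x : Var) (T : Term) : Subst := fun y => if y = x then T else .var y

/-- Substitution in processes. It is only ever applied to closed terms, so that no variable can
be captured. -/
def Proc.subst (σ : Subst) : Proc → Proc
  | .nil => .nil
  | .par P Q => .par (P.subst σ) (Q.subst σ)
  | .repl P => .repl (P.subst σ)
  | .new l x P => .new l x (P.subst (σ.drop {x}))
  | .inp U A P => .inp (U.subst σ) (A.subst (σ.drop A.bv)) (P.subst (σ.drop A.bv))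
  | .out U T P => .out (U.subst σ) (T.subst σ) (P.subst σ)
  | .ite U V P Q => .ite (U.subst σ) (V.subst σ) (P.subst σ) (Q.subst σ)
  | .letin x T P => .letin x (T.subst σ) (P.subst (σ.drop {x}))

/-- The free variables of a process. -/
def Proc.fv : Proc → Set Var
  | .nil => ∅
  | .par P Q => P.fv ∪ Q.fv
  | .repl P => P.fv
  | .new _ x P => P.fv \ {x}
  | .inp U A P => U.fv ∪ ((A.toTerm.fv ∪ P.fv) \ A.bv)
  | .out U T P => U.fv ∪ T.fv ∪ P.fv
  | .ite U V P Q => U.fv ∪ V.fv ∪ P.fv ∪ Q.fv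
  | .letin x T P => T.fv ∪ (P.fv \ {x})

/-- The names that occur in a process; they are free, since restrictions bind variables. -/
def Proc.names : Proc → Set Name
  | .nil => ∅
  | .par P Q => P.names ∪ Q.names
  | .repl P => P.names
  | .new _ _ P => P.names
  | .inp U A P => U.names ∪ A.toTerm.names ∪ P.names
  | .out U T P => U.names ∪ T.names ∪ P.names
  | .ite U V P Q => U.names ∪ V.names ∪ P.names ∪ Q.names
  | .letin _ T P => T.names ∪ P.names

/-- The function symbols of a pattern, apart from those that build its sequences, which are
public. -/
def Pat.sig : Pat → Set Sym
  | .bind _ => ∅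
  | .eq t => t.sig
  | .tup ps => ⋃ i, (ps i).sig

/-- The function symbols of a process. -/
def Proc.sig : Proc → Set Sym
  | .nil => ∅
  | .par P Q => P.sig ∪ Q.sig
  | .repl P => P.sig
  | .new _ _ P => P.sig
  | .inp U A P => U.sig ∪ A.sig ∪ P.sig
  | .out U T P => U.sig ∪ T.sig ∪ P.sig
  | .ite U V P Q => U.sig ∪ V.sig ∪ P.sig ∪ Q.sig
  | .letin _ T P => T.sig ∪ P.sig

/-- The labels of the restrictions in a process. -/
def Proc.labels : Proc → Set Label
  | .nil => ∅
  | .par P Q => P.labels ∪ Q.labels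
  | .repl P => P.labels
  | .new l _ P => {l} ∪ P.labels
  | .inp _ _ P => P.labels
  | .out _ _ P => P.labels
  | .ite _ _ P Q => P.labels ∪ Q.labels
  | .letin _ _ P => P.labels

/-- A configuration: the names in use, the terms made available to the attacker, and the processes
running in parallel. -/
structure Config where
  names : Set Name
  know : Set Term
  procs : Multiset Proc

/-- The operational semantics. Messages and values of `let` are substituted in normal form; all
comparisons of terms are modulo the theory. A message sent on a channel becomes available to the
attacker if the latter can deduce the channel. -/
inductive Red (E : Theory) : Config → Config → Prop
  | nil {N M Ps} : Red E ⟨N, M, .nil ::ₘ Ps⟩ ⟨N, M, Ps⟩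
  | bang {N M Ps P} : Red E ⟨N, M, .repl P ::ₘ Ps⟩ ⟨N, M, P ::ₘ .repl P ::ₘ Ps⟩
  | par {N M Ps P Q} : Red E ⟨N, M, .par P Q ::ₘ Ps⟩ ⟨N, M, P ::ₘ Q ::ₘ Ps⟩
  | new {N M Ps l x P} {n : Name} : n.label = l → n ∉ N →
      Red E ⟨N, M, .new l x P ::ₘ Ps⟩
        ⟨N ∪ {n}, M, P.subst (Subst.single x (.name n)) ::ₘ Ps⟩
  | comm {N M Ps U T P U' A Q} {σ : Subst} : EqE E U U' →
      (∀ x ∈ A.bv, nf E (σ x) = σ x) → (∀ x ∉ A.bv, σ x = .var x) →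
      EqE E T (A.toTerm.subst σ) →
      Red E ⟨N, M, .out U T P ::ₘ .inp U' A Q ::ₘ Ps⟩
        ⟨N, M ∪ {T' | T' = T ∧ Ded E M U}, P ::ₘ Q.subst σ ::ₘ Ps⟩
  | ite_true {N M Ps U V P Q} : EqE E U V →
      Red E ⟨N, M, .ite U V P Q ::ₘ Ps⟩ ⟨N, M, P ::ₘ Ps⟩
  | ite_false {N M Ps U V P Q} : ¬ EqE E U V →
      Red E ⟨N, M, .ite U V P Q ::ₘ Ps⟩ ⟨N, M, Q ::ₘ Ps⟩
  | letin {N M Ps x T P} : Disjoint (nf E T).sig (destructors E) →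
      Red E ⟨N, M, .letin x T P ::ₘ Ps⟩
        ⟨N, M, P.subst (Subst.single x (nf E T)) ::ₘ Ps⟩

/-- Attacker processes: closed processes without private symbols and without the restricted names
of the protocol. -/
def Attacker (Q : Proc) : Prop :=
  Q.fv = ∅ ∧ Q.sig ∩ Sym.priv = ∅ ∧ (∀ n ∈ Q.names, n.label = .att) ∧ ∀ l ∈ Q.labels, l = .att

/-- `P ⊨ Att(T)`: an attacker can learn `T` by interacting with `P`. -/
def Att (E : Theory) (P : Proc) (T : Term) : Prop :=
  ∃ Q, Attacker Q ∧ ∃ C : Config,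
    Relation.ReflTransGen (Red E) ⟨(Proc.par P Q).names, ∅, {.par P Q}⟩ C ∧ Ded E C.know T

/-- Correspondence assertions `Att(T) ⟹ false` (`concl = none`) and `Att(T) ⟹ U = V`
(`concl = some (U, V)`). -/
structure Assertion where
  prem : Term
  concl : Option (Term × Term)

/-- `Φσ` for the conclusion `Φ` of an assertion. -/
def holdsConcl (E : Theory) (σ : Subst) : Option (Term × Term) → Prop
  | none => False
  | some (U, V) => EqE E (U.subst σ) (V.subst σ)

/-- `P` satisfies an assertion. -/
def SatAssertion (E : Theory) (P : Proc) (A : Assertion) : Prop :=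
  ∀ σ : Subst, Att E P (A.prem.subst σ) → holdsConcl E σ A.concl

/-- A property is a family of correspondence assertions, all of which have to be satisfied. -/
abbrev Property := Set Assertion

def Sat (E : Theory) (P : Proc) (Φ : Property) : Prop := ∀ A ∈ Φ, SatAssertion E P A

/-! ### The protocol -/

abbrev V (x : Var) : Term := .var x

/-- Reset requests on `ch`, with reset value `rv`. -/
def pcrReset : Proc :=
  .inp (V .ch) (.tup ![.eq .reset_req, .bind .nonce, .bind .pf_state]) <|
  .letin .new_st (.reset (V .pf_state) .tpm_acc (V .rv)) <|
  .out (V .ch) (.tup ![.reset_resp, V .nonce, V .new_st]) .nil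

def tpmReset : Proc :=
  .par
    (.letin .ch .cpu_tpm <| .letin .rv .pd <| .repl pcrReset)
    (.letin .ch .os <| .letin .rv .ps <| .repl pcrReset)

def pcrExtend : Proc :=
  .inp (V .ch) (.tup ![.eq .extend_req, .bind .nonce, .bind .pf_state, .bind .v]) <|
  .letin .new_st (.extend (V .pf_state) .tpm_acc (V .v)) <|
  .out (V .ch) (.tup ![.extend_resp, V .nonce, V .new_st]) .nil

def pcrExtendSmall : Proc :=
  .letin .new_st (.extend (V .pf_state) .tpm_acc (V .val)) <|
  .out (V .ch) (.tup ![.extend_resp, V .nonce, V .new_st]) .nil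

def pcrExtendBig : Proc :=
  .out .os (.tup ![V .pcr, V .val]) <|
  .inp .os (.bind .new_pcr) <|
  .ite (.is_big (V .new_pcr)) .tt
    (.letin .new_st (.set_pcr (V .pf_state) .tpm_acc (V .new_pcr)) <|
      .out (V .ch) (.tup ![.extend_resp, V .nonce, V .new_st]) .nil)
    .nil

def pcrExtendB : Proc :=
  .inp (V .ch) (.tup ![.eq .extend_req, .bind .nonce, .bind .pf_state, .bind .val]) <|
  .letin .pcr (.pcr (V .pf_state)) <|
  .ite (.is_small (V .pcr)) .tt pcrExtendSmall pcrExtendBig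

def tpmExtend (ext : Proc) : Proc :=
  .par (.letin .ch .cpu_tpm <| .repl ext) <|
  .par (.letin .ch .os <| .repl ext) <|
  .repl (.inp .cpu_tpm (.tup ![.eq .ext_channel, .bind .ch]) <| .repl ext)

def unsealProc : Proc :=
  .inp (V .ch) (.tup ![.eq .tag_open, .bind .blob]) <|
  .letin .v (.unsealData (V .blob) (.pcr (V .pf_state))) <|
  .out (V .ch) (.tup ![.tag_plain, V .v]) .nil

def tpmUnseal : Proc :=
  .inp .os (.bind .pf_state) <|
  .ite (.lock (V .pf_state)) .tt
    (.letin .ch (.tpm_ch (.pp (V .pf_state))) unsealProc)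
    (.letin .ch .os unsealProc)

/-- The trusted platform module whose extension requests are handled by `ext`. -/
def tpmProc (ext : Proc) : Proc :=
  .par (.repl tpmReset) <| .par (.repl (tpmExtend ext)) (.repl tpmUnseal)

def cpuProc : Proc :=
  .repl <|
  .inp .os (.tup ![.eq .drt_req, .bind .init, .bind .pp, .bind .pf_state]) <|
  .ite (.lock (V .pf_state)) .ff
    (.letin .s0' (.set_int (V .pf_state) .cpu_acc .ff) <|
    .letin .s0 (.set_lock (V .s0') .cpu_acc .tt) <|
    .letin .measure (.tup ![.h (V .init), .h (.stm (V .pf_state))]) <|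
    .new .nonce .nonce <|
    .out .cpu_tpm (.tup ![.reset_req, V .nonce, V .s0]) <|
    .inp .cpu_tpm (.tup ![.eq .reset_resp, .eq (V .nonce), .bind .s1]) <|
    .out .cpu_tpm (.tup ![.extend_req, V .nonce, V .s1, V .measure]) <|
    .inp .cpu_tpm (.tup ![.eq .extend_resp, .eq (V .nonce), .bind .s2]) <|
    .letin .s3 (.set_init (V .s2) .cpu_acc (V .init)) <|
    .letin .einit (.get_entry (V .init)) <|
    .out (V .einit) (.tup ![V .nonce, V .s3, .tpm_ch (V .init), V .pp]) <|
    .out .cpu_tpm (.tup ![.ext_channel, .tpm_ch (V .init)]) <|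
    .inp (V .einit) (.tup ![.eq .drt_resp, .eq (V .nonce), .bind .new_state]) <|
    .letin .epp (.get_entry (.pp (V .new_state))) <|
    .out (V .epp) (.tup ![V .new_state, .tpm_ch (.prog (V .epp))]) <|
    .out .cpu_tpm (.tup ![.ext_channel, .tpm_ch (.prog (V .epp))]) .nil)
    .nil

/-- The trusted loader. -/
def initProc : Proc :=
  .out .os (.prog .Tinit) <|
  .out .os (.prog .Tstm) <|
  .inp .Tinit (.tup ![.bind .nonce, .bind .pf_st, .bind .tpmc, .bind .pp]) <|
  .letin .measure (.h (V .pp)) <|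
  .new .nonce1 .nonce1 <|
  .out (V .tpmc) (.tup ![.extend_req, V .nonce1, V .pf_st, V .measure]) <|
  .inp (V .tpmc) (.tup ![.eq .extend_resp, .eq (V .nonce1), .bind .ext_st]) <|
  .letin .new_st (.set_pp (V .ext_st) .Tinit (V .pp)) <|
  .out .Tinit (.tup ![.drt_resp, V .nonce, V .new_st]) <|
  .out .os (V .new_st) .nil

/-- The trusted protected program. -/
def ppProc : Proc :=
  .out .os (.prog .Tpp) <|
  .inp .Tpp (.tup ![.bind .pf_state0, .bind .tpmc]) <|
  .letin .pf_st (.set_int (V .pf_state0) .Tpp .tt) <|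
  .out .os (V .pf_st) <|
  .inp .os (.bind .xblob) <|
  .inp .os (.bind .xenc) <|
  .out (V .tpmc) (.tup ![.tag_open, V .xblob]) <|
  .inp (V .tpmc) (.tup ![.eq .tag_plain, .bind .xk]) <|
  .letin .mess (.sdec (V .xenc) (V .xk)) <|
  .out .os (V .mess) <|
  .new .rand .rand <|
  .out (V .tpmc) (.tup ![.extend_req, V .rand, V .pf_st, .bot]) <|
  .inp (V .tpmc) (.tup ![.eq .extend_resp, .eq (V .rand), .bind .exts]) <|
  .letin .ends (.set_lock (V .exts) .Tpp .ff) <|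
  .out .os (V .ends) .nil

/-- The value of the register that records the trusted programs. -/
abbrev hchain : Term :=
  Term.chain .pd
    [.tup ![.h (.prog .Tinit), .h (.prog .Tstm)], .h (.prog .Tpp)]

def dataProc : Proc :=
  .new .kpp .kpp <|
  .new .hipp .hipp <|
  .out .os (.senc (V .hipp) (V .kpp)) <|
  .letin .sealed_key (.sealData (V .kpp) hchain) <|
  .out .os (V .sealed_key) .nil

def setupProc : Proc :=
  .inp .os (.bind .xstm) <|
  .inp .os (.bind .xsmi) <|
  .out .os (.state (.tpm .ps) (.cpu .tt .bot) (.smram (V .xstm) (V .xsmi))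
    (.drt .bot .bot .ff)) <|
  .inp .os (.bind .init) <|
  .inp .os (.bind .pp) <|
  .inp .os (.bind .pf_state) <|
  .out .os (.tup ![.drt_req, V .init, V .pp, V .pf_state]) .nil

def execProc : Proc :=
  .par cpuProc <| .par (.repl initProc) <| .par setupProc <| .par dataProc (.repl ppProc)

/-- The process `DRT`. -/
def DRT : Proc := .par (tpmProc pcrExtend) execProc

/-- The process `DRT^b`; the bound only enters through the theory `Edrtb b`. -/
def DRTb : Proc := .par (tpmProc pcrExtendB) execProc

/-! ### Security properties -/

/-- Secrecy of the sealed key: no name created by the restriction of `k_pp` can be learnt. -/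
def PhiSec : Property := {A | ∃ i, A = ⟨.name ⟨.kpp, i⟩, none⟩}

/-- Code integrity. -/
def PhiInt : Property :=
  {⟨.state (.tpm hchain) (.cpu (V .xint) (V .xcache)) (.smram (V .xstm) (V .xsmi))
      (.drt (V .xinit) (V .xpp) .tt),
    some (.tup ![V .xinit, V .xpp, V .xstm],
      .tup ![.prog .Tinit, .prog .Tpp, .prog .Tstm])⟩}

end Drt

namespace Drt

/-! ### The two theories -/

/-! The equivalence holds because both sides are true: `sat_of_good` proves secrecy and integrity
for either system, and no run of one is translated into a run of the other. One invariant serves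
both theories, which `Th c b` covers uniformly, the proposition `c` switching the bounding rules on.

The set `Pub` bounds the attacker's knowledge from above. A public state never has register `pd` or
`launchChain`, the two values from which `hchain` is reached by further extensions, and if its
register is `hchain` then the trusted handler, loader and protected program are in place and the
state is locked. These conditions survive every public operation: extending a public state cannot
produce `launchChain` or `hchain`, since its predecessor is excluded, and altering the trusted
components of a state with register `hchain` needs a private token, a private entry point or an open
lock (`Redex.pub`). Integrity is then part of the definition of `Pub`. Secrecy holds because a
public state with register `hchain` is locked on the trusted protected program, so that unsealing
with it answers on a private channel only.

For the protocol itself, `Msg` lists what may travel on each channel, and `Good` says that a process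
sends only such messages as long as it receives only such messages. This is preserved by reduction
(`Inv.red`) and holds for every attacker (`good_attacker`). The delicate part is the launch: the
processor and the loader send a request and trust the answer that carries their nonce. A map `φ` on
names ties each nonce to the value measured when it was created; injectivity of pairing and hashing
then shows that the measured handler is the one in the returned state. Only a launch of the trusted
loader has register `launchChain`, and that state stays on private channels until the loader has
recorded and installed the same protected program.

The bound enters in two places. The registers `pd` and `launchReg` record zero and one extensions,
hence are small when `2 ≤ b`, and the requests of a launch never reach the branch in which the
attacker supplies the register. A value accepted as big has at least three nested extensions, so it
is none of `pd`, `launchChain`, `hchain`, and installing it in a public state is harmless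
(`eval_is_big`, `Msg.extend_big`).

Normal forms are computed by the recursive function `ev` (`nf_eq_ev`): the rules apply constructor
patterns to evaluated arguments and return terms that are again normal. -/

/-- The theory of the platform, with the rules for bounded extensions if `c` holds. -/
def Th (c : Prop) (b : ℕ) : Theory := fun l r => Edrt l r ∨ (c ∧ Ebound b l r)

theorem Th_false (b : ℕ) : Th False b = Edrt := by
  funext l r; simp [Th]

theorem Th_true (b : ℕ) : Th True b = Edrtb b := by
  funext l r; simp [Th, Edrtb]

open Term in
/-- The instances of the rewrite rules, sorted by the root symbol of the left-hand side. -/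
def Redex (c : Prop) (b : ℕ) : (f : Sym) → (Fin f.arity → Term) → Term → Prop
  | .proj n i, a, r => ∃ ts : Fin n → Term, a 0 = tup ts ∧ r = ts i
  | .sdec, a, r => ∃ k, a 0 = senc r k ∧ a 1 = k
  | .unsealData, a, r => ∃ k, a 0 = sealData r k ∧ a 1 = k
  | .get_entry, a, r => a 0 = prog r
  | .pcr, a, r => ∃ x₁ x₂ x₃, a 0 = state (tpm r) x₁ x₂ x₃
  | .int, a, r => ∃ x₁ y x₂ x₃, a 0 = state x₁ (cpu r y) x₂ x₃
  | .cacheR, a, r => ∃ x₁ y x₂ x₃, a 0 = state x₁ (cpu y r) x₂ x₃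
  | .stm, a, r => ∃ x₁ x₂ y x₃, a 0 = state x₁ x₂ (smram r y) x₃
  | .smi, a, r => ∃ x₁ x₂ y x₃, a 0 = state x₁ x₂ (smram y r) x₃
  | .init, a, r => ∃ x₁ x₂ x₃ y z, a 0 = state x₁ x₂ x₃ (drt r y z)
  | .pp, a, r => ∃ x₁ x₂ x₃ y z, a 0 = state x₁ x₂ x₃ (drt y r z)
  | .lock, a, r => ∃ x₁ x₂ x₃ y z, a 0 = state x₁ x₂ x₃ (drt y z r)
  | .reset, a, r => ∃ y x₁ x₂ x₃ v, a 0 = state (tpm y) x₁ x₂ x₃ ∧ a 1 = tpm_acc ∧ a 2 = v ∧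
      (v = ps ∨ v = pd) ∧ r = state (tpm v) x₁ x₂ x₃
  | .extend, a, r => ∃ y x₁ x₂ x₃ v, a 0 = state (tpm y) x₁ x₂ x₃ ∧ a 1 = tpm_acc ∧ a 2 = v ∧
      r = state (tpm (h (tup ![y, v]))) x₁ x₂ x₃
  | .set_pcr, a, r => ∃ y x₁ x₂ x₃ v, a 0 = state (tpm y) x₁ x₂ x₃ ∧ a 1 = tpm_acc ∧ a 2 = v ∧
      r = state (tpm v) x₁ x₂ x₃
  | .set_int, a, r => ∃ x₁ y z x₂ x₃ t v, a 0 = state x₁ (cpu y z) x₂ x₃ ∧ a 1 = t ∧ a 2 = v ∧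
      (t = cpu_acc ∨ ∃ w, x₃ = drt w (prog t) tt) ∧ r = state x₁ (cpu v z) x₂ x₃
  | .cacheW, a, r => ∃ x₁ y z x₂ x₃ v, a 0 = state x₁ (cpu y z) x₂ x₃ ∧ a 1 = v ∧
      r = state x₁ (cpu y v) x₂ x₃
  | .flush_stm, a, r => ∃ x₁ y v z₁ z₂ w₁ w₂,
      a 0 = state x₁ (cpu y v) (smram z₁ z₂) (drt w₁ w₂ ff) ∧
      r = state x₁ (cpu y v) (smram v z₂) (drt w₁ w₂ ff)
  | .flush_smi, a, r => ∃ x₁ y v z₁ z₂ x₂,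
      a 0 = state x₁ (cpu y v) (smram z₁ z₂) x₂ ∧ r = state x₁ (cpu y v) (smram z₁ v) x₂
  | .set_init, a, r => ∃ x₁ x₂ x₃ y₁ y₂ y₃ v, a 0 = state x₁ x₂ x₃ (drt y₁ y₂ y₃) ∧
      a 1 = cpu_acc ∧ a 2 = v ∧ r = state x₁ x₂ x₃ (drt v y₂ y₃)
  | .set_pp, a, r => ∃ x₁ x₂ x₃ y₁ y₂ y₃ t v, a 0 = state x₁ x₂ x₃ (drt y₁ y₂ y₃) ∧
      a 1 = t ∧ a 2 = v ∧ (t = cpu_acc ∨ y₁ = prog t ∨ ∃ z z₁ z₂, x₂ = cpu tt z ∧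
        x₃ = smram (prog z₁) (prog z₂) ∧ t = tup ![z₁, z₂]) ∧
      r = state x₁ x₂ x₃ (drt y₁ v y₃)
  | .set_lock, a, r => ∃ x₁ x₂ x₃ y₁ y₂ y₃ t v, a 0 = state x₁ x₂ x₃ (drt y₁ y₂ y₃) ∧
      a 1 = t ∧ a 2 = v ∧ (t = cpu_acc ∨ y₂ = prog t ∨ ∃ z z₁ z₂, x₂ = cpu tt z ∧
        x₃ = smram (prog z₁) (prog z₂) ∧ t = tup ![z₁, z₂]) ∧
      r = state x₁ x₂ x₃ (drt y₁ y₂ v)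
  | .is_small, a, r => c ∧ ∃ v₀ vs, (v₀ = ps ∨ v₀ = pd) ∧ vs.length < b ∧ a 0 = chain v₀ vs ∧ r = tt
  | .is_big, a, r => c ∧ ∃ v₀ vs, vs.length = b + 1 ∧ a 0 = chain v₀ vs ∧ r = tt
  | _, _, _ => False

/-- Extends `Redex` to all terms, so that a rule instance can be analysed by cases while its
left-hand side is still a free index. -/
def RedexT (c : Prop) (b : ℕ) : Term → Term → Prop
  | .app f a, r => Redex c b f a r
  | _, _ => False

theorem RedexT_of_Th {c : Prop} {b : ℕ} {l r : Term} (H : Th c b l r) : RedexT c b l r := by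
  rcases H with (H | H | H | H) | ⟨hc, H⟩
  · cases H; exact ⟨_, rfl, rfl⟩
  · cases H <;> exact ⟨_, rfl, rfl⟩
  · cases H; exact rfl
  · cases H
    case pcr => exact ⟨_, _, _, rfl⟩
    case int => exact ⟨_, _, _, _, rfl⟩
    case cacheR => exact ⟨_, _, _, _, rfl⟩
    case stm => exact ⟨_, _, _, _, rfl⟩
    case smi => exact ⟨_, _, _, _, rfl⟩
    case init => exact ⟨_, _, _, _, _, rfl⟩
    case pp => exact ⟨_, _, _, _, _, rfl⟩
    case lock => exact ⟨_, _, _, _, _, rfl⟩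
    case reset_ps => exact ⟨_, _, _, _, _, rfl, rfl, rfl, .inl rfl, rfl⟩
    case reset_pd => exact ⟨_, _, _, _, _, rfl, rfl, rfl, .inr rfl, rfl⟩
    case extend => exact ⟨_, _, _, _, _, rfl, rfl, rfl, rfl⟩
    case set_pcr => exact ⟨_, _, _, _, _, rfl, rfl, rfl, rfl⟩
    case set_int_cpu => exact ⟨_, _, _, _, _, _, _, rfl, rfl, rfl, .inl rfl, rfl⟩
    case set_int_pp => exact ⟨_, _, _, _, _, _, _, rfl, rfl, rfl, .inr ⟨_, rfl⟩, rfl⟩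
    case cacheW => exact ⟨_, _, _, _, _, _, rfl, rfl, rfl⟩
    case flush_stm => exact ⟨_, _, _, _, _, _, _, rfl, rfl⟩
    case flush_smi => exact ⟨_, _, _, _, _, _, rfl, rfl⟩
    case set_init => exact ⟨_, _, _, _, _, _, _, rfl, rfl, rfl, rfl⟩
    case set_pp_cpu => exact ⟨_, _, _, _, _, _, _, _, rfl, rfl, rfl, .inl rfl, rfl⟩
    case set_pp_init => exact ⟨_, _, _, _, _, _, _, _, rfl, rfl, rfl, .inr (.inl rfl), rfl⟩
    case set_pp_smi =>
      exact ⟨_, _, _, _, _, _, _, _, rfl, rfl, rfl, .inr (.inr ⟨_, _, _, rfl, rfl, rfl⟩), rfl⟩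
    case set_lock_cpu => exact ⟨_, _, _, _, _, _, _, _, rfl, rfl, rfl, .inl rfl, rfl⟩
    case set_lock_pp => exact ⟨_, _, _, _, _, _, _, _, rfl, rfl, rfl, .inr (.inl rfl), rfl⟩
    case set_lock_smi =>
      exact ⟨_, _, _, _, _, _, _, _, rfl, rfl, rfl, .inr (.inr ⟨_, _, _, rfl, rfl, rfl⟩), rfl⟩
  · cases H with
    | small_ps vs h => exact ⟨hc, _, vs, .inl rfl, h, rfl, rfl⟩
    | small_pd vs h => exact ⟨hc, _, vs, .inr rfl, h, rfl, rfl⟩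
    | big v₀ vs h => exact ⟨hc, _, vs, h, rfl, rfl⟩

theorem fun1 {a : Fin 1 → Term} : a = ![a 0] := by
  funext i; fin_cases i; rfl

theorem fun2 {a : Fin 2 → Term} : a = ![a 0, a 1] := by
  funext i; fin_cases i <;> rfl

theorem fun3 {a : Fin 3 → Term} : a = ![a 0, a 1, a 2] := by
  funext i; fin_cases i <;> rfl

theorem vec1 {a : Fin 1 → Term} {x : Term} (h : a 0 = x) : a = ![x] := by
  rw [fun1 (a := a), h]

theorem vec2 {a : Fin 2 → Term} {x y : Term} (h : a 0 = x) (h' : a 1 = y) : a = ![x, y] := by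
  rw [fun2 (a := a), h, h']

theorem vec3 {a : Fin 3 → Term} {x y z : Term} (h : a 0 = x) (h' : a 1 = y) (h'' : a 2 = z) :
    a = ![x, y, z] := by
  rw [fun3 (a := a), h, h', h'']

theorem Th_of_Redex {c : Prop} {b : ℕ} {f : Sym} {a : Fin f.arity → Term} {r : Term}
    (H : Redex c b f a r) : Th c b (.app f a) r := by
  cases f <;> try exact H.elim
  case proj n i =>
    obtain ⟨ts, h, rfl⟩ := H
    rw [vec1 h]; exact .inl (.inl (.proj i ts))
  case sdec =>
    obtain ⟨k, h, h'⟩ := H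
    rw [vec2 h h']; exact .inl (.inr (.inl (.sdec _ _)))
  case unsealData =>
    obtain ⟨k, h, h'⟩ := H
    rw [vec2 h h']; exact .inl (.inr (.inl (.unsealData _ _)))
  case get_entry =>
    rw [vec1 H]; exact .inl (.inr (.inr (.inl (.get_entry _))))
  case is_small =>
    obtain ⟨hc, v₀, vs, hv, hl, h, rfl⟩ := H
    rw [vec1 h]
    rcases hv with rfl | rfl
    · exact .inr ⟨hc, .small_ps vs hl⟩
    · exact .inr ⟨hc, .small_pd vs hl⟩
  case is_big =>
    obtain ⟨hc, v₀, vs, hl, h, rfl⟩ := H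
    rw [vec1 h]
    exact .inr ⟨hc, .big v₀ vs hl⟩
  all_goals refine .inl (.inr (.inr (.inr ?_)))
  case pcr => obtain ⟨_, _, _, h⟩ := H; rw [vec1 h]; constructor
  case int => obtain ⟨_, _, _, _, h⟩ := H; rw [vec1 h]; constructor
  case cacheR => obtain ⟨_, _, _, _, h⟩ := H; rw [vec1 h]; constructor
  case stm => obtain ⟨_, _, _, _, h⟩ := H; rw [vec1 h]; constructor
  case smi => obtain ⟨_, _, _, _, h⟩ := H; rw [vec1 h]; constructor
  case init => obtain ⟨_, _, _, _, _, h⟩ := H; rw [vec1 h]; constructor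
  case pp => obtain ⟨_, _, _, _, _, h⟩ := H; rw [vec1 h]; constructor
  case lock => obtain ⟨_, _, _, _, _, h⟩ := H; rw [vec1 h]; constructor
  case reset =>
    obtain ⟨_, _, _, _, _, h, h', h'', hv, rfl⟩ := H
    rw [vec3 h h' h'']
    rcases hv with rfl | rfl <;> constructor
  case extend =>
    obtain ⟨_, _, _, _, _, h, h', h'', rfl⟩ := H; rw [vec3 h h' h'']; constructor
  case set_pcr =>
    obtain ⟨_, _, _, _, _, h, h', h'', rfl⟩ := H; rw [vec3 h h' h'']; constructor
  case set_int =>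
    obtain ⟨_, _, _, _, _, _, _, h, h', h'', hv, rfl⟩ := H
    rw [vec3 h h' h'']
    rcases hv with rfl | ⟨w, rfl⟩
    · exact .set_int_cpu ..
    · exact .set_int_pp ..
  case cacheW => obtain ⟨_, _, _, _, _, _, h, h', rfl⟩ := H; rw [vec2 h h']; constructor
  case flush_stm => obtain ⟨_, _, _, _, _, _, _, h, rfl⟩ := H; rw [vec1 h]; constructor
  case flush_smi => obtain ⟨_, _, _, _, _, _, h, rfl⟩ := H; rw [vec1 h]; constructor
  case set_init =>
    obtain ⟨_, _, _, _, _, _, _, h, h', h'', rfl⟩ := H; rw [vec3 h h' h'']; constructor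
  case set_pp =>
    obtain ⟨_, _, _, _, _, _, _, _, h, h', h'', hv, rfl⟩ := H
    rw [vec3 h h' h'']
    rcases hv with rfl | rfl | ⟨_, _, _, rfl, rfl, rfl⟩
    · exact .set_pp_cpu ..
    · exact .set_pp_init ..
    · exact .set_pp_smi ..
  case set_lock =>
    obtain ⟨_, _, _, _, _, _, _, _, h, h', h'', hv, rfl⟩ := H
    rw [vec3 h h' h'']
    rcases hv with rfl | rfl | ⟨_, _, _, rfl, rfl, rfl⟩
    · exact .set_lock_cpu ..
    · exact .set_lock_pp ..
    · exact .set_lock_smi ..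

theorem Th_app_iff {c : Prop} {b : ℕ} {f : Sym} {a : Fin f.arity → Term} {r : Term} :
    Th c b (.app f a) r ↔ Redex c b f a r :=
  ⟨RedexT_of_Th, Th_of_Redex⟩

/-- The symbols at the root of rewrite rules. -/
def Sym.isDes : Sym → Bool
  | .proj _ _ | .sdec | .unsealData | .get_entry | .pcr | .int | .cacheR | .stm | .smi | .init
  | .pp | .lock | .reset | .extend | .set_pcr | .set_int | .cacheW | .flush_stm | .flush_smi
  | .set_init | .set_pp | .set_lock | .is_small | .is_big => true
  | _ => false

theorem Redex.isDes {c : Prop} {b : ℕ} {f : Sym} {a : Fin f.arity → Term} {r : Term}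
    (H : Redex c b f a r) : f.isDes = true := by
  cases f <;> first | rfl | exact H.elim

/-- Rules for the same destructor overlap only where several authorisations apply, and then the
results agree. -/
theorem Redex.unique {c : Prop} {b : ℕ} {f : Sym} {a : Fin f.arity → Term} {r r' : Term}
    (H : Redex c b f a r) (H' : Redex c b f a r') : r = r' := by
  cases f <;> first | exact H.elim | simp only [Redex] at H H'
  case proj n i =>
    obtain ⟨ts, h, rfl⟩ := H
    obtain ⟨ts', h', rfl⟩ := H'
    simp_all
  all_goals grind [Matrix.vecCons_inj]

/-! ### Normal forms -/

open Classical in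
/-- One step at the root, if possible. -/
noncomputable def rootStep (E : Theory) (t : Term) : Term :=
  if H : ∃ r, E t r then H.choose else t

/-- Innermost evaluation. -/
noncomputable def ev (E : Theory) : Term → Term
  | .var x => .var x
  | .name n => .name n
  | .app f a => rootStep E (.app f fun i => ev E (a i))

theorem rootStep_redex {c : Prop} {b : ℕ} {f : Sym} {a : Fin f.arity → Term} {r : Term}
    (H : Redex c b f a r) : rootStep (Th c b) (.app f a) = r := by
  have h : ∃ r, Th c b (.app f a) r := ⟨r, Th_of_Redex H⟩
  rw [rootStep, dif_pos h]
  exact (Th_app_iff.1 h.choose_spec).unique H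

theorem rootStep_cases (c : Prop) (b : ℕ) (f : Sym) (a : Fin f.arity → Term) :
    Redex c b f a (rootStep (Th c b) (.app f a)) ∨
      (∀ r, ¬ Redex c b f a r) ∧ rootStep (Th c b) (.app f a) = .app f a := by
  by_cases h : ∃ r, Redex c b f a r
  · obtain ⟨r, h⟩ := h
    rw [rootStep_redex h]; exact .inl h
  · push Not at h
    refine .inr ⟨h, ?_⟩
    rw [rootStep, dif_neg]
    rintro ⟨r, H⟩
    exact h r (Th_app_iff.1 H)

theorem ev_con {c : Prop} {b : ℕ} {f : Sym} {a : Fin f.arity → Term} (hf : f.isDes = false) :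
    ev (Th c b) (.app f a) = .app f (ev (Th c b) ∘ a) := by
  rw [ev]
  rcases rootStep_cases c b f (fun i => ev (Th c b) (a i)) with h | h
  · simp [h.isDes] at hf
  · exact h.2

/-! ### Evaluation commutes with constructors. -/

@[simp]
theorem comp_vecEmpty (f : Term → Term) (v : Fin 0 → Term) : f ∘ v = ![] :=
  Subsingleton.elim _ _

@[simp]
theorem comp_vecCons (f : Term → Term) (x : Term) {n : ℕ} (v : Fin n → Term) :
    f ∘ Matrix.vecCons x v = Matrix.vecCons (f x) (f ∘ v) := by
  funext i; exact Fin.cases rfl (fun _ => rfl) i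

open Term in
@[simp]
theorem ev_const {c : Prop} {b : ℕ} :
    ev (Th c b) os = os ∧
    ev (Th c b) ps = ps ∧
    ev (Th c b) pd = pd ∧
    ev (Th c b) tt = tt ∧
    ev (Th c b) ff = ff ∧
    ev (Th c b) bot = bot ∧
    ev (Th c b) reset_req = reset_req ∧
    ev (Th c b) reset_resp = reset_resp ∧
    ev (Th c b) extend_req = extend_req ∧
    ev (Th c b) extend_resp = extend_resp ∧
    ev (Th c b) ext_channel = ext_channel ∧
    ev (Th c b) tag_open = tag_open ∧
    ev (Th c b) tag_plain = tag_plain ∧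
    ev (Th c b) drt_req = drt_req ∧
    ev (Th c b) drt_resp = drt_resp ∧
    ev (Th c b) tpm_acc = tpm_acc ∧
    ev (Th c b) cpu_acc = cpu_acc ∧
    ev (Th c b) cpu_tpm = cpu_tpm ∧
    ∀ i, ev (Th c b) (entry i) = entry i := by
  refine ⟨?_, ?_, ?_, ?_, ?_, ?_, ?_, ?_, ?_, ?_, ?_, ?_, ?_, ?_, ?_, ?_, ?_, ?_,
    fun i => ?_⟩ <;> exact (ev_con rfl).trans (by simp)

open Term in
@[simp]
theorem ev_constructor {c : Prop} {b : ℕ} :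
    (∀ x, ev (Th c b) (h x) = h (ev (Th c b) x)) ∧
    (∀ x, ev (Th c b) (prog x) = prog (ev (Th c b) x)) ∧
    (∀ x, ev (Th c b) (tpm x) = tpm (ev (Th c b) x)) ∧
    (∀ x, ev (Th c b) (tpm_ch x) = tpm_ch (ev (Th c b) x)) ∧
    (∀ x y, ev (Th c b) (senc x y) = senc (ev (Th c b) x) (ev (Th c b) y)) ∧
    (∀ x y, ev (Th c b) (sealData x y) = sealData (ev (Th c b) x) (ev (Th c b) y)) ∧
    (∀ x y, ev (Th c b) (cpu x y) = cpu (ev (Th c b) x) (ev (Th c b) y)) ∧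
    (∀ x y, ev (Th c b) (smram x y) = smram (ev (Th c b) x) (ev (Th c b) y)) ∧
    (∀ x y z, ev (Th c b) (drt x y z) = drt (ev (Th c b) x) (ev (Th c b) y) (ev (Th c b) z)) ∧
    (∀ x y z w, ev (Th c b) (state x y z w) =
      state (ev (Th c b) x) (ev (Th c b) y) (ev (Th c b) z) (ev (Th c b) w)) := by
  refine ⟨?_, ?_, ?_, ?_, ?_, ?_, ?_, ?_, ?_, ?_⟩ <;> intros <;> exact (ev_con rfl).trans (by simp)

@[simp]
theorem ev_tup {c : Prop} {b n : ℕ} (ts : Fin n → Term) :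
    ev (Th c b) (.tup ts) = .tup (ev (Th c b) ∘ ts) :=
  ev_con rfl

theorem ev_chain {c : Prop} {b : ℕ} (v : Term) (vs : List Term) :
    ev (Th c b) (Term.chain v vs) = Term.chain (ev (Th c b) v) (vs.map (ev (Th c b))) := by
  induction vs generalizing v with
  | nil => rfl
  | cons x vs ih =>
    simp only [Term.chain, List.foldl_cons, List.map_cons] at ih ⊢
    rw [ih]
    simp

/-- Below the root, left-hand sides consist of constructors and variables, so evaluating the
arguments preserves the match, including repeated variables. Chains stay chains of the same length.
This is the source of confluence. -/
theorem Redex.ev {c : Prop} {b : ℕ} {f : Sym} {a : Fin f.arity → Term} {r : Term}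
    (H : Redex c b f a r) : Redex c b f (ev (Th c b) ∘ a) (ev (Th c b) r) := by
  cases f <;> first | exact H.elim | simp only [Redex, Function.comp_apply] at H ⊢
  case proj n i =>
    obtain ⟨ts, h, rfl⟩ := H
    exact ⟨Drt.ev (Th c b) ∘ ts, by simp [h], rfl⟩
  case is_small =>
    obtain ⟨hc, v₀, vs, hv, hl, h, rfl⟩ := H
    refine ⟨hc, v₀, vs.map (Drt.ev (Th c b)), hv, by simpa, ?_, by simp ⟩
    rw [h, ev_chain]
    rcases hv with rfl | rfl <;> simp
  case is_big =>
    obtain ⟨hc, v₀, vs, hl, h, rfl⟩ := H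
    exact ⟨hc, _, vs.map (Drt.ev (Th c b)), by simpa, by rw [h, ev_chain], by simp ⟩
  case reset =>
    obtain ⟨_, _, _, _, _, h, h', h'', hv, rfl⟩ := H
    rw [h, h', h'']
    rcases hv with rfl | rfl <;> simp
  case set_int =>
    obtain ⟨_, _, _, _, _, _, _, h, h', h'', hv, rfl⟩ := H
    rw [h, h', h'']
    rcases hv with rfl | ⟨w, rfl⟩ <;> simp
  case set_pp =>
    obtain ⟨_, _, _, _, _, _, _, _, h, h', h'', hv, rfl⟩ := H
    rw [h, h', h'']
    rcases hv with rfl | rfl | ⟨_, _, _, rfl, rfl, rfl⟩ <;>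
      simp
  case set_lock =>
    obtain ⟨_, _, _, _, _, _, _, _, h, h', h'', hv, rfl⟩ := H
    rw [h, h', h'']
    rcases hv with rfl | rfl | ⟨_, _, _, rfl, rfl, rfl⟩ <;>
      simp
  case sdec | unsealData => obtain ⟨_, h, h'⟩ := H; simp [h, h']
  case get_entry => simp [H]
  case pcr => obtain ⟨_, _, _, h⟩ := H; simp [h]
  case int | cacheR | stm | smi => obtain ⟨_, _, _, _, h⟩ := H; simp [h]
  case init | pp | lock => obtain ⟨_, _, _, _, _, h⟩ := H; simp [h]
  case extend | set_pcr => obtain ⟨_, _, _, _, _, h, h', h'', rfl⟩ := H; simp [h, h', h'']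
  case cacheW => obtain ⟨_, _, _, _, _, _, h, h', rfl⟩ := H; simp [h, h']
  case flush_smi => obtain ⟨_, _, _, _, _, _, h, rfl⟩ := H; simp [h]
  case flush_stm => obtain ⟨_, _, _, _, _, _, _, h, rfl⟩ := H; simp [h]
  case set_init => obtain ⟨_, _, _, _, _, _, _, h, h', h'', rfl⟩ := H; simp [h, h', h'']

/-- After evaluation of the arguments a root redex is still a redex with the evaluated contractum
(`Redex.ev`), and `rootStep` has no other choice. So `ev` is constant on rewrite sequences, and
normal forms are unique. -/
theorem ev_eq_of_step {c : Prop} {b : ℕ} {t t' : Term} (H : Step (Th c b) t t') :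
    ev (Th c b) t = ev (Th c b) t' := by
  induction H with
  | root h =>
    rename_i l r
    cases l with
    | app f a =>
      rw [ev]
      exact rootStep_redex (Th_app_iff.1 h).ev
    | var x => exact (RedexT_of_Th h).elim
    | name n => exact (RedexT_of_Th h).elim
  | arg h ih =>
    rename_i f a i t
    simp only [ev]
    congr 2
    funext j
    by_cases hj : j = i
    · subst hj; simp [ih]
    · simp [hj]

theorem ev_eq_of_steps {c : Prop} {b : ℕ} {t t' : Term}
    (H : Relation.ReflTransGen (Step (Th c b)) t t') : ev (Th c b) t = ev (Th c b) t' := by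
  induction H with
  | refl => rfl
  | tail _ h ih => rw [ih, ev_eq_of_step h]

/-- Terms that cannot be rewritten. -/
def Normal (c : Prop) (b : ℕ) : Term → Prop
  | .app f a => (∀ i, Normal c b (a i)) ∧ ∀ r, ¬ Redex c b f a r
  | _ => True

theorem Normal.not_step {c : Prop} {b : ℕ} {t t' : Term} (H : Normal c b t) :
    ¬ Step (Th c b) t t' := by
  intro h
  induction h with
  | root h =>
    rename_i l r
    cases l with
    | app f a => exact H.2 _ (Th_app_iff.1 h)
    | var x => exact (RedexT_of_Th h).elim
    | name n => exact (RedexT_of_Th h).elim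
  | arg h ih => exact ih (H.1 _)

theorem Normal.ev_eq {c : Prop} {b : ℕ} {t : Term} (H : Normal c b t) : ev (Th c b) t = t := by
  induction t with
  | var x => rfl
  | name n => rfl
  | app f a ih =>
    have h : (fun i => ev (Th c b) (a i)) = a := funext fun i => ih i (H.1 i)
    rw [ev, h]
    rcases rootStep_cases c b f a with h | h
    · exact (H.2 _ h).elim
    · exact h.2

theorem normal_of_not_step {c : Prop} {b : ℕ} {t : Term} (H : ∀ t', ¬ Step (Th c b) t t') :
    Normal c b t := by
  induction t with
  | var x => trivial
  | name n => trivial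
  | app f a ih =>
    exact ⟨fun i => ih i fun t' h => H _ (.arg h), fun r h => H _ (.root (Th_of_Redex h))⟩

theorem normal_con {c : Prop} {b : ℕ} {f : Sym} {a : Fin f.arity → Term} (hf : f.isDes = false) :
    Normal c b (.app f a) ↔ ∀ i, Normal c b (a i) := by
  refine ⟨fun h => h.1, fun h => ⟨h, fun r H => ?_⟩⟩
  simp [H.isDes] at hf

open Term in
@[simp]
theorem normal_constructor {c : Prop} {b : ℕ} :
    Normal c b ps ∧ Normal c b pd ∧ Normal c b tt ∧ Normal c b ff ∧
    (∀ x, Normal c b (h x) ↔ Normal c b x) ∧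
    (∀ x, Normal c b (prog x) ↔ Normal c b x) ∧
    (∀ x, Normal c b (tpm x) ↔ Normal c b x) ∧
    (∀ x y, Normal c b (senc x y) ↔ Normal c b x ∧ Normal c b y) ∧
    (∀ x y, Normal c b (sealData x y) ↔ Normal c b x ∧ Normal c b y) ∧
    (∀ x y, Normal c b (cpu x y) ↔ Normal c b x ∧ Normal c b y) ∧
    (∀ x y, Normal c b (smram x y) ↔ Normal c b x ∧ Normal c b y) ∧
    (∀ x y, Normal c b (tup ![x, y]) ↔ Normal c b x ∧ Normal c b y) ∧
    (∀ x y z, Normal c b (drt x y z) ↔ Normal c b x ∧ Normal c b y ∧ Normal c b z) ∧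
    (∀ x y z w, Normal c b (state x y z w) ↔
      Normal c b x ∧ Normal c b y ∧ Normal c b z ∧ Normal c b w) := by
  refine ⟨?_, ?_, ?_, ?_, ?_, ?_, ?_, ?_, ?_, ?_, ?_, ?_, ?_, ?_⟩ <;> intros <;>
    simp [normal_con (f := .ps) rfl, normal_con (f := .pd) rfl, normal_con (f := .tt) rfl,
      normal_con (f := .ff) rfl, normal_con (f := .h) rfl, normal_con (f := .prog) rfl,
      normal_con (f := .tpm) rfl, normal_con (f := .senc) rfl, normal_con (f := .sealData) rfl,
      normal_con (f := .cpu) rfl, normal_con (f := .smram) rfl, normal_con (f := .tup 2) rfl,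
      normal_con (f := .drt) rfl, normal_con (f := .state) rfl, Fin.forall_fin_succ]

/-- A contractum is assembled by constructors from pieces of the arguments. Hence one root step
after evaluating the arguments is enough, which is why `ev` can be defined by structural recursion.
-/
theorem Redex.normal {c : Prop} {b : ℕ} {f : Sym} {a : Fin f.arity → Term} {r : Term}
    (H : Redex c b f a r) (ha : ∀ i, Normal c b (a i)) : Normal c b r := by
  cases f <;> first | exact H.elim | simp only [Redex] at H
  case proj n i =>
    obtain ⟨ts, h, rfl⟩ := H
    have := ha 0
    rw [h] at this
    exact this.1 i
  case is_small => obtain ⟨-, _, _, -, -, -, rfl⟩ := H; simp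
  case is_big => obtain ⟨-, _, _, -, -, rfl⟩ := H; simp
  case sdec | unsealData => obtain ⟨_, h, h'⟩ := H; have := ha 0; simp_all
  case get_entry => have := ha 0; simp_all
  case pcr => obtain ⟨_, _, _, h⟩ := H; have := ha 0; simp_all
  case int | cacheR | stm | smi => obtain ⟨_, _, _, _, h⟩ := H; have := ha 0; simp_all
  case init | pp | lock => obtain ⟨_, _, _, _, _, h⟩ := H; have := ha 0; simp_all
  case extend | set_pcr =>
    obtain ⟨_, _, _, _, _, h, h', rfl, rfl⟩ := H
    have h0 := ha 0; have h2 := ha 2; rw [h] at h0; simp_all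
  case reset =>
    obtain ⟨_, _, _, _, _, h, h', rfl, hv, rfl⟩ := H
    have h0 := ha 0; have h2 := ha 2; rw [h] at h0; simp_all
  case cacheW =>
    obtain ⟨_, _, _, _, _, _, h, rfl, rfl⟩ := H
    have h0 := ha 0; have h1 := ha 1; rw [h] at h0; simp_all
  case flush_smi =>
    obtain ⟨_, _, _, _, _, _, h, rfl⟩ := H
    have h0 := ha 0; rw [h] at h0; simp_all
  case flush_stm =>
    obtain ⟨_, _, _, _, _, _, _, h, rfl⟩ := H
    have h0 := ha 0; rw [h] at h0; simp_all
  case set_int =>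
    obtain ⟨_, _, _, _, _, _, _, h, h', rfl, hv, rfl⟩ := H
    have h0 := ha 0; have h2 := ha 2; rw [h] at h0; simp at h0 ⊢; tauto
  case set_init =>
    obtain ⟨_, _, _, _, _, _, _, h, h', rfl, rfl⟩ := H
    have h0 := ha 0; have h2 := ha 2; rw [h] at h0; simp at h0 ⊢; tauto
  case set_pp | set_lock =>
    obtain ⟨_, _, _, _, _, _, _, _, h, h', rfl, hv, rfl⟩ := H
    have h0 := ha 0; have h2 := ha 2; rw [h] at h0; simp at h0 ⊢; tauto

theorem ev_normal {c : Prop} {b : ℕ} (t : Term) : Normal c b (ev (Th c b) t) := by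
  induction t with
  | var x => trivial
  | name n => trivial
  | app f a ih =>
    rw [ev]
    rcases rootStep_cases c b f (fun i => ev (Th c b) (a i)) with h | ⟨h, h'⟩
    · exact h.normal ih
    · rw [h']; exact ⟨ih, h⟩

@[simp]
theorem ev_ev {c : Prop} {b : ℕ} (t : Term) : ev (Th c b) (ev (Th c b) t) = ev (Th c b) t :=
  (ev_normal t).ev_eq

/-! ### Evaluation is reached by rewriting. -/

theorem steps_arg {E : Theory} {f : Sym} (a : Fin f.arity → Term) (i : Fin f.arity) {t : Term}
    (H : Relation.ReflTransGen (Step E) (a i) t) :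
    Relation.ReflTransGen (Step E) (.app f a) (.app f (Function.update a i t)) := by
  induction H with
  | refl => simpa using .refl
  | tail _ h ih =>
    rename_i u v _
    refine ih.tail ?_
    have := Step.arg (E := E) (f := f) (args := Function.update a i u) (i := i) (t := v) (by simpa)
    simpa using this

theorem steps_args {E : Theory} {f : Sym} (a a' : Fin f.arity → Term)
    (H : ∀ i, Relation.ReflTransGen (Step E) (a i) (a' i)) :
    Relation.ReflTransGen (Step E) (.app f a) (.app f a') := by
  -- The arguments are rewritten one after another; `s` is the set of positions already treated.
  have key : ∀ s : Finset (Fin f.arity),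
      Relation.ReflTransGen (Step E) (.app f a) (.app f (s.piecewise a' a)) := by
    intro s
    induction s using Finset.induction_on with
    | empty => simpa using .refl
    | insert i s hi ih =>
      refine ih.trans ?_
      rw [Finset.piecewise_insert]
      exact steps_arg _ _ (by simpa [hi] using H i)
  simpa using key Finset.univ

theorem steps_ev {c : Prop} {b : ℕ} (t : Term) :
    Relation.ReflTransGen (Step (Th c b)) t (ev (Th c b) t) := by
  induction t with
  | var x => exact .refl
  | name n => exact .refl
  | app f a ih =>
    refine (steps_args a _ ih).trans ?_
    rw [ev]
    rcases rootStep_cases c b f (fun i => ev (Th c b) (a i)) with h | ⟨h, h'⟩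
    · exact .single (.root (Th_of_Redex h))
    · rw [h']

/-- `ev t` is a normal form reachable from `t`, and any other one evaluates both to itself and to
`ev t`; so the choice made in `nf` is forced. -/
theorem nf_eq_ev (c : Prop) (b : ℕ) : nf (Th c b) = ev (Th c b) := by
  funext t
  have H : ∃ W, IsNF (Th c b) t W := ⟨_, steps_ev t, fun W' => (ev_normal t).not_step⟩
  have h := H.choose_spec
  rw [nf, dif_pos H, ev_eq_of_steps h.1, (normal_of_not_step h.2).ev_eq]

theorem EqE_iff {c : Prop} {b : ℕ} {U V : Term} :
    EqE (Th c b) U V ↔ ev (Th c b) U = ev (Th c b) V := by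
  rw [EqE, nf_eq_ev]

/-- If a destructor application evaluates to a term without destructors, its rule applied. -/
theorem redex_of_disjoint {c : Prop} {b : ℕ} {f : Sym} {a : Fin f.arity → Term}
    (hf : f ∈ destructors (Th c b))
    (H : Disjoint (ev (Th c b) (.app f a)).sig (destructors (Th c b))) :
    Redex c b f (ev (Th c b) ∘ a) (ev (Th c b) (.app f a)) := by
  rcases rootStep_cases c b f (ev (Th c b) ∘ a) with h | ⟨h, h'⟩
  · exact h
  · have : ev (Th c b) (.app f a) = .app f (ev (Th c b) ∘ a) := h'
    rw [this] at H
    exact (Set.disjoint_left.1 H (by simp [Term.sig]) hf).elim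

/-- If a destructor application evaluates to a term with another root, its rule applied. -/
theorem redex_of_ne {c : Prop} {b : ℕ} {f : Sym} {a : Fin f.arity → Term} {t : Term}
    (H : ev (Th c b) (.app f a) = t) (ht : ∀ a', t ≠ .app f a') :
    Redex c b f (ev (Th c b) ∘ a) t := by
  rcases rootStep_cases c b f (ev (Th c b) ∘ a) with h | ⟨h, h'⟩
  · exact H ▸ h
  · exact (ht _ (H.symm.trans h')).elim

/-! ### Closed terms -/

/-- Terms without variables. -/
def Term.Closed : Term → Prop
  | .var _ => False
  | .name _ => True
  | .app _ a => ∀ i, (a i).Closed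

theorem Term.Closed.subst_eq {t : Term} (H : t.Closed) (σ : Subst) : t.subst σ = t := by
  induction t with
  | var x => exact H.elim
  | name n => rfl
  | app f a ih =>
    rw [Term.subst]
    congr 1
    exact funext fun i => ih i (H i)

/-! ### What the attacker may know -/

/-- The value of the register after the launch of the trusted loader with the trusted handler. -/
abbrev launchChain : Term := .h (.tup ![.pd, .tup ![.h (.prog .Tinit), .h (.prog .Tstm)]])

theorem hchain_eq : hchain = .h (.tup ![launchChain, .h (.prog .Tpp)]) := rfl

/-- The invariant of the states that are available to the attacker: their register is not about to
become `hchain`, and if it is `hchain` then the trusted programs are loaded and locked. -/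
structure SafeState (p m a q l : Term) : Prop where
  ne_pd : p ≠ .pd
  ne_launch : p ≠ launchChain
  trusted : p = hchain → m = .prog .Tstm ∧ a = .prog .Tinit ∧ q = .prog .Tpp ∧ l = .tt

open Term in
/-- An upper bound for the knowledge of the attacker. -/
inductive Pub : Term → Prop
  | name {n : Name} : n.label ≠ .kpp → Pub (.name n)
  | app {f : Sym} {a : Fin f.arity → Term} : f ∉ Sym.priv → (∀ i, Pub (a i)) → Pub (.app f a)
  | senc {x : Term} {j : ℕ} : Pub x → Pub (senc x (.name ⟨.kpp, j⟩))
  | sealed {j : ℕ} : Pub (sealData (.name ⟨.kpp, j⟩) hchain)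
  | prog {j : ℕ} : Pub (prog (entry j))
  | tpm_ch {e : Term} : Pub e → Pub (tpm_ch (prog e))
  | state {p i k m s a q l : Term} : Pub p → Pub i → Pub k → Pub m → Pub s → Pub a → Pub q →
      Pub l → SafeState p m a q l → Pub (state (tpm p) (cpu i k) (smram m s) (drt a q l))

open Term in
/-- `Pub` by cases on the root symbol. -/
def PubCases : Term → Prop
  | .var _ => False
  | .name n => n.label ≠ .kpp
  | .app .senc a => Pub (a 0) ∧ (Pub (a 1) ∨ ∃ j, a 1 = .name ⟨.kpp, j⟩)
  | .app .sealData a => Pub (a 1) ∧ (Pub (a 0) ∨ (∃ j, a 0 = .name ⟨.kpp, j⟩) ∧ a 1 = hchain)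
  | .app .prog a => Pub (a 0) ∨ ∃ j, a 0 = entry j
  | .app .tpm_ch a => ∃ e, a 0 = prog e ∧ Pub e
  | .app .state x => ∃ p i k m s a q l,
      x = ![tpm p, cpu i k, smram m s, drt a q l] ∧ Pub p ∧ Pub i ∧ Pub k ∧ Pub m ∧ Pub s ∧
      Pub a ∧ Pub q ∧ Pub l ∧ SafeState p m a q l
  | .app f a => f ∉ Sym.priv ∧ ∀ i, Pub (a i)

/-! ### Inversion of `Pub`. -/

theorem Pub.const {f : Sym} {a : Fin f.arity → Term} (h : f.arity = 0) (hf : f ∉ Sym.priv) :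
    Pub (.app f a) :=
  .app hf fun i => (Fin.cast h i).elim0

theorem pub_pd : Pub .pd := .const rfl (by simp [Sym.priv])

theorem Pub.h {x : Term} (hx : Pub x) : Pub (.h x) :=
  .app (by simp [Sym.priv]) (by simpa [Fin.forall_fin_succ] using hx)

theorem Pub.tup {n : ℕ} {x : Fin n → Term} (hx : ∀ i, Pub (x i)) : Pub (.tup x) :=
  .app (by simp [Sym.priv]) hx

theorem pub_launchChain : Pub launchChain := by
  refine .h (.tup ?_)
  simp only [Fin.forall_fin_succ, Matrix.cons_val]
  exact ⟨pub_pd, .tup (by simpa [Fin.forall_fin_succ] using ⟨.h .prog, .h .prog⟩), by simp⟩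

theorem pub_hchain : Pub hchain := by
  refine .h (.tup ?_)
  simp only [Fin.forall_fin_succ, Matrix.cons_val]
  exact ⟨pub_launchChain, .h .prog, by simp⟩

theorem Pub.inv {t : Term} (H : Pub t) : PubCases t := by
  cases H with
  | name h => exact h
  | app hf ha =>
    rename_i f a
    cases f
    case senc => exact ⟨ha 0, .inl (ha 1)⟩
    case sealData => exact ⟨ha 1, .inl (ha 0)⟩
    case prog => exact .inl (ha 0)
    case tpm_ch => simp [Sym.priv] at hf
    case state => simp [Sym.priv] at hf
    all_goals exact ⟨hf, ha⟩
  | senc h => exact ⟨h, .inr ⟨_, rfl⟩⟩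
  | sealed => exact ⟨pub_hchain, .inr ⟨⟨_, rfl⟩, rfl⟩⟩
  | prog => exact .inr ⟨_, rfl⟩
  | tpm_ch h => exact ⟨_, rfl, h⟩
  | state h1 h2 h3 h4 h5 h6 h7 h8 h =>
    exact ⟨_, _, _, _, _, _, _, _, rfl, h1, h2, h3, h4, h5, h6, h7, h8, h⟩

open Term in
@[simp]
-- The secrets on which all later arguments rest: access tokens, the processor channel, entry points
-- and sealed keys. No constructor of `Pub` yields any of them.
theorem not_pub : ¬ Pub tpm_acc ∧ ¬ Pub cpu_acc ∧ ¬ Pub cpu_tpm ∧ (∀ j, ¬ Pub (entry j)) ∧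
    (∀ j, ¬ Pub (.name ⟨.kpp, j⟩)) := by
  refine ⟨?_, ?_, ?_, ?_, ?_⟩ <;> intros <;> intro h <;> have := h.inv <;>
    simp [PubCases, Sym.priv] at this

@[simp]
theorem pub_tup {n : ℕ} {x : Fin n → Term} : Pub (.tup x) ↔ ∀ i, Pub (x i) :=
  ⟨fun h => h.inv.2, .tup⟩

@[simp]
theorem pub_h {x : Term} : Pub (.h x) ↔ Pub x :=
  ⟨fun h => h.inv.2 0, .h⟩

theorem pub_prog {x : Term} : Pub (.prog x) ↔ Pub x ∨ ∃ j, x = .entry j := by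
  refine ⟨fun h => h.inv, ?_⟩
  rintro (h | ⟨j, rfl⟩)
  · exact .app (by simp [Sym.priv]) (by simpa [Fin.forall_fin_succ] using h)
  · exact .prog

theorem pub_tpm_ch {x : Term} : Pub (.tpm_ch x) ↔ ∃ e, x = .prog e ∧ Pub e := by
  refine ⟨fun h => h.inv, ?_⟩
  rintro ⟨e, rfl, h⟩
  exact .tpm_ch h

@[simp]
-- The program `prog (entry j)` is public, but its channel would be public only if the entry point
-- were.
theorem not_pub_tpm_ch_entry (j : ℕ) : ¬ Pub (.tpm_ch (.prog (.entry j))) := by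
  rintro h
  obtain ⟨e, he, h⟩ := pub_tpm_ch.1 h
  simp at he; subst he; simp at h

theorem Pub.state_inv {x y z w : Term} (H : Pub (.state x y z w)) :
    ∃ p i k m s a q l, (x = .tpm p ∧ y = .cpu i k ∧ z = .smram m s ∧ w = .drt a q l) ∧
      Pub p ∧ Pub i ∧ Pub k ∧ Pub m ∧ Pub s ∧ Pub a ∧ Pub q ∧ Pub l ∧ SafeState p m a q l := by
  obtain ⟨p, i, k, m, s, a, q, l, h, h'⟩ := H.inv
  refine ⟨p, i, k, m, s, a, q, l, ?_, h'⟩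
  simpa using h

theorem pub_state {p i k m s a q l : Term} :
    Pub (.state (.tpm p) (.cpu i k) (.smram m s) (.drt a q l)) ↔
      Pub p ∧ Pub i ∧ Pub k ∧ Pub m ∧ Pub s ∧ Pub a ∧ Pub q ∧ Pub l ∧ SafeState p m a q l := by
  constructor
  · intro h
    obtain ⟨p, i, k, m, s, a, q, l, h, h'⟩ := h.state_inv
    simp at h
    obtain ⟨rfl, ⟨rfl, rfl⟩, ⟨rfl, rfl⟩, rfl, rfl, rfl⟩ := h
    exact h'
  · rintro ⟨h1, h2, h3, h4, h5, h6, h7, h8, h⟩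
    exact .state h1 h2 h3 h4 h5 h6 h7 h8 h

theorem Pub.closed {t : Term} (H : Pub t) : t.Closed := by
  induction H with
  | name => trivial
  | app _ _ ih => exact ih
  | senc _ ih => simpa [Term.Closed, Fin.forall_fin_succ] using ih
  | sealed => simp [Term.Closed, Fin.forall_fin_succ, Term.chain]
  | prog => simp [Term.Closed]
  | tpm_ch _ ih => simpa [Term.Closed] using ih
  | state _ _ _ _ _ _ _ _ _ => simp_all [Term.Closed, Fin.forall_fin_succ]

/-- Only a register `hchain` needs care. Then the authorisation would be `cpu_acc`, the entry point
`Tinit`, or a pair containing `Tstm`, none of which is public. -/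
theorem SafeState.set_pp {p i k m s a q l t v : Term} (H : SafeState p m a q l)
    (ht : Pub t) (h : t = .cpu_acc ∨ a = .prog t ∨ ∃ z z₁ z₂,
      Term.cpu i k = .cpu .tt z ∧ Term.smram m s = .smram (.prog z₁) (.prog z₂) ∧
        t = .tup ![z₁, z₂]) : SafeState p m a v l := by
  refine ⟨H.ne_pd, H.ne_launch, fun hp => ?_⟩
  obtain ⟨rfl, rfl, rfl, rfl⟩ := H.trusted hp
  rcases h with rfl | h | ⟨_, _, _, -, h2, rfl⟩
  · simp at ht
  · simp at h; subst h; simp at ht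
  · simp at h2; rw [← h2.1] at ht; simp [Fin.forall_fin_succ] at ht

/-- The argument for `SafeState.set_pp`, with `Tpp` in the role of `Tinit`. -/
theorem SafeState.set_lock {p i k m s a q l t v : Term} (H : SafeState p m a q l)
    (ht : Pub t) (h : t = .cpu_acc ∨ q = .prog t ∨ ∃ z z₁ z₂,
      Term.cpu i k = .cpu .tt z ∧ Term.smram m s = .smram (.prog z₁) (.prog z₂) ∧
        t = .tup ![z₁, z₂]) : SafeState p m a q v := by
  refine ⟨H.ne_pd, H.ne_launch, fun hp => ?_⟩
  obtain ⟨rfl, rfl, rfl, rfl⟩ := H.trusted hp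
  rcases h with rfl | h | ⟨_, _, _, -, h2, rfl⟩
  · simp at ht
  · simp at h; subst h; simp at ht
  · simp at h2; rw [← h2.1] at ht; simp [Fin.forall_fin_succ] at ht

/-- Operations on the register and on the loader component need a private token. The interrupt flag,
the cache and the second handler do not occur in `SafeState`, so they may change freely; the other
components are protected by authorisations or by the lock. -/
theorem Redex.pub {c : Prop} {b : ℕ} {f : Sym} {x : Fin f.arity → Term} {r : Term}
    (H : Redex c b f x r) (hf : f ∉ Sym.priv) (hx : ∀ i, Pub (x i)) : Pub r := by
  cases f <;> first | exact H.elim | (simp [Sym.priv] at hf; done) | simp only [Redex] at H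
  case proj n i =>
    obtain ⟨ts, h, rfl⟩ := H
    have := hx 0
    rw [h] at this
    exact pub_tup.1 this i
  case sdec =>
    obtain ⟨k, h, -⟩ := H
    have := hx 0
    rw [h] at this
    -- A public ciphertext has a public plaintext whatever its key, so the key need not be
    -- considered.
    exact this.inv.1
  case reset =>
    obtain ⟨_, _, _, _, _, -, h, -⟩ := H
    have := hx 1
    simp [h] at this
  case extend =>
    obtain ⟨_, _, _, _, _, -, h, -⟩ := H
    have := hx 1
    simp [h] at this
  case set_init =>
    obtain ⟨_, _, _, _, _, _, _, -, h, -⟩ := H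
    have := hx 1
    simp [h] at this
  all_goals have h0 := hx 0
  case pcr =>
    obtain ⟨_, _, _, h⟩ := H
    rw [h] at h0
    obtain ⟨p, i, k, m, s, a, q, l, h, h'⟩ := h0.state_inv
    simp at h; grind
  case int | cacheR | stm | smi =>
    obtain ⟨_, _, _, _, h⟩ := H
    rw [h] at h0
    obtain ⟨p, i, k, m, s, a, q, l, h, h'⟩ := h0.state_inv
    simp at h; grind
  case init | pp | lock =>
    obtain ⟨_, _, _, _, _, h⟩ := H
    rw [h] at h0
    obtain ⟨p, i, k, m, s, a, q, l, h, h'⟩ := h0.state_inv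
    simp at h; grind
  case set_int =>
    obtain ⟨_, _, _, _, _, _, _, h, h', rfl, hv, rfl⟩ := H
    rw [h] at h0
    obtain ⟨p, i, k, m, s, a, q, l, ⟨rfl, e, rfl, rfl⟩, h'⟩ := h0.state_inv
    have h2 := hx 2
    simp at e; obtain ⟨rfl, rfl⟩ := e
    rw [pub_state]; tauto
  case cacheW =>
    obtain ⟨_, _, _, _, _, _, h, rfl, rfl⟩ := H
    rw [h] at h0
    obtain ⟨p, i, k, m, s, a, q, l, ⟨rfl, e, rfl, rfl⟩, h'⟩ := h0.state_inv
    have h1 := hx 1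
    simp at e; obtain ⟨rfl, rfl⟩ := e
    rw [pub_state]; tauto
  case flush_smi =>
    obtain ⟨_, _, _, _, _, _, h, rfl⟩ := H
    rw [h] at h0
    obtain ⟨p, i, k, m, s, a, q, l, ⟨rfl, e, e', rfl⟩, h'⟩ := h0.state_inv
    simp at e; obtain ⟨rfl, rfl⟩ := e
    simp at e'; obtain ⟨rfl, rfl⟩ := e'
    rw [pub_state]; tauto
  case flush_stm =>
    obtain ⟨_, _, _, _, _, _, _, h, rfl⟩ := H
    rw [h] at h0
    obtain ⟨p, i, k, m, s, a, q, l, ⟨rfl, -⟩, -⟩ := h0.state_inv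
    rw [pub_state] at h0
    rw [pub_state]
    have := h0.2.2.2.2.2.2.2.2
    refine ⟨h0.1, h0.2.1, h0.2.2.1, h0.2.2.1, h0.2.2.2.2.1, h0.2.2.2.2.2.1, h0.2.2.2.2.2.2.1,
      h0.2.2.2.2.2.2.2.1, this.ne_pd, this.ne_launch, fun hp => ?_⟩
    -- Register `hchain` would force the lock to be `tt`, but the handler can be flushed only when
    -- it is `ff`.
    have := (this.trusted hp).2.2.2
    simp at this
  case set_pp =>
    obtain ⟨_, _, _, a, q, l, _, _, h, rfl, rfl, hv, rfl⟩ := H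
    rw [h] at h0
    obtain ⟨p, i, k, m, s, _, _, _, ⟨rfl, rfl, rfl, e⟩, h'⟩ := h0.state_inv
    have h1 := hx 1
    have h2 := hx 2
    simp at e; obtain ⟨rfl, rfl, rfl⟩ := e
    have := h'.2.2.2.2.2.2.2.2.set_pp (v := x 2) h1 hv
    rw [pub_state]; tauto
  case set_lock =>
    obtain ⟨_, _, _, a, q, l, _, _, h, rfl, rfl, hv, rfl⟩ := H
    rw [h] at h0
    obtain ⟨p, i, k, m, s, _, _, _, ⟨rfl, rfl, rfl, e⟩, h'⟩ := h0.state_inv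
    have h1 := hx 1
    have h2 := hx 2
    simp at e; obtain ⟨rfl, rfl, rfl⟩ := e
    have := h'.2.2.2.2.2.2.2.2.set_lock (v := x 2) h1 hv
    rw [pub_state]; tauto

/-- The attacker's knowledge is closed under the application of public symbols. -/
theorem pub_ev_app {c : Prop} {b : ℕ} {f : Sym} {a : Fin f.arity → Term} (hf : f ∉ Sym.priv)
    (ha : ∀ i, Pub (ev (Th c b) (a i))) : Pub (ev (Th c b) (.app f a)) := by
  rw [ev]
  rcases rootStep_cases c b f (fun i => ev (Th c b) (a i)) with h | ⟨h, h'⟩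
  · exact h.pub hf ha
  · rw [h']; exact .app hf ha

theorem pub_of_ded {c : Prop} {b : ℕ} {M : Set Term} (hM : ∀ t ∈ M, Pub (ev (Th c b) t)) {T : Term}
    (H : Ded (Th c b) M T) : Pub (ev (Th c b) T) := by
  induction H with
  | mem h h' => exact EqE_iff.1 h' ▸ hM _ h
  | app hf _ h' ih => exact EqE_iff.1 h' ▸ pub_ev_app hf ih

/-! ### Messages on channels -/

/-- The components of a state other than the register and the lock. -/
structure PubParts (i k m s a q : Term) : Prop where
  int : Pub i
  cache : Pub k
  stm : Pub m
  smi : Pub s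
  init : Pub a
  pp : Pub q

open Term in
/-- The register after the launch of the program `a` with the handler `m`. -/
abbrev launchReg (a m : Term) : Term := h (tup ![pd, tup ![h a, h m]])

open Term in
/-- The locked states of a launch. -/
abbrev lockedState (p i k m s a q : Term) : Term :=
  state (tpm p) (cpu i k) (smram m s) (drt a q tt)

open Term in
/-- An upper bound for the messages `T` that are sent on the channel `U`. A restricted name `n` is
linked by `φ n` to the value that is to be recorded by the request for which it was created. -/
inductive Msg (φ : Name → Term) : Term → Term → Prop
  | pub {U T : Term} : Pub U → Pub T → Msg φ U T
  | reset_req {n : Name} {p i k m s a q u : Term} : Pub p → PubParts i k m s a q → Pub u →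
      φ n = tup ![h u, h m] →
      Msg φ cpu_tpm (tup ![reset_req, .name n, lockedState p i k m s a q])
  | reset_resp {n : Name} {i k m s a q u : Term} : PubParts i k m s a q → Pub u →
      φ n = tup ![h u, h m] →
      Msg φ cpu_tpm (tup ![reset_resp, .name n, lockedState pd i k m s a q])
  | launch_req {n : Name} {i k m s a q u : Term} : PubParts i k m s a q → Pub u →
      φ n = tup ![h u, h m] →
      Msg φ cpu_tpm (tup ![extend_req, .name n, lockedState pd i k m s a q, tup ![h u, h m]])
  | launch_resp {n : Name} {i k m s a q u : Term} : PubParts i k m s a q → Pub u →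
      φ n = tup ![h u, h m] →
      Msg φ cpu_tpm (tup ![extend_resp, .name n, lockedState (launchReg u m) i k m s a q])
  | ext_channel {e : Term} : (Pub e ∨ ∃ j, e = entry j) →
      Msg φ cpu_tpm (tup ![ext_channel, tpm_ch (prog e)])
  | call {j : ℕ} {n i k m s q q' : Term} : Pub n → PubParts i k m s (prog (entry j)) q → Pub q' →
      Msg φ (entry j) (tup ![n, lockedState (launchReg (prog (entry j)) m) i k m s
        (prog (entry j)) q, tpm_ch (prog (entry j)), q'])
  | ret {j : ℕ} {n x : Term} : Pub n → Pub x → Msg φ (entry j) (tup ![drt_resp, n, x])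
  | start {j : ℕ} {x : Term} : Pub x → Msg φ (entry j) (tup ![x, tpm_ch (prog (entry j))])
  | init_req {n : Name} {i k m s q v : Term} : PubParts i k m s (prog Tinit) q → Pub v →
      φ n = v →
      Msg φ (tpm_ch (prog Tinit)) (tup ![extend_req, .name n,
        lockedState (launchReg (prog Tinit) m) i k m s (prog Tinit) q, v])
  | init_resp {n : Name} {i k m s q v : Term} : PubParts i k m s (prog Tinit) q → Pub v →
      φ n = v →
      Msg φ (tpm_ch (prog Tinit)) (tup ![extend_resp, .name n,
        lockedState (h (tup ![launchReg (prog Tinit) m, v])) i k m s (prog Tinit) q])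
  -- The protected program handles public states only, so these messages need no link through `φ`;
  -- what matters about the response is that its register has left `hchain`.
  | pp_req {n x : Term} : Pub n → Pub x →
      Msg φ (tpm_ch (prog Tpp)) (tup ![extend_req, n, x, bot])
  | pp_resp {n p y z w : Term} : Pub n → Pub (state (tpm p) y z w) → p ≠ hchain →
      Msg φ (tpm_ch (prog Tpp)) (tup ![extend_resp, n, state (tpm p) y z w])
  | pp_open {z : Term} : Pub z → Msg φ (tpm_ch (prog Tpp)) (tup ![tag_open, z])
  | pp_plain {v : Term} : v.Closed → Msg φ (tpm_ch (prog Tpp)) (tup ![tag_plain, v])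

/-- Every constructor of `Msg` other than `pub` concerns a channel outside `Pub`. Hence whatever the
attacker can overhear is public. -/
theorem Msg.pub_of_pub {φ : Name → Term} {U T : Term} (H : Msg φ U T) (hU : Pub U) : Pub T := by
  cases H <;> first | assumption | simp at hU

/-- Received values are substituted into processes; closedness rules out capture. -/
theorem Msg.closed {φ : Name → Term} {U T : Term} (H : Msg φ U T) : T.Closed := by
  cases H
  case pub h => exact h.closed
  case reset_req h1 h2 h3 h4 =>
    simp [Term.Closed, Fin.forall_fin_succ, h1.closed, h2.1.closed, h2.2.closed, h2.3.closed,
      h2.4.closed, h2.5.closed, h2.6.closed]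
  case reset_resp h2 h3 h4 =>
    simp [Term.Closed, Fin.forall_fin_succ, h2.1.closed, h2.2.closed, h2.3.closed,
      h2.4.closed, h2.5.closed, h2.6.closed]
  case launch_req h2 h3 h4 =>
    simp [Term.Closed, Fin.forall_fin_succ, h2.1.closed, h2.2.closed, h2.3.closed,
      h2.4.closed, h2.5.closed, h2.6.closed, h3.closed]
  case launch_resp h2 h3 h4 =>
    simp [Term.Closed, Fin.forall_fin_succ, h2.1.closed, h2.2.closed, h2.3.closed,
      h2.4.closed, h2.5.closed, h2.6.closed, h3.closed]
  case ext_channel h =>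
    rcases h with h | ⟨j, rfl⟩
    · simp [Term.Closed, Fin.forall_fin_succ, h.closed]
    · simp [Term.Closed, Fin.forall_fin_succ]
  case call h1 h2 h3 =>
    simp [Term.Closed, Fin.forall_fin_succ, h1.closed, h2.1.closed, h2.2.closed, h2.3.closed,
      h2.4.closed, h2.6.closed, h3.closed]
  case ret h1 h2 => simp [Term.Closed, Fin.forall_fin_succ, h1.closed, h2.closed]
  case start h => simp [Term.Closed, Fin.forall_fin_succ, h.closed]
  case init_req h2 h3 h4 =>
    simp [Term.Closed, Fin.forall_fin_succ, h2.1.closed, h2.2.closed, h2.3.closed,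
      h2.4.closed, h2.6.closed, h3.closed]
  case init_resp h2 h3 h4 =>
    simp [Term.Closed, Fin.forall_fin_succ, h2.1.closed, h2.2.closed, h2.3.closed,
      h2.4.closed, h2.6.closed, h3.closed]
  case pp_req h1 h2 => simp [Term.Closed, Fin.forall_fin_succ, h1.closed, h2.closed]
  case pp_resp h1 h2 h3 =>
    have := h2.closed
    simp [Term.Closed, Fin.forall_fin_succ, h1.closed] at this ⊢
    exact this
  case pp_open h => simp [Term.Closed, Fin.forall_fin_succ, h.closed]
  case pp_plain h => simp [Term.Closed, Fin.forall_fin_succ, h]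

/-! ### The invariant of processes -/

/-- The last component of a sequence. -/
def Term.last : Term → Term
  | .app (.tup (n + 1)) a => a (Fin.last n)
  | t => t

/-- The value that is to be recorded by the request that a process is about to make. -/
def Proc.datum : Proc → Term
  | .out _ _ (.inp _ _ (.out _ T _)) => T.last
  | .out _ T _ => T.last
  | _ => .bot

/-- Processes all of whose messages respect `Msg`, provided that those they receive do. -/
inductive Good (c : Prop) (b : ℕ) (φ : Name → Term) : Proc → Prop
  | nil : Good c b φ .nil
  | par {P Q : Proc} : Good c b φ P → Good c b φ Q → Good c b φ (.par P Q)
  | repl {P : Proc} : Good c b φ P → Good c b φ (.repl P)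
  -- The link of a fresh name may be prescribed at its creation, so goodness is asked only for names
  -- linked to the datum of the continuation.
  | new {l : Label} {x : Var} {P : Proc} :
      (∀ n : Name, n.label = l → φ n = P.datum → Good c b φ (P.subst (Subst.single x (.name n)))) →
      Good c b φ (.new l x P)
  | inp {U : Term} {A : Pat} {P : Proc} :
      (∀ σ : Subst, (∀ x ∈ A.bv, ev (Th c b) (σ x) = σ x) → (∀ x ∉ A.bv, σ x = .var x) →
        Msg φ (ev (Th c b) U) (ev (Th c b) (A.toTerm.subst σ)) → Good c b φ (P.subst σ)) →
      Good c b φ (.inp U A P)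
  | out {U T : Term} {P : Proc} : Msg φ (ev (Th c b) U) (ev (Th c b) T) → Good c b φ P →
      Good c b φ (.out U T P)
  | ite {U V : Term} {P Q : Proc} : (ev (Th c b) U = ev (Th c b) V → Good c b φ P) →
      (ev (Th c b) U ≠ ev (Th c b) V → Good c b φ Q) → Good c b φ (.ite U V P Q)
  | letin {x : Var} {T : Term} {P : Proc} :
      (Disjoint (ev (Th c b) T).sig (destructors (Th c b)) →
        Good c b φ (P.subst (Subst.single x (ev (Th c b) T)))) →
      Good c b φ (.letin x T P)

/-- The invariant of configurations. -/
def Inv (c : Prop) (b : ℕ) (C : Config) : Prop :=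
  (∀ t ∈ C.know, Pub (ev (Th c b) t)) ∧
  ∃ φ : Name → Term, ∀ φ' : Name → Term, (∀ n ∈ C.names, φ' n = φ n) →
    ∀ P ∈ C.procs, Good c b φ' P

/-- Subject reduction. Goodness is required for every `φ'` that agrees with `φ` on the names in use,
which leaves the links of future names open. In a communication the sender guarantees `Msg`, which
is exactly what the receiver assumes. -/
theorem Inv.red {c : Prop} {b : ℕ} {C C' : Config} (H : Inv c b C) (h : Red (Th c b) C C') :
    Inv c b C' := by
  obtain ⟨hM, φ, H⟩ := H
  cases h with
  | nil =>
    refine ⟨hM, φ, fun φ' h' => ?_⟩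
    have := H φ' h'
    simp only [Multiset.mem_cons, forall_eq_or_imp] at this
    exact this.2
  | bang =>
    refine ⟨hM, φ, fun φ' h' => ?_⟩
    have := H φ' h'
    simp only [Multiset.mem_cons, forall_eq_or_imp] at this ⊢
    obtain ⟨h1, h2⟩ := this
    cases h1 with | repl h => exact ⟨h, .repl h, h2⟩
  | par =>
    refine ⟨hM, φ, fun φ' h' => ?_⟩
    have := H φ' h'
    simp only [Multiset.mem_cons, forall_eq_or_imp] at this ⊢
    obtain ⟨h1, h2⟩ := this
    cases h1 with | par h h' => exact ⟨h, h', h2⟩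
  | new hl hn =>
    rename_i N M Ps l x P n
    -- The name is fresh, so linking it now to the value about to be recorded does not disturb the
    -- names in use.
    refine ⟨hM, Function.update φ n P.datum, fun φ' h' => ?_⟩
    have h1 : φ' n = P.datum := by simpa using h' n (by simp)
    have := H φ' fun k hk => by
      have hk' : k ≠ n := fun e => hn (e ▸ hk)
      simpa [hk'] using h' k (Or.inl hk)
    simp only [Multiset.mem_cons, forall_eq_or_imp] at this ⊢
    obtain ⟨h2, h3⟩ := this
    cases h2 with | new h => exact ⟨h n hl h1, h3⟩
  | comm hU h1 h2 hT =>
    rename_i N M Ps U T P U' A Q σ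
    rw [EqE_iff] at hU hT
    rw [nf_eq_ev] at h1
    have key : ∀ φ' : Name → Term, (∀ n ∈ N, φ' n = φ n) →
        Msg φ' (ev (Th c b) U) (ev (Th c b) T) ∧ Good c b φ' P ∧ Good c b φ' (Q.subst σ) ∧
          ∀ R ∈ Ps, Good c b φ' R := by
      intro φ' h'
      have := H φ' h'
      simp only [Multiset.mem_cons, forall_eq_or_imp] at this
      obtain ⟨h3, h4, h5⟩ := this
      cases h3 with
      | out h6 h7 =>
        cases h4 with
        | inp h8 => exact ⟨h6, h7, h8 σ h1 h2 (by rwa [← hU, ← hT]), h5⟩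
    refine ⟨?_, φ, fun φ' h' => ?_⟩
    · rintro t (ht | ⟨rfl, ht⟩)
      · exact hM t ht
      · exact (key φ fun _ _ => rfl).1.pub_of_pub (pub_of_ded hM ht)
    · simp only [Multiset.mem_cons, forall_eq_or_imp]
      exact (key φ' h').2
  | ite_true h =>
    refine ⟨hM, φ, fun φ' h' => ?_⟩
    have := H φ' h'
    simp only [Multiset.mem_cons, forall_eq_or_imp] at this ⊢
    obtain ⟨h1, h2⟩ := this
    cases h1 with | ite h3 h4 => exact ⟨h3 (EqE_iff.1 h), h2⟩
  | ite_false h =>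
    refine ⟨hM, φ, fun φ' h' => ?_⟩
    have := H φ' h'
    simp only [Multiset.mem_cons, forall_eq_or_imp] at this ⊢
    obtain ⟨h1, h2⟩ := this
    cases h1 with | ite h3 h4 => exact ⟨h4 (mt EqE_iff.2 h), h2⟩
  | letin h =>
    rw [nf_eq_ev] at h ⊢
    refine ⟨hM, φ, fun φ' h' => ?_⟩
    have := H φ' h'
    simp only [Multiset.mem_cons, forall_eq_or_imp] at this ⊢
    obtain ⟨h1, h2⟩ := this
    cases h1 with | letin h3 => exact ⟨h3 h, h2⟩

/-! ### Processes in environments -/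

theorem Term.subst_subst (t : Term) (σ τ : Subst) :
    (t.subst σ).subst τ = t.subst fun y => (σ y).subst τ := by
  induction t with
  | var x => rfl
  | name n => rfl
  | app f a ih => simp only [Term.subst, ih]

theorem Term.subst_var (t : Term) : t.subst .var = t := by
  induction t with
  | var x => rfl
  | name n => rfl
  | app f a ih => simp only [Term.subst, ih]

/-- Substitutions by closed terms. -/
def Subst.Wf (σ : Subst) : Prop := ∀ y, σ y = .var y ∨ (σ y).Closed

theorem Subst.Wf.drop {σ : Subst} (hσ : σ.Wf) (s : Finset Var) : (σ.drop s).Wf := by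
  intro y
  by_cases h : y ∈ s
  · simp [Subst.drop, h]
  · simpa [Subst.drop, h] using hσ y

theorem Subst.Wf.update {σ : Subst} (hσ : σ.Wf) (x : Var) {v : Term} (hv : v.Closed) :
    Subst.Wf (Function.update σ x v) := by
  intro y
  by_cases h : y = x
  · subst h; simp [hv]
  · simpa [h] using hσ y

/-- Each value of `σ` is the variable itself or closed, so hiding `s` from `τ` makes no difference
outside `s`. This is the absence of capture. -/
theorem Subst.Wf.drop_comp {σ : Subst} (hσ : σ.Wf) (τ : Subst) (s : Finset Var) :
    (fun y => (σ.drop s y).subst (τ.drop s)) = Subst.drop (fun y => (σ y).subst τ) s := by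
  funext y
  by_cases h : y ∈ s
  · simp [Subst.drop, h, Term.subst]
  · simp only [Subst.drop, h, if_false]
    rcases hσ y with e | e
    · simp [e, Term.subst, Subst.drop, h]
    · rw [e.subst_eq, e.subst_eq]

theorem Pat.bv_subst (A : Pat) (σ : Subst) : (A.subst σ).bv = A.bv := by
  induction A with
  | bind x => rfl
  | eq t => rfl
  | tup ps ih => simp only [Pat.subst, Pat.bv, ih]

theorem Pat.subst_subst (A : Pat) (σ τ : Subst) :
    (A.subst σ).subst τ = A.subst fun y => (σ y).subst τ := by
  induction A with
  | bind x => rfl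
  | eq t => simp only [Pat.subst, Term.subst_subst]
  | tup ps ih => simp only [Pat.subst, ih]

theorem Pat.subst_var (A : Pat) : A.subst .var = A := by
  induction A with
  | bind x => rfl
  | eq t => simp only [Pat.subst, Term.subst_var]
  | tup ps ih => simp only [Pat.subst, ih]

theorem Subst.drop_var (s : Finset Var) : Subst.drop .var s = .var := by
  funext y; simp [Subst.drop]

theorem Proc.subst_var (P : Proc) : P.subst .var = P := by
  induction P <;> simp_all [Proc.subst, Subst.drop_var, Term.subst_var, Pat.subst_var]

theorem Proc.subst_subst (P : Proc) {σ : Subst} (hσ : σ.Wf) (τ : Subst) :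
    (P.subst σ).subst τ = P.subst fun y => (σ y).subst τ := by
  induction P generalizing σ τ with
  | nil => rfl
  | par P Q ih ih' => simp only [Proc.subst, ih hσ, ih' hσ]
  | repl P ih => simp only [Proc.subst, ih hσ]
  | new l x P ih => simp only [Proc.subst, ih (hσ.drop _), hσ.drop_comp]
  | inp U A P ih =>
    simp only [Proc.subst, ih (hσ.drop _), hσ.drop_comp, Term.subst_subst, Pat.bv_subst,
      Pat.subst_subst]
  | out U T P ih => simp only [Proc.subst, ih hσ, Term.subst_subst]
  | ite U V P Q ih ih' => simp only [Proc.subst, ih hσ, ih' hσ, Term.subst_subst]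
  | letin x T P ih => simp only [Proc.subst, ih (hσ.drop _), hσ.drop_comp, Term.subst_subst]

/-- `σ`, overridden by `τ` on `s`. -/
def Subst.override (s : Finset Var) (τ σ : Subst) : Subst := fun y => if y ∈ s then τ y else σ y

theorem Subst.Wf.drop_subst {σ : Subst} (hσ : σ.Wf) {τ : Subst} {s : Finset Var}
    (hτ : ∀ y ∉ s, τ y = .var y) :
    (fun y => (σ.drop s y).subst τ) = Subst.override s τ σ := by
  funext y
  by_cases h : y ∈ s
  · simp [Subst.drop, Subst.override, h, Term.subst]
  · simp only [Subst.drop, Subst.override, h, if_false]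
    rcases hσ y with e | e
    · simp [e, Term.subst, hτ y h]
    · rw [e.subst_eq]

theorem Subst.Wf.drop_single {σ : Subst} (hσ : σ.Wf) (x : Var) (v : Term) :
    (fun y => (σ.drop {x} y).subst (Subst.single x v)) = Function.update σ x v := by
  rw [hσ.drop_subst (by simp +contextual [Subst.single])]
  funext y
  by_cases h : y = x <;> simp [Subst.override, Subst.single, h]

theorem Pat.toTerm_subst (A : Pat) {s : Finset Var} (hs : A.bv ⊆ s) {σ τ : Subst} (hσ : σ.Wf)
    (hτ : ∀ y ∉ s, τ y = .var y) :
    (A.subst (σ.drop s)).toTerm.subst τ = A.toTerm.subst (Subst.override s τ σ) := by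
  induction A with
  | bind x =>
    have : x ∈ s := hs (by simp [Pat.bv])
    simp [Pat.subst, Pat.toTerm, Term.subst, Subst.override, this]
  | eq t => simp only [Pat.subst, Pat.toTerm, Term.subst_subst, hσ.drop_subst hτ]
  | tup ps ih =>
    simp only [Pat.subst, Pat.toTerm, Term.subst]
    congr 1
    funext i
    exact ih i fun x hx => hs (by simp only [Pat.bv, Finset.mem_biUnion]; exact ⟨i, by simp, hx⟩)

/-- The values that a message assigns to the variables of a pattern are components of it. -/
theorem Pat.forall_bv {c : Prop} {b : ℕ} {X : Term → Prop}
    (hX : ∀ {n : ℕ} {ts : Fin n → Term}, X (.tup ts) → ∀ i, X (ts i)) (A : Pat) (τ : Subst)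
    (hτ : ∀ x ∈ A.bv, ev (Th c b) (τ x) = τ x) (H : X (ev (Th c b) (A.toTerm.subst τ))) :
    ∀ x ∈ A.bv, X (τ x) := by
  induction A with
  | bind x =>
    simp only [Pat.bv, Finset.mem_singleton, forall_eq] at hτ ⊢
    simpa [Pat.toTerm, Term.subst, hτ] using H
  | eq t => simp [Pat.bv]
  | tup ps ih =>
    intro x hx
    simp only [Pat.bv, Finset.mem_biUnion] at hx hτ
    obtain ⟨i, hi, hx⟩ := hx
    refine ih i (fun x hx => hτ x ⟨i, hi, hx⟩) ?_ x hx
    simp only [Pat.toTerm, Term.subst] at H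
    rw [ev_tup] at H
    exact hX H i

/-- `P` is good in the environment `σ`. -/
def GoodIn (c : Prop) (b : ℕ) (φ : Name → Term) (σ : Subst) (P : Proc) : Prop :=
  σ.Wf → Good c b φ (P.subst σ)

section
variable {c : Prop} {b : ℕ} {φ : Name → Term} {σ : Subst} {P Q : Proc} {U V T : Term} {x : Var}

theorem GoodIn.good (H : GoodIn c b φ .var P) : Good c b φ P := by
  have := H fun _ => .inl rfl
  rwa [P.subst_var] at this

theorem GoodIn.nil : GoodIn c b φ σ .nil := fun _ => .nil

theorem GoodIn.par (hP : GoodIn c b φ σ P) (hQ : GoodIn c b φ σ Q) : GoodIn c b φ σ (.par P Q) :=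
  fun hσ => .par (hP hσ) (hQ hσ)

theorem GoodIn.repl (hP : GoodIn c b φ σ P) : GoodIn c b φ σ (.repl P) :=
  fun hσ => .repl (hP hσ)

theorem GoodIn.new {l : Label}
    (H : ∀ n : Name, n.label = l → φ n = (P.subst (σ.drop {x})).datum →
      GoodIn c b φ (Function.update σ x (.name n)) P) : GoodIn c b φ σ (.new l x P) := by
  intro hσ
  refine .new fun n hl hn => ?_
  have := H n hl hn (hσ.update _ trivial)
  rwa [P.subst_subst (hσ.drop _), hσ.drop_single]

theorem GoodIn.inp {A : Pat}
    (H : ∀ τ : Subst, (∀ x ∈ A.bv, ev (Th c b) (τ x) = τ x) →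
      Msg φ (ev (Th c b) (U.subst σ)) (ev (Th c b) (A.toTerm.subst (Subst.override A.bv τ σ))) →
      GoodIn c b φ (Subst.override A.bv τ σ) P) : GoodIn c b φ σ (.inp U A P) := by
  intro hσ
  refine .inp fun τ h1 h2 h3 => ?_
  rw [Pat.bv_subst] at h1 h2
  -- Bound values are components of a closed message, so the enlarged environment is again well
  -- formed.
  have hcl := Pat.forall_bv (X := Term.Closed) (fun h => h) _ τ (by rwa [Pat.bv_subst]) h3.closed
  rw [Pat.bv_subst] at hcl
  rw [Pat.toTerm_subst A subset_rfl hσ h2] at h3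
  rw [P.subst_subst (hσ.drop _), hσ.drop_subst h2]
  refine H τ h1 h3 fun y => ?_
  by_cases hy : y ∈ A.bv
  · simp [Subst.override, hy, hcl y hy]
  · simpa [Subst.override, hy] using hσ y

theorem GoodIn.out (h : Msg φ (ev (Th c b) (U.subst σ)) (ev (Th c b) (T.subst σ)))
    (hP : GoodIn c b φ σ P) : GoodIn c b φ σ (.out U T P) :=
  fun hσ => .out h (hP hσ)

theorem GoodIn.ite
    (hP : ev (Th c b) (U.subst σ) = ev (Th c b) (V.subst σ) → GoodIn c b φ σ P)
    (hQ : ev (Th c b) (U.subst σ) ≠ ev (Th c b) (V.subst σ) → GoodIn c b φ σ Q) :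
    GoodIn c b φ σ (.ite U V P Q) :=
  fun hσ => .ite (fun h => hP h hσ) (fun h => hQ h hσ)

theorem GoodIn.letin
    (H : Disjoint (ev (Th c b) (T.subst σ)).sig (destructors (Th c b)) →
      (ev (Th c b) (T.subst σ)).Closed ∧
        GoodIn c b φ (Function.update σ x (ev (Th c b) (T.subst σ))) P) :
    GoodIn c b φ σ (.letin x T P) := by
  intro hσ
  refine .letin fun h => ?_
  have := (H h).2 (hσ.update _ (H h).1)
  rwa [P.subst_subst (hσ.drop _), hσ.drop_single]

end

/-! ### Attackers -/

theorem pub_ev_subst {c : Prop} {b : ℕ} {t : Term} {σ : Subst} (hsig : ∀ f ∈ t.sig, f ∉ Sym.priv)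
    (hnames : ∀ n ∈ t.names, n.label = .att) (hσ : ∀ x ∈ t.fv, Pub (ev (Th c b) (σ x))) :
    Pub (ev (Th c b) (t.subst σ)) := by
  induction t with
  | var x => exact hσ x rfl
  | name n =>
    refine .name ?_
    rw [hnames n rfl]; simp
  | app f a ih =>
    simp only [Term.sig, Term.names, Term.fv, Set.mem_union, Set.mem_iUnion,
      Set.mem_singleton_iff] at hsig hnames hσ
    rw [Term.subst]
    exact pub_ev_app (hsig f (.inl rfl)) fun i => ih i (fun g hg => hsig g (.inr ⟨i, hg⟩))
      (fun n hn => hnames n ⟨i, hn⟩) fun x hx => hσ x ⟨i, hx⟩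

/-- All values in an attacker's environment are public: it computes with public symbols, its own
fresh names are public, and by `Msg.pub_of_pub` its public channels deliver public messages. -/
theorem goodIn_attacker {c : Prop} {b : ℕ} {φ : Name → Term} (P : Proc) {σ : Subst}
    (hsig : ∀ f ∈ P.sig, f ∉ Sym.priv) (hnames : ∀ n ∈ P.names, n.label = .att)
    (hlabels : ∀ l ∈ P.labels, l = .att) (hσ : ∀ x ∈ P.fv, Pub (ev (Th c b) (σ x))) :
    GoodIn c b φ σ P := by
  induction P generalizing σ with
  | nil => exact .nil
  | par P Q ih ih' =>
    simp only [Proc.sig, Proc.names, Proc.labels, Proc.fv, Set.mem_union] at hsig hnames hlabels hσ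
    exact .par (ih (fun f h => hsig f (.inl h)) (fun f h => hnames f (.inl h))
      (fun f h => hlabels f (.inl h)) fun f h => hσ f (.inl h))
      (ih' (fun f h => hsig f (.inr h)) (fun f h => hnames f (.inr h))
      (fun f h => hlabels f (.inr h)) fun f h => hσ f (.inr h))
  | repl P ih => exact .repl (ih hsig hnames hlabels hσ)
  | new l x P ih =>
    simp only [Proc.sig, Proc.names, Proc.labels, Proc.fv, Set.mem_union, Set.mem_singleton_iff,
      Set.mem_sdiff] at hsig hnames hlabels hσ
    refine .new fun n hl hn => ih hsig hnames (fun l h => hlabels l (.inr h)) fun y hy => ?_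
    by_cases h : y = x
    · subst h
      simp only [Function.update_self]
      refine .name ?_
      rw [hl, hlabels l (.inl rfl)]; simp
    · simpa [h] using hσ y ⟨hy, h⟩
  | inp U A P ih =>
    simp only [Proc.sig, Proc.names, Proc.labels, Proc.fv, Set.mem_union, Set.mem_sdiff,
      Finset.mem_coe] at hsig hnames hlabels hσ
    refine .inp fun τ h1 h2 => ?_
    have hU := pub_ev_subst (c := c) (b := b) (t := U) (σ := σ) (fun f h => hsig f (.inl (.inl h)))
      (fun f h => hnames f (.inl (.inl h))) (fun f h => hσ f (.inl h))
    have h3 := Pat.forall_bv (X := Pub) (fun h => pub_tup.1 h) A (Subst.override A.bv τ σ)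
      (fun x hx => by simpa [Subst.override, hx] using h1 x hx) (h2.pub_of_pub hU)
    refine ih (fun f h => hsig f (.inr h)) (fun f h => hnames f (.inr h)) hlabels fun y hy => ?_
    by_cases h : y ∈ A.bv
    · have := h3 y h
      simp only [Subst.override, h, if_true] at this ⊢
      rwa [h1 y h]
    · simpa [Subst.override, h] using hσ y (.inr ⟨.inr hy, h⟩)
  | out U T P ih =>
    simp only [Proc.sig, Proc.names, Proc.labels, Proc.fv, Set.mem_union] at hsig hnames hlabels hσ
    refine .out (.pub ?_ ?_) (ih (fun f h => hsig f (.inr h)) (fun f h => hnames f (.inr h))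
      hlabels fun f h => hσ f (.inr h))
    · exact pub_ev_subst (fun f h => hsig f (.inl (.inl h))) (fun f h => hnames f (.inl (.inl h)))
        (fun f h => hσ f (.inl (.inl h)))
    · exact pub_ev_subst (fun f h => hsig f (.inl (.inr h))) (fun f h => hnames f (.inl (.inr h)))
        (fun f h => hσ f (.inl (.inr h)))
  | ite U V P Q ih ih' =>
    simp only [Proc.sig, Proc.names, Proc.labels, Proc.fv, Set.mem_union] at hsig hnames hlabels hσ
    exact .ite (fun _ => ih (fun f h => hsig f (.inl (.inr h))) (fun f h => hnames f (.inl (.inr h)))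
      (fun f h => hlabels f (.inl h)) fun f h => hσ f (.inl (.inr h)))
      (fun _ => ih' (fun f h => hsig f (.inr h)) (fun f h => hnames f (.inr h))
      (fun f h => hlabels f (.inr h)) fun f h => hσ f (.inr h))
  | letin x T P ih =>
    simp only [Proc.sig, Proc.names, Proc.labels, Proc.fv, Set.mem_union, Set.mem_singleton_iff,
      Set.mem_sdiff] at hsig hnames hlabels hσ
    have hT := pub_ev_subst (c := c) (b := b) (t := T) (σ := σ) (fun f h => hsig f (.inl h))
      (fun f h => hnames f (.inl h)) (fun f h => hσ f (.inl h))
    refine .letin fun _ => ⟨hT.closed, ih (fun f h => hsig f (.inr h)) (fun f h => hnames f (.inr h))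
      hlabels fun y hy => ?_⟩
    by_cases h : y = x
    · subst h; simpa using hT
    · simpa [h] using hσ y (.inr ⟨hy, h⟩)

theorem good_attacker {c : Prop} {b : ℕ} {φ : Name → Term} {Q : Proc} (H : Attacker Q) :
    Good c b φ Q := by
  obtain ⟨h1, h2, h3, h4⟩ := H
  exact (goodIn_attacker Q (fun f hf hf' => (h2 ▸ ⟨hf, hf'⟩ : f ∈ (∅ : Set Sym))) h3 h4
    (by simp [h1])).good

/-- The invariant holds initially, when nothing is known, and is carried along the run. -/
theorem pub_of_att {c : Prop} {b : ℕ} {P : Proc} (hP : ∀ φ, Good c b φ P) {T : Term}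
    (H : Att (Th c b) P T) : Pub (ev (Th c b) T) := by
  obtain ⟨Q, hQ, C, hC, hT⟩ := H
  have key : Inv c b C := by
    clear hT
    induction hC with
    | refl =>
      -- Goodness of the initial processes holds for every `φ`, so its starting value is arbitrary.
      refine ⟨by simp, fun _ => .bot, fun φ' _ => ?_⟩
      simp only [Multiset.mem_singleton, forall_eq]
      exact .par (hP _) (good_attacker hQ)
    | tail _ h ih => exact ih.red h
  exact pub_of_ded key.1 hT

/-! ### Inputs with the patterns of the protocol -/

section
variable {c : Prop} {b : ℕ} {φ : Name → Term} {σ : Subst} {P : Proc} {U : Term}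
  {x y z w : Var} {t t' : Term}

/-- This rule and its variants cover the pattern shapes of the protocol. They replace the overriding
substitution by explicit updates, which `simp` can look up. -/
theorem GoodIn.inp_var
    (H : ∀ v, ev (Th c b) v = v → Msg φ (ev (Th c b) (U.subst σ)) v →
      GoodIn c b φ (Function.update σ x v) P) :
    GoodIn c b φ σ (.inp U (.bind x) P) := by
  refine .inp fun τ h1 h2 => ?_
  have hx := h1 x (by simp [Pat.bv])
  have e : Subst.override (Pat.bind x).bv τ σ = Function.update σ x (τ x) := by
    funext u
    by_cases h : u = x <;> simp [Subst.override, Pat.bv, Function.update, h]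
  rw [e] at h2 ⊢
  exact H _ hx (by simpa [Pat.toTerm, Term.subst, hx] using h2)

theorem GoodIn.inp_tag_var
    (H : ∀ v, ev (Th c b) v = v →
      Msg φ (ev (Th c b) (U.subst σ))
        (.tup ![ev (Th c b) (t.subst (Function.update σ x v)), v]) →
      GoodIn c b φ (Function.update σ x v) P) :
    GoodIn c b φ σ (.inp U (.tup ![.eq t, .bind x]) P) := by
  refine .inp fun τ h1 h2 => ?_
  have hx := h1 x (by simp [Pat.bv, Fin.exists_fin_succ])
  have e : Subst.override (Pat.tup ![.eq t, .bind x]).bv τ σ = Function.update σ x (τ x) := by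
    funext u
    by_cases h : u = x <;> simp [Subst.override, Pat.bv, Function.update, h, Fin.exists_fin_succ]
  rw [e] at h2 ⊢
  refine H _ hx ?_
  convert h2 using 1
  simp [Pat.toTerm, Term.subst]
  funext i
  fin_cases i <;> simp [Pat.toTerm, Term.subst, hx]
theorem GoodIn.inp_tag_var2 (hxy : x ≠ y)
    (H : ∀ v0 v1, ev (Th c b) v0 = v0 → ev (Th c b) v1 = v1 →
      Msg φ (ev (Th c b) (U.subst σ))
        (.tup ![ev (Th c b) (t.subst (Function.update (Function.update σ x v0) y v1)),
          v0,
          v1]) →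
      GoodIn c b φ (Function.update (Function.update σ x v0) y v1) P) :
    GoodIn c b φ σ (.inp U (.tup ![.eq t, .bind x, .bind y]) P) := by
  refine .inp fun τ h1 h2 => ?_
  have hx := h1 x (by simp [Pat.bv, Fin.exists_fin_succ])
  have hy := h1 y (by simp [Pat.bv, Fin.exists_fin_succ])
  have e : Subst.override (Pat.tup ![.eq t, .bind x, .bind y]).bv τ σ =
      Function.update (Function.update σ x (τ x)) y (τ y) := by
    funext u
    clear H h1 h2
    simp [Subst.override, Pat.bv, Function.update, Fin.exists_fin_succ]
    grind
  rw [e] at h2 ⊢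
  refine H _ _ hx hy ?_
  convert h2 using 1
  simp [Pat.toTerm, Term.subst]
  funext i
  fin_cases i <;> simp [Pat.toTerm, Term.subst, *]

theorem GoodIn.inp_tag_var3 (hxy : x ≠ y) (hxz : x ≠ z) (hyz : y ≠ z)
    (H : ∀ v0 v1 v2, ev (Th c b) v0 = v0 → ev (Th c b) v1 = v1 → ev (Th c b) v2 = v2 →
      Msg φ (ev (Th c b) (U.subst σ))
        (.tup ![ev (Th c b) (t.subst (Function.update (Function.update (Function.update σ x v0) y v1) z v2)),
          v0,
          v1,
          v2]) →
      GoodIn c b φ (Function.update (Function.update (Function.update σ x v0) y v1) z v2) P) :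
    GoodIn c b φ σ (.inp U (.tup ![.eq t, .bind x, .bind y, .bind z]) P) := by
  refine .inp fun τ h1 h2 => ?_
  have hx := h1 x (by simp [Pat.bv, Fin.exists_fin_succ])
  have hy := h1 y (by simp [Pat.bv, Fin.exists_fin_succ])
  have hz := h1 z (by simp [Pat.bv, Fin.exists_fin_succ])
  have e : Subst.override (Pat.tup ![.eq t, .bind x, .bind y, .bind z]).bv τ σ =
      Function.update (Function.update (Function.update σ x (τ x)) y (τ y)) z (τ z) := by
    funext u
    clear H h1 h2
    simp [Subst.override, Pat.bv, Function.update, Fin.exists_fin_succ]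
    grind
  rw [e] at h2 ⊢
  refine H _ _ _ hx hy hz ?_
  convert h2 using 1
  simp [Pat.toTerm, Term.subst]
  funext i
  fin_cases i <;> simp [Pat.toTerm, Term.subst, *]

theorem GoodIn.inp_tag_eq_var
    (H : ∀ v, ev (Th c b) v = v →
      Msg φ (ev (Th c b) (U.subst σ))
        (.tup ![ev (Th c b) (t.subst (Function.update σ x v)),
          ev (Th c b) (t'.subst (Function.update σ x v)),
          v]) →
      GoodIn c b φ (Function.update σ x v) P) :
    GoodIn c b φ σ (.inp U (.tup ![.eq t, .eq t', .bind x]) P) := by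
  refine .inp fun τ h1 h2 => ?_
  have hx := h1 x (by simp [Pat.bv, Fin.exists_fin_succ])
  have e : Subst.override (Pat.tup ![.eq t, .eq t', .bind x]).bv τ σ =
      Function.update σ x (τ x) := by
    funext u
    clear H h1 h2
    simp [Subst.override, Pat.bv, Function.update, Fin.exists_fin_succ]
    grind
  rw [e] at h2 ⊢
  refine H _ hx ?_
  convert h2 using 1
  simp [Pat.toTerm, Term.subst]
  funext i
  fin_cases i <;> simp [Pat.toTerm, Term.subst, *]

theorem GoodIn.inp_var2 (hxy : x ≠ y)
    (H : ∀ v0 v1, ev (Th c b) v0 = v0 → ev (Th c b) v1 = v1 →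
      Msg φ (ev (Th c b) (U.subst σ))
        (.tup ![v0,
          v1]) →
      GoodIn c b φ (Function.update (Function.update σ x v0) y v1) P) :
    GoodIn c b φ σ (.inp U (.tup ![.bind x, .bind y]) P) := by
  refine .inp fun τ h1 h2 => ?_
  have hx := h1 x (by simp [Pat.bv, Fin.exists_fin_succ])
  have hy := h1 y (by simp [Pat.bv, Fin.exists_fin_succ])
  have e : Subst.override (Pat.tup ![.bind x, .bind y]).bv τ σ =
      Function.update (Function.update σ x (τ x)) y (τ y) := by
    funext u
    clear H h1 h2
    simp [Subst.override, Pat.bv, Function.update, Fin.exists_fin_succ]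
    grind
  rw [e] at h2 ⊢
  refine H _ _ hx hy ?_
  convert h2 using 1
  simp [Pat.toTerm, Term.subst]
  funext i
  fin_cases i <;> simp [Pat.toTerm, Term.subst, *]

theorem GoodIn.inp_var4 (hxy : x ≠ y) (hxz : x ≠ z) (hyz : y ≠ z) (hxw : x ≠ w)
    (hyw : y ≠ w) (hzw : z ≠ w)
    (H : ∀ v0 v1 v2 v3, ev (Th c b) v0 = v0 → ev (Th c b) v1 = v1 → ev (Th c b) v2 = v2 →
      ev (Th c b) v3 = v3 →
      Msg φ (ev (Th c b) (U.subst σ))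
        (.tup ![v0,
          v1,
          v2,
          v3]) →
      GoodIn c b φ (Function.update (Function.update (Function.update (Function.update σ x v0) y v1)
        z v2) w v3) P) :
    GoodIn c b φ σ (.inp U (.tup ![.bind x, .bind y, .bind z, .bind w]) P) := by
  refine .inp fun τ h1 h2 => ?_
  have hx := h1 x (by simp [Pat.bv, Fin.exists_fin_succ])
  have hy := h1 y (by simp [Pat.bv, Fin.exists_fin_succ])
  have hz := h1 z (by simp [Pat.bv, Fin.exists_fin_succ])
  have hw := h1 w (by simp [Pat.bv, Fin.exists_fin_succ])
  have e : Subst.override (Pat.tup ![.bind x, .bind y, .bind z, .bind w]).bv τ σ =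
      Function.update (Function.update (Function.update (Function.update σ x (τ x)) y (τ y)) z (τ z)) w (τ w) := by
    funext u
    clear H h1 h2
    simp [Subst.override, Pat.bv, Function.update, Fin.exists_fin_succ]
    grind
  rw [e] at h2 ⊢
  refine H _ _ _ _ hx hy hz hw ?_
  convert h2 using 1
  simp [Pat.toTerm, Term.subst]
  funext i
  fin_cases i <;> simp [Pat.toTerm, Term.subst, *]

end

/-! ### Evaluation of the destructors of the protocol -/

/-- A symbol counts as a destructor once some instance of a rule has it at the root; `bot` fills the
variables of such an instance. -/
theorem mem_destructors {c : Prop} {b : ℕ} {f : Sym}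
    (hf : f ∈ [Sym.sdec, .unsealData, .get_entry, .pcr, .reset, .extend, .set_pcr, .set_int,
      .set_init, .set_pp, .set_lock]) : f ∈ destructors (Th c b) := by
  simp only [List.mem_cons, List.not_mem_nil, or_false] at hf
  rcases hf with rfl | rfl | rfl | rfl | rfl | rfl | rfl | rfl | rfl | rfl | rfl
  · exact ⟨_, _, .inl (.inr (.inl (.sdec .bot .bot)))⟩
  · exact ⟨_, _, .inl (.inr (.inl (.unsealData .bot .bot)))⟩
  · exact ⟨_, _, .inl (.inr (.inr (.inl (.get_entry .bot))))⟩
  · exact ⟨_, _, .inl (.inr (.inr (.inr (.pcr .bot .bot .bot .bot))))⟩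
  · exact ⟨_, _, .inl (.inr (.inr (.inr (.reset_pd .bot .bot .bot .bot))))⟩
  · exact ⟨_, _, .inl (.inr (.inr (.inr (.extend .bot .bot .bot .bot .bot))))⟩
  · exact ⟨_, _, .inl (.inr (.inr (.inr (.set_pcr .bot .bot .bot .bot .bot))))⟩
  · exact ⟨_, _, .inl (.inr (.inr (.inr (.set_int_cpu .bot .bot .bot .bot .bot .bot))))⟩
  · exact ⟨_, _, .inl (.inr (.inr (.inr (.set_init .bot .bot .bot .bot .bot .bot .bot))))⟩
  · exact ⟨_, _, .inl (.inr (.inr (.inr (.set_pp_cpu .bot .bot .bot .bot .bot .bot .bot))))⟩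
  · exact ⟨_, _, .inl (.inr (.inr (.inr (.set_lock_cpu .bot .bot .bot .bot .bot .bot .bot))))⟩

theorem ev_fixed {c : Prop} {b : ℕ} {t v : Term} (h : ev (Th c b) t = v) : ev (Th c b) v = v := by
  rw [← h, ev_ev]

/-- The result of an evaluation may be stored in a variable. -/
abbrev Ok (c : Prop) (b : ℕ) (t : Term) : Prop :=
  Disjoint (ev (Th c b) t).sig (destructors (Th c b))

section
variable {c : Prop} {b : ℕ} {x v t z k : Term}

/-- In these evaluation lemmas a `let` that proceeds has a value without destructors, so its rule
must have fired and the argument has the shape the rule requires. -/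
theorem eval_reset (hx : ev (Th c b) x = x) (hv : ev (Th c b) v = v)
    (H : Ok c b (.reset x .tpm_acc v)) :
    ∃ p x₁ x₂ x₃, x = .state (.tpm p) x₁ x₂ x₃ ∧
      ev (Th c b) (.reset x .tpm_acc v) = .state (.tpm v) x₁ x₂ x₃ := by
  obtain ⟨p, x₁, x₂, x₃, v', h, -, h', -, e⟩ := redex_of_disjoint (mem_destructors (by simp)) H
  simp [hx, hv] at h h'
  subst h'
  exact ⟨p, x₁, x₂, x₃, h, e⟩

theorem eval_extend (hx : ev (Th c b) x = x) (hv : ev (Th c b) v = v)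
    (H : Ok c b (.extend x .tpm_acc v)) :
    ∃ p x₁ x₂ x₃, x = .state (.tpm p) x₁ x₂ x₃ ∧
      ev (Th c b) (.extend x .tpm_acc v) = .state (.tpm (.h (.tup ![p, v]))) x₁ x₂ x₃ := by
  obtain ⟨p, x₁, x₂, x₃, v', h, -, h', e⟩ := redex_of_disjoint (mem_destructors (by simp)) H
  simp [hx, hv] at h h'
  subst h'
  exact ⟨p, x₁, x₂, x₃, h, e⟩

theorem eval_set_pcr (hx : ev (Th c b) x = x) (hv : ev (Th c b) v = v)
    (H : Ok c b (.set_pcr x .tpm_acc v)) :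
    ∃ p x₁ x₂ x₃, x = .state (.tpm p) x₁ x₂ x₃ ∧
      ev (Th c b) (.set_pcr x .tpm_acc v) = .state (.tpm v) x₁ x₂ x₃ := by
  obtain ⟨p, x₁, x₂, x₃, v', h, -, h', e⟩ := redex_of_disjoint (mem_destructors (by simp)) H
  simp [hx, hv] at h h'
  subst h'
  exact ⟨p, x₁, x₂, x₃, h, e⟩

theorem eval_pcr (hx : ev (Th c b) x = x) (H : Ok c b (.pcr x)) :
    ∃ x₁ x₂ x₃, x = .state (.tpm (ev (Th c b) (.pcr x))) x₁ x₂ x₃ := by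
  obtain ⟨x₁, x₂, x₃, h⟩ := redex_of_disjoint (mem_destructors (by simp)) H
  simp only [Function.comp_apply, Matrix.cons_val_zero, hx] at h
  exact ⟨x₁, x₂, x₃, h⟩

theorem eval_get_entry (H : Ok c b (.get_entry x)) :
    ev (Th c b) x = .prog (ev (Th c b) (.get_entry x)) :=
  redex_of_disjoint (mem_destructors (by simp)) H

theorem eval_unseal (hz : ev (Th c b) z = z) (H : Ok c b (.unsealData z t)) :
    z = .sealData (ev (Th c b) (.unsealData z t)) (ev (Th c b) t) := by
  obtain ⟨k, h, h'⟩ := redex_of_disjoint (mem_destructors (by simp)) H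
  simp only [Function.comp_apply, Matrix.cons_val_zero, Matrix.cons_val_one, hz] at h h'
  rw [h', ← h]

theorem eval_sdec (hz : ev (Th c b) z = z) (hk : ev (Th c b) k = k) (H : Ok c b (.sdec z k)) :
    z = .senc (ev (Th c b) (.sdec z k)) k := by
  obtain ⟨k', h, h'⟩ := redex_of_disjoint (mem_destructors (by simp)) H
  simp only [Function.comp_apply, Matrix.cons_val_zero, Matrix.cons_val_one, hz, hk] at h h'
  subst h'
  exact h

theorem eval_set_int (hx : ev (Th c b) x = x) (ht : ev (Th c b) t = t) (hv : ev (Th c b) v = v)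
    (H : Ok c b (.set_int x t v)) :
    ∃ x₁ y z x₂ x₃, x = .state x₁ (.cpu y z) x₂ x₃ ∧
      (t = .cpu_acc ∨ ∃ w, x₃ = .drt w (.prog t) .tt) ∧
      ev (Th c b) (.set_int x t v) = .state x₁ (.cpu v z) x₂ x₃ := by
  obtain ⟨x₁, y, z, x₂, x₃, t', v', h, h1, h2, h3, e⟩ :=
    redex_of_disjoint (mem_destructors (by simp)) H
  simp [hx, hv, ht] at h h1 h2
  subst h1 h2
  exact ⟨x₁, y, z, x₂, x₃, h, h3, e⟩

theorem eval_set_init (hx : ev (Th c b) x = x) (hv : ev (Th c b) v = v)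
    (H : Ok c b (.set_init x .cpu_acc v)) :
    ∃ x₁ x₂ x₃ y₁ y₂ y₃, x = .state x₁ x₂ x₃ (.drt y₁ y₂ y₃) ∧
      ev (Th c b) (.set_init x .cpu_acc v) = .state x₁ x₂ x₃ (.drt v y₂ y₃) := by
  obtain ⟨x₁, x₂, x₃, y₁, y₂, y₃, v', h, -, h2, e⟩ :=
    redex_of_disjoint (mem_destructors (by simp)) H
  simp [hx, hv] at h h2
  subst h2
  exact ⟨x₁, x₂, x₃, y₁, y₂, y₃, h, e⟩

theorem eval_set_pp (hx : ev (Th c b) x = x) (hv : ev (Th c b) v = v)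
    (H : Ok c b (.set_pp x t v)) :
    ∃ x₁ x₂ x₃ y₁ y₂ y₃, x = .state x₁ x₂ x₃ (.drt y₁ y₂ y₃) ∧
      ev (Th c b) (.set_pp x t v) = .state x₁ x₂ x₃ (.drt y₁ v y₃) := by
  obtain ⟨x₁, x₂, x₃, y₁, y₂, y₃, t', v', h, -, h2, -, e⟩ :=
    redex_of_disjoint (mem_destructors (by simp)) H
  simp [hx, hv] at h h2
  subst h2
  exact ⟨x₁, x₂, x₃, y₁, y₂, y₃, h, e⟩

theorem eval_set_lock (hx : ev (Th c b) x = x) (hv : ev (Th c b) v = v)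
    (H : Ok c b (.set_lock x t v)) :
    ∃ x₁ x₂ x₃ y₁ y₂ y₃, x = .state x₁ x₂ x₃ (.drt y₁ y₂ y₃) ∧
      ev (Th c b) (.set_lock x t v) = .state x₁ x₂ x₃ (.drt y₁ y₂ v) := by
  obtain ⟨x₁, x₂, x₃, y₁, y₂, y₃, t', v', h, -, h2, -, e⟩ :=
    redex_of_disjoint (mem_destructors (by simp)) H
  simp [hx, hv] at h h2
  subst h2
  exact ⟨x₁, x₂, x₃, y₁, y₂, y₃, h, e⟩

theorem eval_lock (hx : ev (Th c b) x = x) (H : ev (Th c b) (.lock x) = t)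
    (ht : ∀ a, t ≠ .app .lock a) : ∃ x₁ x₂ x₃ y z, x = .state x₁ x₂ x₃ (.drt y z t) := by
  obtain ⟨x₁, x₂, x₃, y, z, h⟩ := redex_of_ne H ht
  simp only [Function.comp_apply, Matrix.cons_val_zero, hx] at h
  exact ⟨x₁, x₂, x₃, y, z, h⟩

theorem ev_pcr_state {p x₁ x₂ x₃ : Term} (hx : ev (Th c b) (.state (.tpm p) x₁ x₂ x₃) =
    .state (.tpm p) x₁ x₂ x₃) : ev (Th c b) (.pcr (.state (.tpm p) x₁ x₂ x₃)) = p :=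
  rootStep_redex (f := .pcr) ⟨x₁, x₂, x₃, hx⟩

theorem ev_stm_state {x₁ x₂ m s x₃ : Term} (hx : ev (Th c b) (.state x₁ x₂ (.smram m s) x₃) =
    .state x₁ x₂ (.smram m s) x₃) : ev (Th c b) (.stm (.state x₁ x₂ (.smram m s) x₃)) = m :=
  rootStep_redex (f := .stm) ⟨x₁, x₂, s, x₃, hx⟩

theorem ev_lock_state {x₁ x₂ x₃ a q l : Term} (hx : ev (Th c b) (.state x₁ x₂ x₃ (.drt a q l)) =
    .state x₁ x₂ x₃ (.drt a q l)) : ev (Th c b) (.lock (.state x₁ x₂ x₃ (.drt a q l))) = l :=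
  rootStep_redex (f := .lock) ⟨x₁, x₂, x₃, a, q, hx⟩

theorem ev_pp_state {x₁ x₂ x₃ a q l : Term} (hx : ev (Th c b) (.state x₁ x₂ x₃ (.drt a q l)) =
    .state x₁ x₂ x₃ (.drt a q l)) : ev (Th c b) (.pp (.state x₁ x₂ x₃ (.drt a q l))) = q :=
  rootStep_redex (f := .pp) ⟨x₁, x₂, x₃, a, l, hx⟩

end

/-! ### Extensions of the register -/

/-- The new register is a hash, so it is not `pd`; by injectivity it could be `launchChain` or
`hchain` only if the old one were `pd` or `launchChain`. -/
theorem SafeState.extend {p m a q l v : Term} (H : SafeState p m a q l) :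
    SafeState (.h (.tup ![p, v])) m a q l := by
  refine ⟨by simp, fun h => ?_, fun h => ?_⟩
  · simp at h; exact H.ne_pd h.1
  · rw [hchain_eq] at h; simp at h; exact absurd h.1 H.ne_launch

theorem Pub.extend {p x y z v : Term} (H : Pub (.state (.tpm p) x y z)) (hv : Pub v) :
    Pub (.state (.tpm (.h (.tup ![p, v]))) x y z) := by
  obtain ⟨p', i, k, m, s, a, q, l, ⟨e, rfl, rfl, rfl⟩, h⟩ := H.state_inv
  simp at e; subst e
  rw [pub_state]
  refine ⟨?_, h.2.1, h.2.2.1, h.2.2.2.1, h.2.2.2.2.1, h.2.2.2.2.2.1, h.2.2.2.2.2.2.1,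
    h.2.2.2.2.2.2.2.1, h.2.2.2.2.2.2.2.2.extend⟩
  simpa [Fin.forall_fin_succ] using ⟨h.1, hv⟩

theorem Pub.set_pcr {p p' x y z : Term} (H : Pub (.state (.tpm p) x y z)) (hp : Pub p')
    (h1 : p' ≠ .pd) (h2 : p' ≠ launchChain) (h3 : p' ≠ hchain) :
    Pub (.state (.tpm p') x y z) := by
  obtain ⟨p', i, k, m, s, a, q, l, ⟨e, rfl, rfl, rfl⟩, h⟩ := H.state_inv
  rw [pub_state]
  exact ⟨hp, h.2.1, h.2.2.1, h.2.2.2.1, h.2.2.2.2.1, h.2.2.2.2.2.1, h.2.2.2.2.2.2.1,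
    h.2.2.2.2.2.2.2.1, h1, h2, fun h => absurd h h3⟩

@[simp]
theorem pub_const : Pub .os ∧ Pub .ps ∧ Pub .pd ∧ Pub .tt ∧ Pub .ff ∧ Pub .bot ∧ Pub .reset_req ∧
    Pub .reset_resp ∧ Pub .extend_req ∧ Pub .extend_resp ∧ Pub .tag_open ∧ Pub .tag_plain ∧
    Pub .drt_req ∧ Pub .drt_resp := by
  refine ⟨?_, ?_, ?_, ?_, ?_, ?_, ?_, ?_, ?_, ?_, ?_, ?_, ?_, ?_⟩ <;>
    exact .const rfl (by simp [Sym.priv])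

/-- Each kind of extension request has a matching kind of response, and the link of the nonce is
passed on. A `call` also has four components, but its third is not a state. -/
theorem Msg.extend {φ : Name → Term} {U n p x y z v : Term}
    (H : Msg φ U (.tup ![.extend_req, n, .state (.tpm p) x y z, v])) :
    Msg φ U (.tup ![.extend_resp, n, .state (.tpm (.h (.tup ![p, v]))) x y z]) := by
  generalize hT : Term.tup ![.extend_req, n, .state (.tpm p) x y z, v] = T at H
  cases H <;> simp at hT
  case pub h1 h2 =>
    subst hT
    simp [Fin.forall_fin_succ] at h2
    exact .pub h1 (by simpa [Fin.forall_fin_succ] using ⟨h2.1, h2.2.1.extend h2.2.2⟩)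
  case launch_req h1 h2 h3 =>
    obtain ⟨rfl, ⟨rfl, rfl, rfl, rfl⟩, rfl⟩ := hT
    exact .launch_resp h1 h2 h3
  case init_req h1 h2 h3 =>
    obtain ⟨rfl, ⟨rfl, rfl, rfl, rfl⟩, rfl⟩ := hT
    exact .init_resp h1 h2 h3
  case pp_req h1 h2 =>
    obtain ⟨rfl, rfl, rfl⟩ := hT
    refine .pp_resp h1 (h2.extend (by simp)) ?_
    -- The last recorded value is `bot`, whereas that of `hchain` is a hash.
    rw [hchain_eq]; simp

/-! ### Registers that are small or big. -/

theorem chain_succ (v₀ : Term) {vs : List Term} {n : ℕ} (h : vs.length = n + 1) :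
    ∃ vs' x, vs'.length = n ∧ Term.chain v₀ vs = .h (.tup ![Term.chain v₀ vs', x]) := by
  rcases vs.eq_nil_or_concat with rfl | ⟨vs', x, rfl⟩
  · simp at h
  · exact ⟨vs', x, by simpa using h, by simp [Term.chain]⟩

/-- A big value has at least three nested hashes along its first components, while `hchain` has two
above `pd`, `launchChain` one and `pd` none. -/
theorem eval_is_big {c : Prop} {b : ℕ} (hb : 2 ≤ b) {p : Term} (hp : ev (Th c b) p = p)
    (H : ev (Th c b) (.is_big p) = .tt) : p ≠ .pd ∧ p ≠ launchChain ∧ p ≠ hchain := by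
  obtain ⟨-, v₀, vs, hl, h, -⟩ := redex_of_ne H (by simp)
  simp only [Function.comp_apply, Matrix.cons_val_zero, hp] at h
  -- With the bound written as `b + 2` the chain has `b + 3` extensions, enough to peel off three.
  obtain ⟨b, rfl⟩ : ∃ b', b = b' + 2 := ⟨b - 2, by omega⟩
  obtain ⟨vs', x, hl, e⟩ := chain_succ v₀ hl
  obtain ⟨vs', y, hl, e'⟩ := chain_succ v₀ hl
  obtain ⟨vs', z, -, e''⟩ := chain_succ v₀ hl
  rw [e, e', e''] at h
  subst h
  rw [hchain_eq]
  simp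

/-- A launch extends a register with zero recorded values and the loader one with a single value;
both numbers are below `b`, so both requests take the small branch. -/
theorem eval_is_small_pd {c : Prop} {b : ℕ} (hc : c) (hb : 2 ≤ b) :
    ev (Th c b) (.is_small .pd) = .tt :=
  rootStep_redex (f := .is_small)
    ⟨hc, .pd, [], .inr rfl, by simp; omega, by simp [Term.chain], rfl⟩

theorem eval_is_small_extend_pd {c : Prop} {b : ℕ} (hc : c) (hb : 2 ≤ b) (v : Term) :
    ev (Th c b) (.is_small (.h (.tup ![.pd, v]))) = .tt :=
  rootStep_redex (f := .is_small)
    ⟨hc, .pd, [ev (Th c b) v], .inr rfl, by simp; omega, by simp [Term.chain], rfl⟩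

/-- The registers of launch and loader requests are small. What remains are requests about public
states, whose register may be disclosed and replaced by any public value other than the three
critical ones. -/
theorem Msg.extend_big {c : Prop} {b : ℕ} {φ : Name → Term} {U n p x y z v : Term} (hc : c)
    (hb : 2 ≤ b) (hp : ev (Th c b) (.is_small p) ≠ .tt)
    (H : Msg φ U (.tup ![.extend_req, n, .state (.tpm p) x y z, v])) :
    Pub p ∧ Pub v ∧ ∀ p', Pub p' → p' ≠ .pd → p' ≠ launchChain → p' ≠ hchain →
      Msg φ U (.tup ![.extend_resp, n, .state (.tpm p') x y z]) := by
  generalize hT : Term.tup ![.extend_req, n, .state (.tpm p) x y z, v] = T at H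
  cases H <;> simp at hT
  case pub h1 h2 =>
    subst hT
    simp [Fin.forall_fin_succ] at h2
    obtain ⟨_, _, _, _, _, _, _, _, ⟨e, -⟩, h, -⟩ := h2.2.1.state_inv
    simp at e; subst e
    exact ⟨h, h2.2.2, fun p' h3 h4 h5 h6 => .pub h1
      (by simpa [Fin.forall_fin_succ] using ⟨h2.1, h2.2.1.set_pcr h3 h4 h5 h6⟩)⟩
  case launch_req h1 h2 h3 =>
    obtain ⟨rfl, ⟨rfl, rfl, rfl, rfl⟩, rfl⟩ := hT
    exact absurd (eval_is_small_pd hc hb) hp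
  case init_req h1 h2 h3 =>
    obtain ⟨rfl, ⟨rfl, rfl, rfl, rfl⟩, rfl⟩ := hT
    exact absurd (eval_is_small_extend_pd hc hb _) hp
  case pp_req h1 h2 =>
    obtain ⟨rfl, rfl, rfl⟩ := hT
    obtain ⟨_, _, _, _, _, _, _, _, ⟨e, -⟩, h, -⟩ := h2.state_inv
    simp at e; subst e
    exact ⟨h, by simp, fun p' h3 h4 h5 h6 => .pp_resp h1 (h2.set_pcr h3 h4 h5 h6) h6⟩

/-! ### The protocol -/

@[simp]
theorem subst_app (f : Sym) (a : Fin f.arity → Term) (σ : Subst) :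
    (Term.app f a).subst σ = .app f (Term.subst σ ∘ a) := rfl

@[simp]
theorem subst_var_eq (x : Var) (σ : Subst) : (Term.var x).subst σ = σ x := rfl

@[simp]
theorem ev_name {c : Prop} {b : ℕ} (n : Name) : ev (Th c b) (.name n) = .name n := rfl

@[simp]
theorem ev_hchain {c : Prop} {b : ℕ} : ev (Th c b) hchain = hchain := by
  simp [ev_chain]

theorem closed_const {f : Sym} {a : Fin f.arity → Term} (h : f.arity = 0) :
    (Term.app f a).Closed :=
  fun i => (Fin.cast h i).elim0

theorem Msg.pub_os {φ : Name → Term} {T : Term} (H : Msg φ .os T) : Pub T :=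
  H.pub_of_pub (by simp)

theorem Msg.reset {φ : Name → Term} {n p x y z : Term}
    (H : Msg φ .cpu_tpm (.tup ![.reset_req, n, .state (.tpm p) x y z])) :
    Msg φ .cpu_tpm (.tup ![.reset_resp, n, .state (.tpm .pd) x y z]) := by
  generalize hT : Term.tup ![.reset_req, n, .state (.tpm p) x y z] = T at H
  generalize hU : Term.cpu_tpm = U at H
  cases H <;> simp at hT hU
  case pub h1 h2 => subst hU; simp at h1
  case reset_req h1 h2 h3 h4 =>
    obtain ⟨rfl, rfl, rfl, rfl, rfl⟩ := hT
    exact .reset_resp h2 h3 h4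

/-- Unsealing requests come from the attacker or the trusted protected program. Entry points are
excluded because a `start` message is also a pair and could begin with this tag. -/
theorem Msg.tag_open_inv {φ : Name → Term} {U z : Term} (hU : ∀ j, U ≠ .entry j)
    (H : Msg φ U (.tup ![.tag_open, z])) :
    Pub z ∧ (Pub U ∨ U = .tpm_ch (.prog .Tpp)) := by
  generalize hT : Term.tup ![.tag_open, z] = T at H
  cases H <;> simp at hT
  case pub h1 h2 =>
    subst hT
    simp [Fin.forall_fin_succ] at h2
    exact ⟨h2, .inl h1⟩
  case start h1 => exact absurd rfl (hU _)
  case pp_open h =>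
    subst hT
    exact ⟨h, .inr rfl⟩

section
variable {c : Prop} {b : ℕ} {φ : Name → Term} {σ : Subst}

theorem GoodIn.let_eq {x : Var} {T T' : Term} {P : Proc} (e : T.subst σ = T')
    (H : Ok c b T' → ∃ v, ev (Th c b) T' = v ∧ v.Closed ∧ GoodIn c b φ (Function.update σ x v) P) :
    GoodIn c b φ σ (.letin x T P) := by
  subst e
  refine .letin fun h => ?_
  obtain ⟨v, rfl, h⟩ := H h
  exact h

/-- Resetting to `pd` happens only on the private channel of the processor. On the public channel
the value is `ps`, which is not critical. -/
theorem goodIn_pcrReset (hσ : σ .ch = .cpu_tpm ∧ σ .rv = .pd ∨ σ .ch = .os ∧ σ .rv = .ps) :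
    GoodIn c b φ σ pcrReset := by
  refine .inp_tag_var2 (by decide) fun n x hn hx hm => .let_eq (T' := .reset x .tpm_acc (σ .rv))
    (by simp) fun hd => ?_
  have hrv : ev (Th c b) (σ .rv) = σ .rv := by rcases hσ with h | h <;> simp [h.2]
  obtain ⟨p, x₁, x₂, x₃, rfl, e⟩ := eval_reset hx hrv hd
  have key : Msg φ (σ .ch) (.tup ![.reset_resp, n, .state (.tpm (σ .rv)) x₁ x₂ x₃]) := by
    rcases hσ with ⟨h1, h2⟩ | ⟨h1, h2⟩ <;> simp [h1] at hm <;> rw [h1, h2]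
    · exact hm.reset
    · have := hm.pub_os
      simp [Fin.forall_fin_succ] at this
      exact .pub (by simp) (by simpa [Fin.forall_fin_succ] using
        ⟨this.1, this.2.set_pcr (by simp) (by simp) (by simp) (by rw [hchain_eq]; simp)⟩)
  refine ⟨_, e, key.closed 2, .out ?_ .nil⟩
  have hch : ev (Th c b) (σ .ch) = σ .ch := by rcases hσ with h | h <;> simp [h.1]
  have he := ev_fixed e
  simpa [hch, hn, he] using key

theorem goodIn_pcrExtend (hch : ev (Th c b) (σ .ch) = σ .ch) : GoodIn c b φ σ pcrExtend := by
  refine .inp_tag_var3 (by decide) (by decide) (by decide) fun n x v hn hx hv hm =>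
    .let_eq (T' := .extend x .tpm_acc v) (by simp) fun hd => ?_
  simp [hch] at hm
  obtain ⟨p, x₁, x₂, x₃, rfl, e⟩ := eval_extend hx hv hd
  refine ⟨_, e, hm.extend.closed 2, .out ?_ .nil⟩
  have he := ev_fixed e
  simpa [hch, hn, he] using hm.extend

theorem goodIn_pcrExtendB (hc : c) (hb : 2 ≤ b) (hch : ev (Th c b) (σ .ch) = σ .ch) :
    GoodIn c b φ σ pcrExtendB := by
  refine .inp_tag_var3 (by decide) (by decide) (by decide) fun n x v hn hx hv hm =>
    .let_eq (T' := .pcr x) (by simp) fun hd => ?_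
  simp [hch] at hm
  obtain ⟨x₁, x₂, x₃, e⟩ := eval_pcr hx hd
  have hp := ev_ev (c := c) (b := b) (Term.pcr x)
  generalize ev (Th c b) (Term.pcr x) = p at e hp
  subst e
  -- The indices lead from the request to its state, then to the `tpm` part, then to the register.
  refine ⟨p, rfl, (hm.closed 2) 0 0, .ite (fun _ => ?_) (fun hs => ?_)⟩
  · refine .let_eq (T' := .extend (.state (.tpm p) x₁ x₂ x₃) .tpm_acc v) (by simp) fun hd => ?_
    obtain ⟨_, _, _, _, h, e⟩ := eval_extend hx hv hd
    simp at h
    obtain ⟨rfl, rfl, rfl, rfl⟩ := h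
    refine ⟨_, e, hm.extend.closed 2, .out ?_ .nil⟩
    have he := ev_fixed e
    simpa [hch, hn, he] using hm.extend
  · have hs' : ev (Th c b) (.is_small p) ≠ .tt := by simpa using hs
    obtain ⟨h1, h2, h3⟩ := hm.extend_big hc hb hs'
    refine .out (.pub (by simp) (by simpa [Fin.forall_fin_succ, hp, hv] using ⟨h1, h2⟩)) ?_
    refine .inp_var fun p' hp' hm' => .ite (fun hbig => ?_) (fun _ => .nil)
    have hbig' : ev (Th c b) (.is_big p') = .tt := by simpa using hbig
    have h4 := eval_is_big hb hp' hbig'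
    simp at hm'
    refine .let_eq (T' := .set_pcr (.state (.tpm p) x₁ x₂ x₃) .tpm_acc p') (by simp) fun hd => ?_
    obtain ⟨_, _, _, _, h, e⟩ := eval_set_pcr hx hp' hd
    simp at h
    obtain ⟨rfl, rfl, rfl, rfl⟩ := h
    have h5 := h3 p' hm'.pub_os h4.1 h4.2.1 h4.2.2
    refine ⟨_, e, h5.closed 2, .out ?_ .nil⟩
    have he := ev_fixed e
    simpa [hch, hn, he] using h5

/-- A public sealed term has public content unless it is sealed against `hchain`. The hypothesis `H`
excludes that register on public channels; on the private channel any closed answer is allowed. -/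
theorem goodIn_unsealProc (hent : ∀ j, σ .ch ≠ .entry j)
    (hch : ev (Th c b) (σ .ch) = σ .ch)
    (H : Pub (σ .ch) → ev (Th c b) (.pcr (σ .pf_state)) ≠ hchain) :
    GoodIn c b φ σ unsealProc := by
  refine .inp_tag_var fun z hz hm =>
    .let_eq (T' := .unsealData z (.pcr (σ .pf_state))) (by simp) fun hd => ?_
  simp [hch] at hm
  obtain ⟨h1, h2⟩ := hm.tag_open_inv hent
  have e := eval_unseal hz hd
  have hv := ev_ev (c := c) (b := b) (Term.unsealData z (.pcr (σ .pf_state)))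
  generalize ev (Th c b) (Term.unsealData z (.pcr (σ .pf_state))) = v at e hv
  refine ⟨v, rfl, ?_, .out ?_ .nil⟩
  · have := h1.closed
    rw [e] at this
    exact this 0
  · suffices Msg φ (σ .ch) (.tup ![.tag_plain, v]) by simpa [hch, hv] using this
    rcases h2 with h2 | h2
    · refine .pub h2 ?_
      rw [e] at h1
      rcases h1.inv.2 with h | ⟨-, h⟩
      · simpa [Fin.forall_fin_succ] using h
      · exact absurd h (H h2)
    · rw [h2]
      refine .pp_plain ?_
      have := h1.closed
      rw [e] at this
      exact this 0

/-- A public state with register `hchain` is locked on the trusted protected program. In the locked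
branch the channel is then private, and the other branch is impossible. -/
theorem goodIn_tpmUnseal : GoodIn c b φ σ tpmUnseal := by
  refine .inp_var fun x hx hm => ?_
  simp at hm
  have hpub := hm.pub_os
  refine .ite (fun h => ?_) (fun h => ?_)
  · have hl : ev (Th c b) (.lock x) = .tt := by simpa using h
    obtain ⟨x₁, x₂, x₃, a, q, rfl⟩ := eval_lock hx hl (by simp)
    refine .let_eq (T' := .tpm_ch (.pp (.state x₁ x₂ x₃ (.drt a q .tt)))) (by simp) fun _ => ?_
    obtain ⟨p, i, k, m, s, _, _, _, ⟨rfl, rfl, rfl, e⟩, h1, h2, h3, h4, h5, h6, h7, h8, h9⟩ :=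
      hpub.state_inv
    simp at e
    obtain ⟨rfl, rfl, rfl⟩ := e
    have hq : ev (Th c b) q = q := by simp at hx; exact hx.2.2.2.2
    refine ⟨.tpm_ch q, by simp [ev_pp_state hx], fun _ => by simpa using h7.closed,
      goodIn_unsealProc (by simp) (by simpa using hq) ?_⟩
    simp [ev_pcr_state hx]
    intro h hp
    obtain ⟨-, -, rfl, -⟩ := h9.trusted hp
    simp at h
  · have hl : ev (Th c b) (.lock x) ≠ .tt := by simpa using h
    refine .let_eq (T' := .os) (by simp) fun _ => ⟨.os, by simp, closed_const rfl, ?_⟩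
    refine goodIn_unsealProc (by simp) (by simp) ?_
    simp
    intro hp
    -- The input need not be a state, but reading `hchain` from it shows that it is.
    obtain ⟨x₁, x₂, x₃, e⟩ := redex_of_ne (f := .pcr) hp (by simp [hchain_eq])
    simp only [Function.comp_apply, Matrix.cons_val_zero, hx] at e
    subst e
    obtain ⟨p, i, k, m, s, a, q, l, ⟨e, rfl, rfl, rfl⟩, h1, h2, h3, h4, h5, h6, h7, h8, h9⟩ :=
      hpub.state_inv
    simp only [Term.app.injEq, heq_eq_eq, true_and, Matrix.vecCons_inj, and_true] at e
    obtain ⟨-, -, -, rfl⟩ := h9.trusted e.symm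
    exact hl (ev_lock_state hx)

theorem goodIn_tpmProc {ext : Proc}
    (H : ∀ σ : Subst, ev (Th c b) (σ .ch) = σ .ch → GoodIn c b φ σ ext) :
    GoodIn c b φ σ (tpmProc ext) := by
  refine .par (.repl (.par ?_ ?_)) (.par (.repl (.par ?_ (.par ?_ (.repl ?_))))
    (.repl goodIn_tpmUnseal))
  · refine .let_eq (T' := .cpu_tpm) (by simp) fun _ => ⟨.cpu_tpm, by simp, closed_const rfl, ?_⟩
    refine .let_eq (T' := .pd) (by simp) fun _ => ⟨.pd, by simp, closed_const rfl, .repl ?_⟩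
    exact goodIn_pcrReset (.inl (by simp))
  · refine .let_eq (T' := .os) (by simp) fun _ => ⟨.os, by simp, closed_const rfl, ?_⟩
    refine .let_eq (T' := .ps) (by simp) fun _ => ⟨.ps, by simp, closed_const rfl, .repl ?_⟩
    exact goodIn_pcrReset (.inr (by simp))
  · refine .let_eq (T' := .cpu_tpm) (by simp) fun _ => ⟨.cpu_tpm, by simp, closed_const rfl, .repl ?_⟩
    exact H _ (by simp)
  · refine .let_eq (T' := .os) (by simp) fun _ => ⟨.os, by simp, closed_const rfl, .repl ?_⟩
    exact H _ (by simp)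
  -- The extension process is good on every channel, so it does not matter which one is announced.
  · exact .inp_tag_var fun v hv _ => .repl (H _ (by simpa using hv))

/-- Only the key is protected: the payload `hi_pp` counts as public, so that decrypting with the key
reveals nothing new. -/
theorem goodIn_dataProc : GoodIn c b φ σ dataProc := by
  refine .new fun k hk _ => .new fun hi hhi _ => ?_
  obtain ⟨l, j⟩ := k
  simp only at hk
  subst hk
  refine .out (.pub (by simp) ?_) ?_
  · simp
    exact .senc (.name (by simp [hhi]))
  · refine .let_eq (T' := .sealData (.name ⟨.kpp, j⟩) hchain) (by simp [Term.chain])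
      fun _ => ⟨.sealData (.name ⟨.kpp, j⟩) hchain, ?_, Pub.sealed.closed, .out ?_ .nil⟩
    · simp
    · refine .pub (by simp) ?_
      simp
      exact .sealed

theorem goodIn_setupProc : GoodIn c b φ σ setupProc := by
  refine .inp_var fun m hm hm' => .inp_var fun s hs hs' => .out (.pub (by simp) ?_)
    (.inp_var fun i hi hi' => .inp_var fun q hq hq' => .inp_var fun x hx hx' =>
      .out (.pub (by simp) ?_) .nil)
  · simp at hm' hs'
    simp [hm, hs]
    exact .state (by simp) (by simp) (by simp) hm'.pub_os hs'.pub_os (by simp) (by simp) (by simp)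
      ⟨by simp, by simp, by simp [hchain_eq]⟩
  · simp at hi' hq' hx'
    simp [hi, hq, hx, Fin.forall_fin_succ]
    exact ⟨hi'.pub_os, hq'.pub_os, hx'.pub_os⟩

end

/-! ### Reading answers on private channels. -/

theorem Msg.reset_resp_inv {φ : Name → Term} {n : Name} {u m x : Term}
    (hn : φ n = .tup ![.h u, .h m])
    (H : Msg φ .cpu_tpm (.tup ![.reset_resp, .name n, x])) :
    ∃ i k s a q, x = lockedState .pd i k m s a q ∧ PubParts i k m s a q := by
  generalize hT : Term.tup ![.reset_resp, .name n, x] = T at H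
  generalize hU : Term.cpu_tpm = U at H
  cases H <;> simp at hT hU
  case pub h1 h2 => subst hU; simp at h1
  case reset_resp h1 h2 h3 =>
    obtain ⟨rfl, rfl⟩ := hT
    -- The nonce is linked to one pair of hashes, so the handler in the returned state is the
    -- measured one.
    rw [hn] at h3
    simp at h3
    obtain ⟨rfl, rfl⟩ := h3
    exact ⟨_, _, _, _, _, rfl, h1⟩

theorem Msg.launch_resp_inv {φ : Name → Term} {n : Name} {u m x : Term}
    (hn : φ n = .tup ![.h u, .h m])
    (H : Msg φ .cpu_tpm (.tup ![.extend_resp, .name n, x])) :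
    ∃ i k s a q, x = lockedState (launchReg u m) i k m s a q ∧ PubParts i k m s a q := by
  generalize hT : Term.tup ![.extend_resp, .name n, x] = T at H
  generalize hU : Term.cpu_tpm = U at H
  cases H <;> simp at hT hU
  case pub h1 h2 => subst hU; simp at h1
  case launch_resp h1 h2 h3 =>
    obtain ⟨rfl, rfl⟩ := hT
    rw [hn] at h3
    simp at h3
    obtain ⟨rfl, rfl⟩ := h3
    exact ⟨_, _, _, _, _, rfl, h1⟩

theorem Msg.ret_inv {φ : Name → Term} {e n x : Term}
    (H : Msg φ e (.tup ![.drt_resp, n, x])) : Pub x := by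
  generalize hT : Term.tup ![.drt_resp, n, x] = T at H
  cases H <;> simp at hT
  case pub h1 h2 =>
    subst hT
    simp [Fin.forall_fin_succ] at h2
    exact h2.2
  case ret h1 h2 => exact hT.2 ▸ h2

/-- Messages on an entry point differ in length: four components for a call, three for a return, two
for a start. -/
theorem Msg.call_inv {φ : Name → Term} {j : ℕ} {n x t q' : Term}
    (H : Msg φ (.entry j) (.tup ![n, x, t, q'])) :
    Pub n ∧ Pub q' ∧ t = .tpm_ch (.prog (.entry j)) ∧
      ∃ i k m s q, x = lockedState (launchReg (.prog (.entry j)) m) i k m s (.prog (.entry j)) q ∧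
        PubParts i k m s (.prog (.entry j)) q := by
  generalize hT : Term.tup ![n, x, t, q'] = T at H
  generalize hU : Term.entry j = U at H
  cases H <;> simp at hT hU
  case pub h1 h2 => subst hU; simp at h1
  case call h1 h2 h3 =>
    subst hU
    obtain ⟨rfl, rfl, rfl, rfl⟩ := hT
    exact ⟨h1, h3, rfl, _, _, _, _, _, rfl, h2⟩

theorem Msg.init_resp_inv {φ : Name → Term} {n : Name} {v x : Term} (hn : φ n = v)
    (H : Msg φ (.tpm_ch (.prog .Tinit)) (.tup ![.extend_resp, .name n, x])) :
    ∃ i k m s q, x = lockedState (.h (.tup ![launchReg (.prog .Tinit) m, v])) i k m s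
      (.prog .Tinit) q ∧ PubParts i k m s (.prog .Tinit) q := by
  generalize hT : Term.tup ![.extend_resp, .name n, x] = T at H
  generalize hU : Term.tpm_ch (.prog .Tinit) = U at H
  cases H <;> simp at hT hU
  case pub h1 h2 => subst hU; simp at h1
  case init_resp h1 h2 h3 =>
    obtain ⟨rfl, rfl⟩ := hT
    rw [hn] at h3
    subst h3
    exact ⟨_, _, _, _, _, rfl, h1⟩

theorem Msg.start_inv {φ : Name → Term} {j : ℕ} {x t : Term}
    (H : Msg φ (.entry j) (.tup ![x, t])) : Pub x ∧ t = .tpm_ch (.prog (.entry j)) := by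
  generalize hT : Term.tup ![x, t] = T at H
  generalize hU : Term.entry j = U at H
  cases H <;> simp at hT hU
  case pub h1 h2 => subst hU; simp at h1
  case start h =>
    subst hU
    obtain ⟨rfl, rfl⟩ := hT
    exact ⟨h, rfl⟩

theorem Msg.pp_resp_inv {φ : Name → Term} {n x : Term}
    (H : Msg φ (.tpm_ch (.prog .Tpp)) (.tup ![.extend_resp, n, x])) :
    ∃ p y z w, x = .state (.tpm p) y z w ∧ Pub x ∧ p ≠ hchain := by
  generalize hT : Term.tup ![.extend_resp, n, x] = T at H
  generalize hU : Term.tpm_ch (.prog .Tpp) = U at H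
  cases H <;> simp at hT hU
  case pub h1 h2 => subst hU; simp at h1
  case pp_resp h1 h2 h3 =>
    obtain ⟨rfl, rfl⟩ := hT
    exact ⟨_, _, _, _, rfl, h2, h3⟩

/-- The processor creates its nonce one exchange before the extension request, the loader
immediately before it. These two shapes let `Proc.datum` find the measurement in either case. -/
theorem datum_subst_out_inp_out (U T U' : Term) (A : Pat) (U'' T' : Term) (P : Proc) (σ : Subst) :
    ((Proc.out U T (.inp U' A (.out U'' T' P))).subst σ).datum =
      (T'.subst (σ.drop A.bv)).last := rfl

theorem datum_subst_out_inp_letin (U T U' : Term) (A : Pat) (x : Var) (T' : Term) (P : Proc)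
    (σ : Subst) :
    ((Proc.out U T (.inp U' A (.letin x T' P))).subst σ).datum = (T.subst σ).last := rfl

/-! ### The loader, the protected program and the processor. -/

section
variable {c : Prop} {b : ℕ} {φ : Name → Term} {σ : Subst}

/-- The loader records the hash of the program it installs, and the register it extends records the
handler of the state. If the outcome is `hchain`, injectivity makes both of them the trusted ones.
-/
theorem goodIn_initProc : GoodIn c b φ σ initProc := by
  refine .out (.pub (by simp) (by simpa using .prog)) (.out (.pub (by simp) (by simpa using .prog)) ?_)
  refine .inp_var4 (by decide) (by decide) (by decide) (by decide) (by decide) (by decide)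
    fun n x t q hn hx _ hq hm => ?_
  simp at hm
  obtain ⟨hn', hq', rfl, i, k, m, s, q₀, rfl, hparts⟩ := hm.call_inv
  refine .let_eq (T' := .h q) (by simp) fun _ => ⟨.h q, by simp [hq], hq'.h.closed, ?_⟩
  refine .new fun n₁ hl hφ => ?_
  rw [datum_subst_out_inp_letin] at hφ
  simp [Subst.drop, Term.last] at hφ
  simp [-ev_tup] at hx
  refine .out (by simpa [hx, hq] using Msg.init_req hparts hq'.h hφ) ?_
  refine .inp_tag_eq_var fun x' hx' hm' => ?_
  simp at hm'
  -- The nonce fixes only the recorded value. The returned state may have another handler `m`, but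
  -- its register records that same `m`.
  obtain ⟨i, k, m, s, q₀, rfl, hparts⟩ := hm'.init_resp_inv hφ
  refine .let_eq (T' := .set_pp (lockedState (.h (.tup ![launchReg (.prog .Tinit) m, .h q])) i k m s
    (.prog .Tinit) q₀) .Tinit q) (by simp) fun hd => ?_
  obtain ⟨_, _, _, _, _, _, h, e⟩ := eval_set_pp hx' hq hd
  have he := ev_fixed e
  simp at h
  obtain ⟨rfl, rfl, rfl, rfl, rfl, rfl⟩ := h
  have hpub : Pub (lockedState (.h (.tup ![launchReg (.prog .Tinit) m, .h q])) i k m s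
      (.prog .Tinit) q) := by
    refine .state ?_ hparts.1 hparts.2 hparts.3 hparts.4 hparts.5 hq' (by simp)
      ⟨by simp, by simp, fun h => ?_⟩
    · simpa [Fin.forall_fin_succ] using ⟨⟨.prog, hparts.3⟩, hq'⟩
    · rw [hchain_eq] at h
      simp at h
      simp [h]
  refine ⟨_, e, hpub.closed, .out ?_ (.out (.pub (by simp) ?_) .nil)⟩
  · simpa [he, hn] using Msg.ret (φ := φ) (j := 0) hn' hpub
  · simpa [he] using hpub

/-- The state handled here is public throughout. The lock may be released because the final
extension has moved the register away from `hchain`. -/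
theorem goodIn_ppProc : GoodIn c b φ σ ppProc := by
  refine .out (.pub (by simp) (by simpa using .prog)) ?_
  refine .inp_var2 (by decide) fun x t hx _ hm => ?_
  simp at hm
  obtain ⟨hx', rfl⟩ := hm.start_inv
  refine .let_eq (T' := .set_int x .Tpp .tt) (by simp) fun hd => ?_
  obtain ⟨x₁, _, _, x₂, _, rfl, h, e⟩ := eval_set_int hx (by simp) (by simp) hd
  have he := ev_fixed e
  obtain ⟨p, i, k, m, s, a, q, l, ⟨rfl, e', rfl, rfl⟩, h1, h2, h3, h4, h5, h6, h7, h8, h9⟩ :=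
    hx'.state_inv
  simp at e'
  obtain ⟨rfl, rfl⟩ := e'
  have hy := Pub.state h1 (i := .tt) (by simp) h3 h4 h5 h6 h7 h8 h9
  generalize Term.state (.tpm p) (.cpu .tt _) (.smram m s) (.drt a q l) = y at e he hy
  refine ⟨y, e, hy.closed, .out (.pub (by simp) (by simpa [he] using hy)) ?_⟩
  refine .inp_var fun z hz hmz => .inp_var fun w hw hmw => ?_
  simp at hmz hmw
  refine .out (by simpa [hz] using Msg.pp_open hmz.pub_os) ?_
  refine .inp_tag_var fun u hu _ => ?_
  refine .let_eq (T' := .sdec w u) (by simp) fun hd => ?_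
  have hv := eval_sdec hw hu hd
  have hv' := ev_ev (c := c) (b := b) (Term.sdec w u)
  generalize ev (Th c b) (Term.sdec w u) = v at hv hv'
  -- The key may be secret, but the ciphertext came from a public channel, so the plaintext is
  -- public.
  have hvp : Pub v := (hv ▸ hmw.pub_os : Pub (.senc v u)).inv.1
  refine ⟨v, rfl, hvp.closed, .out (.pub (by simp) (by simpa [hv'] using hvp)) ?_⟩
  refine .new fun r hr _ => ?_
  have hr' : Pub (.name r) := .name (by simp [hr])
  refine .out (by simpa [he] using Msg.pp_req hr' hy) ?_
  refine .inp_tag_eq_var fun x' hx' hm' => ?_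
  simp at hm'
  obtain ⟨p', _, _, _, rfl, hpub, hne⟩ := hm'.pp_resp_inv
  refine .let_eq (T' := .set_lock _ .Tpp .ff) (by simp; rfl) fun hd => ?_
  obtain ⟨_, _, _, _, _, _, h, e⟩ := eval_set_lock hx' (by simp) hd
  have he := ev_fixed e
  simp at h
  obtain ⟨rfl, rfl, rfl, rfl⟩ := h
  obtain ⟨p, i, k, m, s, a, q, l, ⟨e1, rfl, rfl, e'⟩, h1, h2, h3, h4, h5, h6, h7, h8, h9⟩ :=
    hpub.state_inv
  simp at e1 e'
  obtain ⟨rfl, rfl, rfl⟩ := e'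
  subst e1
  have hy : Pub _ := .state h1 h2 h3 h4 h5 h6 h7 (l := .ff) (by simp)
    ⟨h9.ne_pd, h9.ne_launch, fun h => absurd h hne⟩
  exact ⟨_, e, hy.closed, .out (.pub (by simp) (by simpa [he] using hy)) .nil⟩

/-- If the entry point is public, the launched program is not the trusted loader, so the register
differs from `launchChain` and the state may be made public. Otherwise the channel is private. -/
theorem Msg.call_of {e n i k m s q q' : Term} (he : Pub e ∨ ∃ j, e = .entry j) (hn : Pub n)
    (hparts : PubParts i k m s (.prog e) q) (hq : Pub q') :
    Msg φ e (.tup ![n, lockedState (launchReg (.prog e) m) i k m s (.prog e) q,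
      .tpm_ch (.prog e), q']) := by
  rcases he with he | ⟨j, rfl⟩
  · refine .pub he ?_
    have : Pub (lockedState (launchReg (.prog e) m) i k m s (.prog e) q) := by
      refine .state ?_ hparts.1 hparts.2 hparts.3 hparts.4 hparts.5 hparts.6 (by simp)
        ⟨by simp, fun h => ?_, fun h => ?_⟩
      · simpa [Fin.forall_fin_succ] using ⟨hparts.5, hparts.3⟩
      · simp at h
        simp [h.1] at he
      · rw [hchain_eq] at h
        simp at h
    simpa [Fin.forall_fin_succ] using ⟨hn, this, .tpm_ch he, hq⟩
  · exact .call hn hparts hq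

theorem Msg.start_of {e x : Term} (he : Pub e ∨ ∃ j, e = .entry j) (hx : Pub x) :
    Msg φ e (.tup ![x, .tpm_ch (.prog e)]) := by
  rcases he with he | ⟨j, rfl⟩
  · exact .pub he (by simpa [Fin.forall_fin_succ] using ⟨hx, .tpm_ch he⟩)
  · exact .start hx

/-- The nonce is linked to the measurement of program and handler, so the launched register
describes the returned state. The state that comes back from the program is public. -/
theorem goodIn_cpuProc : GoodIn c b φ σ cpuProc := by
  refine .repl (.inp_tag_var3 (by decide) (by decide) (by decide) fun a q x ha hq hx hm =>
    .ite (fun h => ?_) fun _ => .nil)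
  simp at hm
  have hm := hm.pub_os
  simp [Fin.forall_fin_succ] at hm
  obtain ⟨ha', hq', hx'⟩ := hm
  have hl : ev (Th c b) (.lock x) = .ff := by simpa using h
  obtain ⟨x₁, x₂, x₃, a₀, q₀, rfl⟩ := eval_lock hx hl (by simp)
  obtain ⟨p, i, k, m, s, _, _, _, ⟨rfl, rfl, rfl, e⟩, h1, h2, h3, h4, h5, h6, h7, -, -⟩ :=
    hx'.state_inv
  simp at e
  obtain ⟨rfl, rfl, rfl⟩ := e
  clear hl h
  refine .let_eq (T' := .set_int (.state (.tpm p) (.cpu i k) (.smram m s) (.drt a₀ q₀ .ff))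
    .cpu_acc .ff) (by simp) fun hd => ?_
  obtain ⟨_, _, _, _, _, h, -, e⟩ := eval_set_int hx (by simp) (by simp) hd
  simp at h
  obtain ⟨rfl, ⟨rfl, rfl⟩, rfl, rfl⟩ := h
  refine ⟨_, e, by simp [Term.Closed, Fin.forall_fin_succ, h1.closed, h3.closed, h4.closed,
    h5.closed, h6.closed, h7.closed], ?_⟩
  replace e := ev_fixed e
  refine .let_eq (T' := .set_lock (.state (.tpm p) (.cpu .ff k) (.smram m s) (.drt a₀ q₀ .ff))
    .cpu_acc .tt) (by simp) fun hd => ?_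
  obtain ⟨_, _, _, _, _, _, h, e₀⟩ := eval_set_lock e (by simp) hd
  simp at h
  obtain ⟨rfl, rfl, rfl, rfl, rfl, rfl⟩ := h
  refine ⟨_, e₀, by simp [Term.Closed, Fin.forall_fin_succ, h1.closed, h3.closed, h4.closed,
    h5.closed, h6.closed, h7.closed], ?_⟩
  replace e₀ := ev_fixed e₀
  refine .let_eq (T' := .tup ![.h a, .h (.stm _)]) (by simp; rfl) fun hd =>
    ⟨.tup ![.h a, .h m], by simp [ha, ev_stm_state hx], by simp [Term.Closed,
      Fin.forall_fin_succ, h4.closed, ha'.closed], ?_⟩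
  refine .new fun n hl hφ => ?_
  rw [datum_subst_out_inp_out] at hφ
  simp [Subst.drop, Term.last, Pat.bv, Fin.exists_fin_succ] at hφ
  have hn : Pub (.name n) := .name (by simp [hl])
  refine .out ?_ ?_
  · simpa [e₀] using Msg.reset_req h1 ⟨by simp, h3, h4, h5, h6, h7⟩ ha' hφ
  refine .inp_tag_eq_var fun s₁ hs₁ hm => ?_
  simp at hm
  obtain ⟨_, _, _, _, _, rfl, hp⟩ := hm.reset_resp_inv hφ
  have hm₁ : ev (Th c b) m = m := by simp at hx; exact hx.2.2.1.1
  refine .out ?_ ?_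
  · have := Msg.launch_req hp ha' hφ
    simp at hs₁
    simpa [hs₁, ha] using this
  refine .inp_tag_eq_var fun s₂ hs₂ hm => ?_
  simp at hm
  obtain ⟨i₂, k₂, s₂, a₂, q₂, rfl, hp⟩ := hm.launch_resp_inv hφ
  refine .let_eq (T' := .set_init (lockedState (launchReg a m) i₂ k₂ m s₂ a₂ q₂) .cpu_acc a)
    (by simp) fun hd => ?_
  obtain ⟨_, _, _, _, _, _, h, e₃⟩ := eval_set_init hs₂ ha hd
  simp at h
  obtain ⟨rfl, rfl, rfl, rfl, rfl, rfl⟩ := h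
  refine ⟨_, e₃, by simp [Term.Closed, Fin.forall_fin_succ, hp.1.closed, hp.2.closed, hp.3.closed,
    hp.4.closed, ha'.closed, hp.6.closed], ?_⟩
  replace e₃ := ev_fixed e₃
  refine .let_eq (T' := .get_entry a) (by simp) fun hd => ?_
  have he := eval_get_entry hd
  have he' := ev_ev (c := c) (b := b) (.get_entry a)
  rw [ha] at he
  generalize ev (Th c b) (.get_entry a) = e at he he'
  subst he
  have hent := pub_prog.1 ha'
  refine ⟨e, rfl, ha'.closed 0, .out ?_ (.out ?_ ?_)⟩
  · have := Msg.call_of (φ := φ) hent hn ⟨hp.1, hp.2, hp.3, hp.4, ha', hp.6⟩ hq'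
    simpa [he', e₃, hq] using this
  · simpa [he'] using Msg.ext_channel hent
  refine .inp_tag_eq_var fun x hx hm => ?_
  simp [he'] at hm
  have hpub := hm.ret_inv
  refine .let_eq (T' := .get_entry (.pp x)) (by simp) fun hd => ?_
  -- Reading the protected program is a public operation on a public state; since `get_entry` fires,
  -- the result is a program whose entry point is public or one of the private ones.
  have hpp : Pub (ev (Th c b) (.pp x)) := pub_ev_app (by simp [Sym.priv])
    (by simpa [Fin.forall_fin_succ, hx] using hpub)
  rw [eval_get_entry hd] at hpp
  have hf' := ev_ev (c := c) (b := b) (.get_entry (.pp x))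
  generalize ev (Th c b) (.get_entry (.pp x)) = f at hpp hf'
  have hf := pub_prog.1 hpp
  refine ⟨f, rfl, hpp.closed 0, .out ?_ (.out ?_ .nil)⟩
  · simpa [hf', hx] using Msg.start_of (φ := φ) hf hpub
  · simpa [hf'] using Msg.ext_channel hf

theorem goodIn_execProc : GoodIn c b φ σ execProc :=
  .par goodIn_cpuProc (.par (.repl goodIn_initProc) (.par goodIn_setupProc
    (.par goodIn_dataProc (.repl goodIn_ppProc))))

theorem good_DRT : Good c b φ DRT :=
  GoodIn.good (.par (goodIn_tpmProc fun _ => goodIn_pcrExtend) goodIn_execProc)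

theorem good_DRTb (hc : c) (hb : 2 ≤ b) : Good c b φ DRTb :=
  GoodIn.good (.par (goodIn_tpmProc fun _ => goodIn_pcrExtendB hc hb) goodIn_execProc)

end

/-! ### The properties -/

/-- No key name is in `Pub`, which gives secrecy; integrity is the field `trusted` of the evaluated
state. -/
theorem sat_of_good {c : Prop} {b : ℕ} {P : Proc} (hP : ∀ φ, Good c b φ P) {Φ : Property}
    (hΦ : Φ ∈ ({PhiSec, PhiInt} : Set Property)) : Sat (Th c b) P Φ := by
  intro A hA σ hatt
  have h := pub_of_att hP hatt
  rcases hΦ with rfl | rfl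
  · obtain ⟨i, rfl⟩ := hA
    exact not_pub.2.2.2.2 i h
  · obtain rfl := hA
    have e : ∀ x y z w u v : Term, ev (Th c b)
        (.state (.tpm hchain) (.cpu x y) (.smram z w) (.drt u v .tt)) =
        .state (.tpm hchain) (.cpu (ev (Th c b) x) (ev (Th c b) y))
          (.smram (ev (Th c b) z) (ev (Th c b) w)) (.drt (ev (Th c b) u) (ev (Th c b) v) .tt) := by
      simp
    have h' := (e (σ .xint) (σ .xcache) (σ .xstm) (σ .xsmi) (σ .xinit) (σ .xpp)) ▸
      (show Pub (ev (Th c b) (.state (.tpm hchain) (.cpu (σ .xint) (σ .xcache))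
        (.smram (σ .xstm) (σ .xsmi)) (.drt (σ .xinit) (σ .xpp) .tt))) by
        simpa [Term.chain] using h)
    obtain ⟨h1, h2, h3, -⟩ := (pub_state.1 h').2.2.2.2.2.2.2.2.trusted rfl
    simp [holdsConcl, EqE_iff, h1, h2, h3]

end Drt

theorem mainTheorem2 (b : ℕ) (hb : 2 ≤ b) (Φ : Drt.Property)
    (hΦ : Φ ∈ ({Drt.PhiSec, Drt.PhiInt} : Set Drt.Property)) :
    Drt.Sat Drt.Edrt Drt.DRT Φ ↔ Drt.Sat (Drt.Edrtb b) Drt.DRTb Φ := by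
  -- Each system satisfies the property outright; `2 ≤ b` is needed only for the bounded one.
  refine iff_of_true ?_ ?_
  · rw [← Drt.Th_false b]
    exact Drt.sat_of_good (fun _ => Drt.good_DRT) hΦ
  · rw [← Drt.Th_true b]
    exact Drt.sat_of_good (fun _ => Drt.good_DRTb trivial hb) hΦ
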